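/- **Theorem (Existence of growth constants).** Let $1\le k\le d$. Cells of the hypercubic lattice with vertex set $\mathbb Z^d$ are given by their centre coordinates; a $k$-cube has exactly $k$ half-integer and $d-k$ integer coordinates, and a $k$-cube $f$ (a *face*) neighbours the $(k-1)$-cubes (*hyperedges*) $f\pm\frac12 e_j$, for $j$ a half-integer dimension of $f$. All configurations below are finite and nonempty, are identified up to translation by $\mathbb Z^d$, and have hyperarea $n$ equal to their number of faces. * A *$(d,k)$-fixed polyominoid* (XD) is a set of $k$-faces with one connected component, where two faces are connected if they neighbour the same hyperedge. * A *$(d,k)$-self-avoiding manifold* (SAM) is an XD in which no hyperedge is neighboured by more than two faces. It is *closed* ($h=0$) if every hyperedge neighboured by one of its faces is neighboured by exactly two of them. * A *$(d,k)$-self-osculating manifold* (SOM) is a set of $k$-faces together with, at every hyperedge $g$, a pairing of the faces of the set that neighbour $g$ (all of them if their number $M$ is even, all but exactly one lone face if $M$ is odd; so two faces are connected if they are the only ones at $g$), such that the set has one connected component with respect to these connections, and at each hyperedge with $M>2$ the osculating condition holds: if $M$ is even, then for any two distinct pairs $\{f_1,f_2\}$, $\{f_3,f_4\}$ at $g$ the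 four faces are different, and $f_1-g=-(f_2-g)$ implies $(f_3-g)\perp(f_4-g)$; if $M$ is odd, then there is an unoccupied $k$-face position neighbouring $g$ which can be paired with the lone face so that the same condition holds for all the pairs. Let $c_n$ be the number of configurations of hyperarea $n$ in a given class. Then the growth constant $\mu=\lim_{n\to\infty}c_n^{1/n}$ exists (as a finite real number) for each of the four classes: closed $(d,k)$-SAMs, $(d,k)$-SAMs, $(d,k)$-SOMs and $(d,k)$-XDs. For closed SAMs, $c_n=0$ for every odd $n$, and the limit is taken through even $n$. -/

import Mathlib

open Filter Topology

noncomputable section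

namespace RestrictedManifold

/-- A cell of the hypercubic lattice with vertex set `ℤ^d`, recorded by *twice* its centre
coordinates: the entry at `i` is odd exactly when the `i`-th centre coordinate is a half-integer. -/
abbrev Cell (d : ℕ) : Type := Fin d → ℤ

/-- The half-integer dimensions (the orientation) of a cell. -/
def halfInt {d : ℕ} (c : Cell d) : Finset (Fin d) :=
  Finset.univ.filter fun i => Odd (c i)

/-- `c` is a `k`-cube: exactly `k` of its centre coordinates are half-integers. -/
def IsCube {d : ℕ} (k : ℕ) (c : Cell d) : Prop :=
  (halfInt c).card = k

/-- The `k`-cube `f` neighbours the `(k-1)`-cube `g`: the centre of `g` is `f ± (1/2) j` for some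
half-integer dimension `j` of `f` (a shift by `1` in doubled coordinates). -/
def Neighbours {d : ℕ} (f g : Cell d) : Prop :=
  ∃ j ∈ halfInt f, g = f + Pi.single j 1 ∨ g = f - Pi.single j 1

/-- The members of `S` that neighbour the hyperedge `g`. -/
def facesAt {d : ℕ} (S : Finset (Cell d)) (g : Cell d) : Finset (Cell d) :=
  open Classical in S.filter fun f => Neighbours f g

/-- Translation of a cell by the lattice vector `t` (which is `2 t` in doubled coordinates). -/
def shift {d : ℕ} (t : Fin d → ℤ) (c : Cell d) : Cell d :=
  fun i => c i + 2 * t i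

/-- `S` is nonempty and any two of its members are joined by a chain in `S` along `r`. -/
def ConnectedBy {d : ℕ} (S : Finset (Cell d)) (r : Cell d → Cell d → Prop) : Prop :=
  S.Nonempty ∧ ∀ f ∈ S, ∀ f' ∈ S,
    Relation.ReflTransGen (fun a b => a ∈ S ∧ b ∈ S ∧ r a b) f f'

/-- A fixed polyominoid: a set of `k`-faces with one connected component, where two faces are
connected when they neighbour the same hyperedge. -/
def IsXD {d : ℕ} (k : ℕ) (S : Finset (Cell d)) : Prop :=
  (∀ f ∈ S, IsCube k f) ∧ ConnectedBy S fun a b => ∃ g, Neighbours a g ∧ Neighbours b g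

/-- A self-avoiding manifold: moreover no hyperedge is neighboured by more than two faces. -/
def IsSAM {d : ℕ} (k : ℕ) (S : Finset (Cell d)) : Prop :=
  IsXD k S ∧ ∀ g, (facesAt S g).card ≤ 2

/-- A closed self-avoiding manifold (`h = 0` boundary components): every hyperedge neighboured
by a face of `S` is neighboured by exactly two of them. -/
def IsClosedSAM {d : ℕ} (k : ℕ) (S : Finset (Cell d)) : Prop :=
  IsSAM k S ∧ ∀ g, (facesAt S g).Nonempty → (facesAt S g).card = 2

/-- A finite set of faces together with connections: `conn g a b` says that the faces `a` and `b`
are connected at the hyperedge `g`. -/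
@[ext]
structure LinkedFaces (d : ℕ) where
  faces : Finset (Cell d)
  conn : Cell d → Cell d → Cell d → Prop

/-- `r` pairs up the members of `F`: all of them if their number is even, all but exactly one
(the lone one) if it is odd. For two faces this says that they are connected. -/
def IsPairing {d : ℕ} (F : Finset (Cell d)) (r : Cell d → Cell d → Prop) : Prop :=
  (∀ a b, r a b → a ∈ F ∧ b ∈ F ∧ a ≠ b) ∧
  (∀ a b, r a b → r b a) ∧
  (∀ a b c, r a b → r a c → b = c) ∧
  (Even F.card → ∀ a ∈ F, ∃ b, r a b) ∧
  (Odd F.card → ∃! a, a ∈ F ∧ ∀ b, ¬ r a b)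

/-- The osculating condition for the pairs of faces given by `r` at the hyperedge `g`: for any two
distinct pairs the four faces are different, and if the members of the first pair lie in opposite
directions from `g`, then those of the second lie in perpendicular directions. The differences
`f - g` are unit vectors in doubled coordinates. -/
def PairsOsculate {d : ℕ} (g : Cell d) (r : Cell d → Cell d → Prop) : Prop :=
  ∀ f₁ f₂ f₃ f₄, r f₁ f₂ → r f₃ f₄ → s(f₁, f₂) ≠ s(f₃, f₄) →
    [f₁, f₂, f₃, f₄].Nodup ∧ (f₁ - g = -(f₂ - g) → (f₃ - g) ⬝ᵥ (f₄ - g) = 0)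

/-- `r` with the pair of `a` and `x` added. -/
def addPair {d : ℕ} (r : Cell d → Cell d → Prop) (a x : Cell d) : Cell d → Cell d → Prop :=
  fun b c => r b c ∨ (b = a ∧ c = x) ∨ (b = x ∧ c = a)

/-- The osculating condition at `g` for the faces `F` with connections `r`. If the number of faces
is odd, it asks that some further face position `x` at `g` can be paired with the lone face so that
the condition for pairs holds. -/
def Osculating {d : ℕ} (g : Cell d) (F : Finset (Cell d)) (r : Cell d → Cell d → Prop) : Prop :=
  (Even F.card → PairsOsculate g r) ∧
  (Odd F.card → ∃ a ∈ F, (∀ b, ¬ r a b) ∧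
    ∃ x, x ∉ F ∧ Neighbours x g ∧ PairsOsculate g (addPair r a x))

/-- A self-osculating manifold. -/
def IsSOM {d : ℕ} (k : ℕ) (M : LinkedFaces d) : Prop :=
  (∀ f ∈ M.faces, IsCube k f) ∧
  (∀ g, IsPairing (facesAt M.faces g) (M.conn g)) ∧
  (∀ g, 2 < (facesAt M.faces g).card → Osculating g (facesAt M.faces g) (M.conn g)) ∧
  ConnectedBy M.faces fun a b => ∃ g, M.conn g a b

lemma shift_zero {d : ℕ} (c : Cell d) : shift 0 c = c := by
  ext i; simp [shift]

lemma shift_add {d : ℕ} (s t : Fin d → ℤ) (c : Cell d) :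
    shift (s + t) c = shift t (shift s c) := by
  ext i; simp only [shift, Pi.add_apply]; ring

lemma shift_neg {d : ℕ} (t : Fin d → ℤ) (c : Cell d) : shift (-t) (shift t c) = c := by
  rw [← shift_add]; simpa using shift_zero c

/-- Identification of sets of faces up to lattice translation. -/
def faceSetoid (d : ℕ) : Setoid (Finset (Cell d)) where
  r S T := ∃ t : Fin d → ℤ, T = S.image (shift t)
  iseqv :=
    { refl := fun S => ⟨0, by ext c; simp [shift_zero]⟩
      symm := by
        rintro S T ⟨t, rfl⟩
        refine ⟨-t, ?_⟩
        rw [Finset.image_image]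
        ext c; simp [shift_neg]
      trans := by
        rintro S T U ⟨s, rfl⟩ ⟨t, rfl⟩
        refine ⟨s + t, ?_⟩
        rw [Finset.image_image]
        ext c; simp [shift_add] }

/-- Identification of sets of faces with connections up to lattice translation. -/
def linkedSetoid (d : ℕ) : Setoid (LinkedFaces d) where
  r M N := ∃ t : Fin d → ℤ, N.faces = M.faces.image (shift t) ∧
    ∀ g a b, N.conn (shift t g) (shift t a) (shift t b) ↔ M.conn g a b
  iseqv :=
    { refl := fun M => ⟨0, by ext c; simp [shift_zero], by simp [shift_zero]⟩
      symm := by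
        rintro M N ⟨t, h, h'⟩
        refine ⟨-t, ?_, fun g a b => ?_⟩
        · rw [h, Finset.image_image]
          ext c; simp [shift_neg]
        · rw [← h']
          have e : ∀ c : Cell d, shift t (shift (-t) c) = c := fun c => by
            simpa using shift_neg (-t) c
          simp [e]
      trans := by
        rintro M N U ⟨s, h₁, h₁'⟩ ⟨t, h₂, h₂'⟩
        refine ⟨s + t, ?_, fun g a b => ?_⟩
        · rw [h₂, h₁, Finset.image_image]
          ext c; simp [shift_add]
        · rw [shift_add, shift_add, shift_add, h₂', h₁'] }

/-- The number of translation classes of `(d,k)`-fixed polyominoids with `k`-area `n`. -/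
def countXD (d k n : ℕ) : ℕ :=
  (Quotient.mk (faceSetoid d) '' {S | IsXD k S ∧ S.card = n}).ncard

/-- The number of translation classes of `(d,k)`-self-avoiding manifolds with `k`-area `n`. -/
def countSAM (d k n : ℕ) : ℕ :=
  (Quotient.mk (faceSetoid d) '' {S | IsSAM k S ∧ S.card = n}).ncard

/-- The number of translation classes of closed `(d,k)`-self-avoiding manifolds with
`k`-area `n`. -/
def countClosedSAM (d k n : ℕ) : ℕ :=
  (Quotient.mk (faceSetoid d) '' {S | IsClosedSAM k S ∧ S.card = n}).ncard

/-- The number of translation classes of `(d,k)`-self-osculating manifolds with `k`-area `n`. -/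
def countSOM (d k n : ℕ) : ℕ :=
  (Quotient.mk (linkedSetoid d) '' {M | IsSOM k M ∧ M.faces.card = n}).ncard

end RestrictedManifold

end

/-! Every limit comes from Fekete's lemma. What is needed is a way to combine two configurations
into one (supermultiplicativity) or to cut one into two (submultiplicativity), up to constant
factors and a bounded change of hyperarea. Finiteness of the limit is common to the gluing
arguments: a connected configuration of $n$ faces is traversed by a walk of $2n$ steps with
boundedly many choices each, so $c_n\le C^{n+1}$ (`finite_classes_and_ncard_le`).

XDs, SAMs and SOMs are treated together, as sets of faces with connections subject to a local
condition at each hyperedge. Fix a direction $x$. If two configurations each have a single rightmost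
face, with $x$ among its half-integer dimensions, then the second can be turned around by a point
reflection and a permutation of coordinates so that its extreme face continues that of the first.
The only new contact is one hyperedge with two faces. The gluing can be undone: the first piece is
the part of the union below some hyperplane, and its hyperarea singles it out
(`IsLower.image_shift`), so only the permutation must be remembered. It remains to give every
configuration such a rightmost face at bounded cost (`exists_growth_of_rightEnd`). For XDs one
further face suffices. For SAMs and SOMs with $k\ge2$, a rightmost face $s$ perpendicular to $x$ is
replaced by the sides of the cube over it (`exists_isTube`). The sides hang together because
$k\ge2$, and they take over the pairings of $s$. As faces at the hyperedges of $s$ now point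
elsewhere, the osculating condition may fail there; it is restored by changing pairings without
losing connectedness (`exists_repair`), because one of the two ways to re-pair two links of a
connected graph keeps it connected (`ConnectedBy.swap`).

For $k=1$ the two sides over an edge are not connected to each other, and another argument is used.
A one-dimensional SAM or SOM is a walk, possibly closed up. Step sequences of walks are
submultiplicative, since a piece of a walk is a walk. Conversely, dropping three edges near the ends
turns a walk into a manifold: the dropped edges supply the free positions required by the osculating
condition, and one of two possible cuts leaves distinct end vertices (`walkWords_le_classCount`).

Closed SAMs are cycles modulo two. The cochain `potential` has coboundary one on every face, so
their hyperarea is even. All rightmost faces of a cycle are perpendicular to $x$, and two closed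
manifolds are joined by putting two such faces opposite each other at unit distance and adding,
modulo two, the boundary of the cube between them (`Facing.isClosedSAM`). For $k=1$ connectedness
uses that a cycle crosses a hyperplane an even number of times. If $k<d$, all large even hyperareas
occur, because attaching a cube adds $2k$ and joining a block of four cubes adds $10k-2$; if $k=d$
there are no closed manifolds and the limit is $0$. -/

/-! ### Growth rates of almost sub- and supermultiplicative sequences -/

/-- Fekete's lemma for a sequence that is subadditive from some index on. -/
lemma tendsto_div_of_eventually_subadditive {v : ℕ → ℝ} {N : ℕ} (hN : 1 ≤ N)
    (h : ∀ m n, N ≤ m → N ≤ n → v (m + n) ≤ v m + v n) {C : ℝ}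
    (hC : ∀ n, N ≤ n → C * n ≤ v n) :
    ∃ L : ℝ, Tendsto (fun n : ℕ => v n / n) atTop (𝓝 L) := by
  have hmul : ∀ n r, N ≤ n → N ≤ r → ∀ k : ℕ, v (k * n + r) ≤ k * v n + v r := by
    intro n r hn hr k
    induction k with
    | zero => simp
    | succ k IH =>
      calc v ((k + 1) * n + r) = v (n + (k * n + r)) := by congr 1; ring
        _ ≤ v n + v (k * n + r) := h _ _ hn (hr.trans (Nat.le_add_left _ _))
        _ ≤ v n + (k * v n + v r) := by grw [IH]
        _ = (k + 1 : ℕ) * v n + v r := by push_cast; ring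
  set A : Set ℝ := (fun n : ℕ => v n / n) '' Set.Ici N with hA
  have hbdd : BddBelow A := by
    refine ⟨C, ?_⟩
    rintro _ ⟨n, hn, rfl⟩
    have hn' : (0 : ℝ) < n := by exact_mod_cast lt_of_lt_of_le (by omega : 0 < N) hn
    rw [le_div_iff₀ hn']
    exact hC n hn
  refine ⟨sInf A, tendsto_order.2 ⟨fun l hl => ?_, fun L hL => ?_⟩⟩
  · refine eventually_atTop.2 ⟨N, fun n hn => hl.trans_le (csInf_le hbdd ⟨n, hn, rfl⟩)⟩
  · obtain ⟨_, ⟨n, hn, rfl⟩, hnL⟩ := exists_lt_of_csInf_lt (s := A) ⟨_, ⟨N, Set.self_mem_Ici, rfl⟩⟩ hL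
    have hn : N ≤ n := hn
    have hn0 : n ≠ 0 := by omega
    refine .atTop_of_arithmetic hn0 fun r _ => ?_
    -- The remainder `r` may lie below `N`, where subadditivity is not available. So `N` multiples
    -- of `n` are moved into the remainder.
    have hr : N ≤ n * N + r := by nlinarith
    generalize hR : n * N + r = R at hr
    have hn' : (n : ℝ) ≠ 0 := by exact_mod_cast hn0
    have A : Tendsto (fun x : ℝ => (v n + v R / x) / (n + R / x)) atTop
        (𝓝 ((v n + 0) / (n + 0))) :=
      (tendsto_const_nhds.add <| tendsto_const_nhds.div_atTop tendsto_id).div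
        (tendsto_const_nhds.add <| tendsto_const_nhds.div_atTop tendsto_id) <| by simpa
    have B : Tendsto (fun x : ℝ => (x * v n + v R) / (x * n + R)) atTop (𝓝 (v n / n)) := by
      rw [add_zero, add_zero] at A
      refine A.congr' <| (eventually_ne_atTop 0).mono fun x hx => ?_
      simp only [add_div' _ _ _ hx, div_div_div_cancel_right₀ hx, mul_comm]
    have D := ((B.comp tendsto_natCast_atTop_atTop).comp (tendsto_sub_atTop_nat N)).eventually
      (gt_mem_nhds hnL)
    refine (D.and (eventually_ge_atTop N)).mono fun k hk => ?_
    obtain ⟨hk, hkN⟩ := hk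
    refine lt_of_le_of_lt ?_ hk
    obtain ⟨m, rfl⟩ := Nat.exists_eq_add_of_le hkN
    have e : n * (N + m) + r = m * n + R := by rw [← hR]; ring
    simp only [Function.comp_apply, e, Nat.add_sub_cancel_left]
    push_cast
    gcongr
    exact hmul n R hn hr m

lemma tendsto_rpow_of_tendsto_log_div {a : ℕ → ℝ} {L : ℝ} (ha : ∀ᶠ n in atTop, 0 < a n)
    (h : Tendsto (fun n : ℕ => Real.log (a n) / n) atTop (𝓝 L)) :
    Tendsto (fun n : ℕ => a n ^ ((1 : ℝ) / n)) atTop (𝓝 (Real.exp L)) := by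
  refine ((Real.continuous_exp.tendsto L).comp h).congr' (ha.mono fun n hn => ?_)
  simp only [Function.comp_apply, Real.rpow_def_of_pos hn, mul_one_div]

/-- Existence of the growth rate of a sequence that is supermultiplicative up to a constant
factor and a constant shift of the index. -/
lemma exists_tendsto_rpow_of_supermul {a : ℕ → ℕ} {K p N C : ℕ}
    (hsup : ∀ i j, a i * a j ≤ K * a (i + j + p)) (hpos : ∀ n, N ≤ n → 0 < a n)
    (hC : ∀ n, a n ≤ C ^ (n + 1)) :
    ∃ μ : ℝ, Tendsto (fun n : ℕ => (a n : ℝ) ^ ((1 : ℝ) / n)) atTop (𝓝 μ) := by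
  have hK : 0 < K := by
    rcases Nat.eq_zero_or_pos K with h | h
    · have := hsup N N
      have h2 := hpos N le_rfl
      subst h
      nlinarith
    · exact h
  have hC0 : 0 < C := by
    rcases Nat.eq_zero_or_pos C with h | h
    · have := hC N
      have h2 := hpos N le_rfl
      simp [h] at this
      omega
    · exact h
  -- Shifting the index by `p` and adding `log K` absorbs both defects, so that `v` is subadditive
  -- wherever the truncated subtraction is harmless.
  set v : ℕ → ℝ := fun n => Real.log K - Real.log (a (n - p)) with hv
  have hsub : ∀ m n, N + p + 1 ≤ m → N + p + 1 ≤ n → v (m + n) ≤ v m + v n := by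
    intro m n hm hn
    have h1 := hsup (m - p) (n - p)
    have e : m - p + (n - p) + p = m + n - p := by omega
    rw [e] at h1
    have p1 : (0 : ℝ) < a (m - p) := by exact_mod_cast hpos _ (by omega)
    have p2 : (0 : ℝ) < a (n - p) := by exact_mod_cast hpos _ (by omega)
    have p3 : (0 : ℝ) < a (m + n - p) := by exact_mod_cast hpos _ (by omega)
    have h2 : (a (m - p) : ℝ) * a (n - p) ≤ K * a (m + n - p) := by exact_mod_cast h1
    have h3 := Real.log_le_log (by positivity) h2
    rw [Real.log_mul p1.ne' p2.ne', Real.log_mul (by positivity) p3.ne'] at h3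
    simp only [hv]
    linarith
  -- The exponential bound keeps the infimum in Fekete's lemma finite; the factor 2 comes from `n -
  -- p + 1 ≤ 2 * n`.
  have hbd : ∀ n, N + p + 1 ≤ n → (-(2 * Real.log C)) * n ≤ v n := by
    intro n hn
    have p1 : (0 : ℝ) < a (n - p) := by exact_mod_cast hpos _ (by omega)
    have h1 : (a (n - p) : ℝ) ≤ (C : ℝ) ^ (n - p + 1) := by exact_mod_cast hC (n - p)
    have h2 := Real.log_le_log p1 h1
    rw [Real.log_pow] at h2
    have hC1 : 0 ≤ Real.log C := Real.log_natCast_nonneg C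
    have hK1 : 0 ≤ Real.log K := Real.log_natCast_nonneg K
    have h3 : ((n - p + 1 : ℕ) : ℝ) ≤ 2 * n := by
      have : n - p + 1 ≤ 2 * n := by omega
      exact_mod_cast this
    simp only [hv]
    nlinarith
  obtain ⟨L, hL⟩ := tendsto_div_of_eventually_subadditive (by omega) hsub hbd
  refine ⟨Real.exp (-L), tendsto_rpow_of_tendsto_log_div
    (eventually_atTop.2 ⟨N, fun n hn => by exact_mod_cast hpos n hn⟩) ?_⟩
  have hk : Tendsto (fun n : ℕ => Real.log K / (n : ℝ)) atTop (𝓝 0) :=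
    tendsto_const_nhds.div_atTop tendsto_natCast_atTop_atTop
  have hr : Tendsto (fun n : ℕ => ((n + p : ℕ) : ℝ) / n) atTop (𝓝 1) := by
    have : Tendsto (fun n : ℕ => 1 + (p : ℝ) / n) atTop (𝓝 (1 + 0)) :=
      tendsto_const_nhds.add (tendsto_const_nhds.div_atTop tendsto_natCast_atTop_atTop)
    rw [add_zero] at this
    refine this.congr' ((eventually_gt_atTop 0).mono fun n hn => ?_)
    have : (n : ℝ) ≠ 0 := by positivity
    push_cast
    field_simp
  have h1 := hk.sub ((hL.comp (tendsto_add_atTop_nat p)).mul hr)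
  rw [zero_sub, mul_one] at h1
  refine h1.congr' ((eventually_gt_atTop 0).mono fun n hn => ?_)
  have : (n : ℝ) ≠ 0 := by positivity
  have : ((n : ℝ) + p) ≠ 0 := by positivity
  simp only [hv, Function.comp_apply, Nat.add_sub_cancel]
  push_cast
  field_simp
  ring

/-- A sequence that agrees, up to constant factors and a bounded shift of the index, with a
submultiplicative one has a growth rate. -/
lemma exists_tendsto_rpow_of_submul {w c : ℕ → ℕ} {K p : ℕ} (hpos : ∀ n, 0 < w n)
    (hsub : ∀ i j, w (i + j) ≤ K * (w i * w j)) (hcw : ∀ n, c n ≤ K * w n)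
    (hwc : ∀ n, 1 ≤ n → w (n + p) ≤ K * c n) :
    ∃ μ : ℝ, Tendsto (fun n : ℕ => (c n : ℝ) ^ ((1 : ℝ) / n)) atTop (𝓝 μ) := by
  have hK : 0 < K := by
    rcases Nat.eq_zero_or_pos K with h | h
    · have := hsub 0 0
      have h2 := hpos 0
      subst h
      simp at this
      omega
    · exact h
  have hw : ∀ n, (0 : ℝ) < w n := fun n => by exact_mod_cast hpos n
  have hK' : (0 : ℝ) < K := by exact_mod_cast hK
  have hc : ∀ n, 1 ≤ n → (0 : ℝ) < c n := fun n hn => by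
    have h1 := hwc n hn
    have h2 := hpos (n + p)
    have : 0 < c n := Nat.pos_of_ne_zero fun h => by rw [h] at h1; omega
    exact_mod_cast this
  set v : ℕ → ℝ := fun n => Real.log K + Real.log (w n) with hv
  have hlog : ∀ m n, v (m + n) ≤ v m + v n := by
    intro m n
    have h1 : (w (m + n) : ℝ) ≤ K * (w m * w n) := by exact_mod_cast hsub m n
    have h2 := Real.log_le_log (hw _) h1
    rw [Real.log_mul hK'.ne' (mul_pos (hw _) (hw _)).ne',
      Real.log_mul (hw _).ne' (hw _).ne'] at h2
    simp only [hv]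
    linarith
  have hv0 : ∀ n, 0 ≤ v n := fun n =>
    add_nonneg (Real.log_natCast_nonneg K) (Real.log_natCast_nonneg _)
  obtain ⟨L, hL⟩ := tendsto_div_of_eventually_subadditive (C := 0) le_rfl
    (fun m n _ _ => hlog m n) (fun n _ => by simpa using hv0 n)
  refine ⟨Real.exp L, tendsto_rpow_of_tendsto_log_div
    (eventually_atTop.2 ⟨1, fun n hn => hc n hn⟩) ?_⟩
  have hk : ∀ B : ℝ, Tendsto (fun n : ℕ => B / (n : ℝ)) atTop (𝓝 0) := fun B =>
    tendsto_const_nhds.div_atTop tendsto_natCast_atTop_atTop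
  have hr : Tendsto (fun n : ℕ => ((n + p : ℕ) : ℝ) / n) atTop (𝓝 1) := by
    have : Tendsto (fun n : ℕ => 1 + (p : ℝ) / n) atTop (𝓝 (1 + 0)) :=
      tendsto_const_nhds.add (hk p)
    rw [add_zero] at this
    refine this.congr' ((eventually_gt_atTop 0).mono fun n hn => ?_)
    have : (n : ℝ) ≠ 0 := by positivity
    push_cast
    field_simp
  -- Lower bound for the squeeze: `w (n + p) ≤ K * c n` says `v (n + p) - 2 log K ≤ log (c n)`, one
  -- `log K` coming from the definition of `v`.
  have hlow : Tendsto (fun n : ℕ => (v (n + p) - 2 * Real.log K) / n) atTop (𝓝 L) := by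
    have h1 := ((hL.comp (tendsto_add_atTop_nat p)).mul hr).sub (hk (2 * Real.log K))
    rw [sub_zero, mul_one] at h1
    refine h1.congr' ((eventually_gt_atTop 0).mono fun n hn => ?_)
    have : (n : ℝ) ≠ 0 := by positivity
    have : ((n : ℝ) + p) ≠ 0 := by positivity
    simp only [Function.comp_apply]
    push_cast
    field_simp
  refine tendsto_of_tendsto_of_tendsto_of_le_of_le' hlow hL ?_ ?_
  · refine eventually_atTop.2 ⟨1, fun n hn => ?_⟩
    have h1 : (w (n + p) : ℝ) ≤ K * c n := by exact_mod_cast hwc n hn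
    have h2 := Real.log_le_log (hw _) h1
    rw [Real.log_mul hK'.ne' (hc n hn).ne'] at h2
    simp only [hv]
    gcongr
    linarith
  · refine eventually_atTop.2 ⟨1, fun n hn => ?_⟩
    have h1 : (c n : ℝ) ≤ K * w n := by exact_mod_cast hcw n
    have h2 := Real.log_le_log (hc n hn) h1
    rw [Real.log_mul hK'.ne' (hw _).ne'] at h2
    simp only [hv]
    gcongr

/-! ### Counting classes through correspondences -/

/-- Comparison of cardinalities through a correspondence that is injective up to a finite code. -/
lemma ncard_le_card_mul_ncard {P Q κ : Type*} [Fintype κ] {X : Set P} {Y : Set Q}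
    (hY : Y.Finite) (R : P → Q → κ → Prop) (hex : ∀ p ∈ X, ∃ q ∈ Y, ∃ c, R p q c)
    (hinj : ∀ p ∈ X, ∀ p' ∈ X, ∀ q ∈ Y, ∀ c, R p q c → R p' q c → p = p') :
    X.ncard ≤ Fintype.card κ * Y.ncard := by
  rcases X.eq_empty_or_nonempty with rfl | ⟨p₀, hp₀⟩
  · simp
  obtain ⟨q₀, -, c₀, -⟩ := hex p₀ hp₀
  have : Nonempty Q := ⟨q₀⟩
  have : Nonempty κ := ⟨c₀⟩
  choose! f hf g hg using hex
  have h1 := Set.ncard_le_ncard_of_injOn (s := X) (t := Y ×ˢ (Set.univ : Set κ))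
    (fun p => (f p, g p)) (fun p hp => ⟨hf p hp, trivial⟩)
    (fun p hp p' hp' h => by
      simp only [Prod.mk.injEq] at h
      exact hinj p hp p' hp' (f p) (hf p hp) (g p) (hg p hp)
        (by rw [h.1, h.2]; exact hg p' hp'))
    (hY.prod Set.finite_univ)
  rw [Set.ncard_prod, Set.ncard_univ, Nat.card_eq_fintype_card] at h1
  linarith

section Quotients

variable {α β γ κ : Type*} [Fintype κ] [sα : Setoid α] [sβ : Setoid β] [sγ : Setoid γ]

/-- A construction on representatives may depend on choices and need not descend to the quotients.
It suffices that equivalent results with equal codes have equivalent sources. -/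
lemma ncard_classes_le {A : Set α} {C : Set γ} (hC : (Quotient.mk sγ '' C).Finite)
    (R : α → γ → κ → Prop) (hex : ∀ a ∈ A, ∃ c ∈ C, ∃ k, R a c k)
    (hinj : ∀ a a' c c' k, a ∈ A → a' ∈ A → R a c k → R a' c' k → c ≈ c' → a ≈ a') :
    (Quotient.mk sα '' A).ncard ≤ Fintype.card κ * (Quotient.mk sγ '' C).ncard := by
  refine ncard_le_card_mul_ncard hC
    (fun p q k => ∃ a ∈ A, ∃ c, Quotient.mk sα a = p ∧ Quotient.mk sγ c = q ∧ R a c k) ?_ ?_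
  · rintro _ ⟨a, ha, rfl⟩
    obtain ⟨c, hc, k, h⟩ := hex a ha
    exact ⟨_, ⟨c, hc, rfl⟩, k, a, ha, c, rfl, rfl, h⟩
  · rintro _ - _ - _ - k ⟨a, ha, c, rfl, rfl, h⟩ ⟨a', ha', c', rfl, hc', h'⟩
    exact Quotient.sound (hinj a a' c c' k ha ha' h h' (sγ.symm (Quotient.exact hc')))

lemma ncard_classes_mul_le {A : Set α} {B : Set β} {C : Set γ}
    (hC : (Quotient.mk sγ '' C).Finite) (R : α → β → γ → κ → Prop)
    (hex : ∀ a ∈ A, ∀ b ∈ B, ∃ c ∈ C, ∃ k, R a b c k)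
    (hinj : ∀ a a' b b' c c' k, a ∈ A → a' ∈ A → b ∈ B → b' ∈ B →
      R a b c k → R a' b' c' k → c ≈ c' → a ≈ a' ∧ b ≈ b') :
    (Quotient.mk sα '' A).ncard * (Quotient.mk sβ '' B).ncard ≤
      Fintype.card κ * (Quotient.mk sγ '' C).ncard := by
  rw [← Set.ncard_prod]
  refine ncard_le_card_mul_ncard hC
    (fun p q k => ∃ a ∈ A, ∃ b ∈ B, ∃ c, Quotient.mk sα a = p.1 ∧ Quotient.mk sβ b = p.2 ∧
      Quotient.mk sγ c = q ∧ R a b c k) ?_ ?_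
  · rintro ⟨_, _⟩ ⟨⟨a, ha, rfl⟩, ⟨b, hb, rfl⟩⟩
    obtain ⟨c, hc, k, h⟩ := hex a ha b hb
    exact ⟨_, ⟨c, hc, rfl⟩, k, a, ha, b, hb, c, rfl, rfl, rfl, h⟩
  · rintro ⟨_, _⟩ - ⟨_, _⟩ - _ - k ⟨a, ha, b, hb, c, rfl, rfl, rfl, h⟩
      ⟨a', ha', b', hb', c', rfl, rfl, hc', h'⟩
    obtain ⟨h1, h2⟩ := hinj a a' b b' c c' k ha ha' hb hb' h h' (sγ.symm (Quotient.exact hc'))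
    exact Prod.ext (Quotient.sound h1) (Quotient.sound h2)

end Quotients

namespace RestrictedManifold

variable {d k : ℕ}

/-! ### Cells and their neighbours -/

/-- The unit vector (in doubled coordinates) in a signed coordinate direction. -/
def unit (v : Fin d × Bool) : Cell d := Pi.single v.1 (if v.2 then 1 else -1)

lemma unit_true (j : Fin d) : unit (j, true) = (Pi.single j 1 : Cell d) := by simp [unit]

lemma unit_false (j : Fin d) : unit (j, false) = -(Pi.single j 1 : Cell d) := by
  simp [unit, Pi.single_neg]

lemma unit_apply (v : Fin d × Bool) (i : Fin d) :
    unit v i = if i = v.1 then (if v.2 then 1 else -1) else 0 := by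
  simp [unit, Pi.single_apply]

lemma unit_apply_of_ne {v : Fin d × Bool} {i : Fin d} (h : i ≠ v.1) : unit v i = 0 := by
  simp [unit_apply, h]

lemma unit_self (v : Fin d × Bool) : unit v v.1 = 1 ∨ unit v v.1 = -1 := by
  rw [unit_apply]; cases v.2 <;> simp

lemma unit_injective : Function.Injective (unit : Fin d × Bool → Cell d) := by
  rintro ⟨i, b⟩ ⟨j, c⟩ h
  have h1 := congrFun h i
  have h2 : i = j := by
    by_contra hij
    rw [unit_apply, unit_apply] at h1
    cases b <;> simp [hij] at h1
  subst h2
  rw [unit_apply, unit_apply] at h1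
  cases b <;> cases c <;> simp at h1 ⊢

lemma neg_unit (v : Fin d × Bool) : -unit v = unit (v.1, !v.2) := by
  ext i; rw [Pi.neg_apply, unit_apply, unit_apply]; cases v.2 <;> simp [neg_ite]

lemma mem_halfInt {c : Cell d} {i : Fin d} : i ∈ halfInt c ↔ Odd (c i) := by simp [halfInt]

lemma neighbours_iff {f g : Cell d} :
    Neighbours f g ↔ ∃ v, v.1 ∈ halfInt f ∧ g = f + unit v := by
  constructor
  · rintro ⟨j, hj, rfl | rfl⟩
    · exact ⟨(j, true), hj, by rw [unit_true]⟩
    · exact ⟨(j, false), hj, by rw [unit_false]; abel⟩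
  · rintro ⟨⟨j, b⟩, hj, rfl⟩
    cases b
    · exact ⟨j, hj, Or.inr (by rw [unit_false]; abel)⟩
    · exact ⟨j, hj, Or.inl (by rw [unit_true])⟩

lemma odd_add_unit_self (f : Cell d) (v : Fin d × Bool) :
    Odd ((f + unit v) v.1) ↔ ¬ Odd (f v.1) := by
  rw [Pi.add_apply]
  rcases unit_self v with h | h <;> rw [h] <;> constructor <;> intro h2 <;> grind

lemma halfInt_add_unit {f : Cell d} {v : Fin d × Bool} (hv : v.1 ∈ halfInt f) :
    halfInt (f + unit v) = (halfInt f).erase v.1 := by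
  ext i
  rw [Finset.mem_erase, mem_halfInt, mem_halfInt]
  by_cases h : i = v.1
  · subst h
    rw [odd_add_unit_self, ← mem_halfInt]
    simp [hv]
  · simp [unit_apply_of_ne h, h]

lemma halfInt_add_unit_insert {g : Cell d} {v : Fin d × Bool} (hv : v.1 ∉ halfInt g) :
    halfInt (g + unit v) = insert v.1 (halfInt g) := by
  ext i
  rw [Finset.mem_insert, mem_halfInt, mem_halfInt]
  by_cases h : i = v.1
  · subst h
    rw [odd_add_unit_self, ← mem_halfInt]
    simp [hv]
  · simp [unit_apply_of_ne h, h]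

lemma neighbours_iff' {f g : Cell d} :
    Neighbours f g ↔ ∃ v, v.1 ∉ halfInt g ∧ f = g + unit v := by
  rw [neighbours_iff]
  constructor
  · rintro ⟨v, hv, rfl⟩
    refine ⟨(v.1, !v.2), ?_, by rw [← neg_unit]; abel⟩
    rw [halfInt_add_unit hv]; simp
  · rintro ⟨v, hv, rfl⟩
    refine ⟨(v.1, !v.2), ?_, by rw [← neg_unit]; abel⟩
    rw [halfInt_add_unit_insert hv]; simp

lemma neighbours_add_unit {f : Cell d} {v : Fin d × Bool} (hv : v.1 ∈ halfInt f) :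
    Neighbours f (f + unit v) := neighbours_iff.2 ⟨v, hv, rfl⟩

lemma neighbours_of_add_unit {g : Cell d} {v : Fin d × Bool} (hv : v.1 ∉ halfInt g) :
    Neighbours (g + unit v) g := neighbours_iff'.2 ⟨v, hv, rfl⟩

lemma mem_facesAt {S : Finset (Cell d)} {f g : Cell d} :
    f ∈ facesAt S g ↔ f ∈ S ∧ Neighbours f g := by simp [facesAt]

lemma facesAt_subset (S : Finset (Cell d)) (g : Cell d) : facesAt S g ⊆ S := fun _ h =>
  (mem_facesAt.1 h).1

lemma neighbours_shift {t : Fin d → ℤ} {f g : Cell d} :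
    Neighbours (shift t f) (shift t g) ↔ Neighbours f g := by
  have hs : ∀ c : Cell d, shift t c = c + fun i => 2 * t i := fun c => rfl
  rw [neighbours_iff, neighbours_iff]
  refine exists_congr fun v => and_congr ?_ ?_
  · rw [mem_halfInt, mem_halfInt, hs, Pi.add_apply]
    constructor <;> intro h <;> grind
  · rw [hs, hs, add_right_comm, add_left_inj]

lemma shift_injective (t : Fin d → ℤ) : Function.Injective (shift t : Cell d → Cell d) :=
  fun a b h => by rw [← shift_neg t a, h, shift_neg]

lemma exists_shift_eq_of_parity {r r' : Cell d} (h : ∀ i, Odd (r i) ↔ Odd (r' i)) :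
    ∃ t, shift t r = r' := by
  refine ⟨fun i => (r' i - r i) / 2, ?_⟩
  ext i
  have := h i
  simp only [shift]
  rw [Int.odd_iff, Int.odd_iff] at this
  omega

lemma shift_eq_add (t : Fin d → ℤ) (c : Cell d) : shift t c = c + fun i => 2 * t i := rfl

/-! ### Chains and an exponential upper bound -/

/-- A chain that leaves a set crosses its boundary. -/
lemma exists_crossing {α : Type*} {r : α → α → Prop} {p : α → Prop} {a b : α}
    (h : Relation.ReflTransGen r a b) (ha : p a) (hb : ¬ p b) : ∃ u v, p u ∧ ¬ p v ∧ r u v := by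
  induction h with
  | refl => exact absurd ha hb
  | @tail b c _ hbc ih =>
    by_cases hp : p b
    · exact ⟨b, c, hp, hb, hbc⟩
    · exact ih hp

/-- Steps from a face to itself can be dropped from a chain, so the relations need only be compared
on distinct faces. -/
lemma connectedBy_congr {S : Finset (Cell d)} {r r' : Cell d → Cell d → Prop}
    (h : ∀ a ∈ S, ∀ b ∈ S, a ≠ b → r a b → r' a b) (hS : ConnectedBy S r) : ConnectedBy S r' := by
  refine ⟨hS.1, fun f hf f' hf' => ?_⟩
  induction hS.2 f hf f' hf' with
  | refl => exact .refl
  | @tail b c h1 h2 ih =>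
    by_cases hbc : b = c
    · subst hbc; exact ih h2.1
    · exact (ih h2.1).tail ⟨h2.1, h2.2.1, h b h2.1 c h2.2.1 hbc h2.2.2⟩

/-- A displacement all of whose entries are between `-2` and `2`. -/
def disp (δ : Fin d → Fin 5) : Cell d := fun i => (δ i : ℤ) - 2

/-- The labelled cells visited by a walk given by its successive displacements. -/
def visited {κ : Type*} : Cell d → List ((Fin d → Fin 5) × κ) → Set (Cell d × κ)
  | _, [] => ∅
  | r, s :: l => insert (r + disp s.1, s.2) (visited (r + disp s.1) l)

lemma visited_add {κ : Type*} (l : List ((Fin d → Fin 5) × κ)) (r s : Cell d) :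
    visited (r + s) l = (fun p : Cell d × κ => (p.1 + s, p.2)) '' visited r l := by
  induction l generalizing r with
  | nil => simp [visited]
  | cons a l ih =>
    simp only [visited, Set.image_insert_eq]
    rw [add_right_comm, ih]

lemma disp_two : disp (fun _ => 2 : Fin d → Fin 5) = 0 := by ext i; simp [disp]

lemma exists_visited_of_chain {κ : Type*} {L : List (Cell d)} (lab : Cell d → κ) (a : Cell d)
    (h : (a :: L).IsChain fun a b => ∃ δ, b = a + disp δ) :
    ∃ l : List ((Fin d → Fin 5) × κ), l.length = L.length ∧
      visited a l = (fun f => (f, lab f)) '' {f | f ∈ L} := by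
  induction L generalizing a with
  | nil => exact ⟨[], rfl, by simp [visited]⟩
  | cons b L ih =>
    rw [List.isChain_cons_cons] at h
    obtain ⟨⟨δ, rfl⟩, h⟩ := h
    obtain ⟨l, hl, hv⟩ := ih _ h
    refine ⟨(δ, lab (a + disp δ)) :: l, by simp [hl], ?_⟩
    simp only [visited, hv]
    ext p
    simp [eq_comm]

/-- As long as faces are missing, some visited `u` has an unvisited neighbour `v`. Replacing one
occurrence of `u` by the detour `u v u` visits one more face at the cost of two steps. -/
lemma exists_covering_chain {S : Finset (Cell d)} {r : Cell d → Cell d → Prop}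
    (hr : ∀ a b, r a b → r b a) (hS : ConnectedBy S r) {r₀ : Cell d} (h₀ : r₀ ∈ S) (m : ℕ)
    (hm : m + 1 ≤ S.card) : ∃ L : List (Cell d), (r₀ :: L).IsChain r ∧ L.length = 2 * m ∧
      (∀ f ∈ r₀ :: L, f ∈ S) ∧ (r₀ :: L).toFinset.card = m + 1 := by
  induction m with
  | zero => exact ⟨[], by simp, rfl, by simpa using h₀, by simp⟩
  | succ m ih =>
    obtain ⟨L, hL, hlen, hLS, hcard⟩ := ih (by omega)
    obtain ⟨w, hwS, hw⟩ : ∃ w ∈ S, w ∉ (r₀ :: L).toFinset := by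
      by_contra! hcon
      have := Finset.card_le_card hcon
      omega
    obtain ⟨u, v, hu, hv, huv⟩ := exists_crossing (p := fun f => f ∈ r₀ :: L)
      (hS.2 r₀ h₀ w hwS) (by simp) (by simpa using hw)
    obtain ⟨L₁, L₂, hL12⟩ := List.append_of_mem hu
    have hsplit := hL
    rw [hL12, List.isChain_split] at hsplit
    have hnew : (L₁ ++ u :: v :: u :: L₂).IsChain r := by
      rw [List.isChain_split]
      exact ⟨hsplit.1, List.isChain_cons_cons.2 ⟨huv.2.2,
        List.isChain_cons_cons.2 ⟨hr _ _ huv.2.2, hsplit.2⟩⟩⟩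
    have hmem : ∀ f, f ∈ L₁ ++ u :: v :: u :: L₂ ↔ f = v ∨ f ∈ r₀ :: L := by
      intro f
      rw [hL12]
      simp only [List.mem_append, List.mem_cons]
      tauto
    obtain ⟨L', hL'⟩ : ∃ L', L₁ ++ u :: v :: u :: L₂ = r₀ :: L' := by
      rcases L₁ with _ | ⟨b, L₁⟩
      · simp only [List.nil_append, List.cons.injEq] at hL12
        exact ⟨_, by rw [hL12.1]; rfl⟩
      · simp only [List.cons_append, List.cons.injEq] at hL12
        exact ⟨_, by rw [hL12.1]; rfl⟩
    have hl1 := congrArg List.length hL'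
    have hl2 := congrArg List.length hL12
    simp only [List.length_append, List.length_cons] at hl1 hl2
    rw [hL'] at hnew hmem
    refine ⟨L', hnew, by omega, fun f hf => ?_, ?_⟩
    · rcases (hmem f).1 hf with rfl | h
      · exact huv.2.1
      · exact hLS f h
    · have : (r₀ :: L').toFinset = insert v (r₀ :: L).toFinset := by
        ext f
        rw [Finset.mem_insert, List.mem_toFinset, List.mem_toFinset]
        exact hmem f
      rw [this, Finset.card_insert_of_notMem (by simpa using hv), hcard]

lemma exists_visited_eq {κ : Type*} {S : Finset (Cell d)} {r : Cell d → Cell d → Prop}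
    (hr : ∀ a b, r a b → r b a) (hd : ∀ a b, r a b → ∃ δ, b = a + disp δ)
    (hS : ConnectedBy S r) (lab : Cell d → κ) {r₀ : Cell d} (h₀ : r₀ ∈ S) :
    ∃ l : List ((Fin d → Fin 5) × κ), l.length = 2 * S.card ∧
      visited r₀ l = (fun f => (f, lab f)) '' (S : Set (Cell d)) := by
  have hpos := Finset.card_pos.2 ⟨r₀, h₀⟩
  obtain ⟨L, hL, hlen, hLS, hcard⟩ :=
    exists_covering_chain hr hS h₀ (S.card - 1) (by omega)
  obtain ⟨l, hl, hv⟩ := exists_visited_of_chain lab r₀ (L := L) (hL.imp fun a b h => hd a b h)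
  -- Two zero displacements: one records the starting cell, which `visited` leaves out, and the
  -- other pads the length from `2 * S.card - 1` to `2 * S.card`.
  refine ⟨(fun _ => 2, lab r₀) :: (fun _ => 2, lab r₀) :: l, ?_, ?_⟩
  · simp only [List.length_cons]; omega
  · have hT : (r₀ :: L).toFinset = S :=
      Finset.eq_of_subset_of_card_le (fun f hf => hLS f (List.mem_toFinset.1 hf)) (by omega)
    simp only [visited, disp_two, add_zero, hv]
    rw [← hT]
    ext p
    simp [eq_comm]

lemma exists_disp_of_neighbours {a b g : Cell d} (ha : Neighbours a g) (hb : Neighbours b g) :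
    ∃ δ, b = a + disp δ := by
  obtain ⟨v, -, rfl⟩ := neighbours_iff'.1 ha
  obtain ⟨w, -, rfl⟩ := neighbours_iff'.1 hb
  have key : ∀ i, 0 ≤ unit w i - unit v i + 2 ∧ unit w i - unit v i + 2 < 5 := by
    intro i
    rw [unit_apply, unit_apply]
    split_ifs <;> norm_num
  refine ⟨fun i => ⟨(unit w i - unit v i + 2).toNat, by have := key i; omega⟩, ?_⟩
  ext i
  have := key i
  simp only [disp, Pi.add_apply]
  omega

namespace LinkedFaces

/-- Connections only relate distinct faces that neighbour the hyperedge in question. -/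
def Supported (M : LinkedFaces d) : Prop :=
  ∀ g a b, M.conn g a b → a ∈ facesAt M.faces g ∧ b ∈ facesAt M.faces g ∧ a ≠ b

/-- The connections of `f` as seen from `f`. -/
def label (M : LinkedFaces d) (f : Cell d) : Fin d × Bool → Fin d × Bool → Prop :=
  fun v w => M.conn (f + unit v) f (f + unit v + unit w)

/-- The connections are recovered from the labels of the faces, so a labelled traversal determines
the whole structure. -/
lemma Supported.conn_iff {M : LinkedFaces d} (hM : M.Supported) {g a b : Cell d} :
    M.conn g a b ↔
      a ∈ M.faces ∧ ∃ v w, g = a + unit v ∧ b = a + unit v + unit w ∧ M.label a v w := by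
  constructor
  · intro h
    obtain ⟨ha, hb, -⟩ := hM g a b h
    obtain ⟨v, -, rfl⟩ := neighbours_iff.1 (mem_facesAt.1 ha).2
    obtain ⟨w, -, rfl⟩ := neighbours_iff'.1 (mem_facesAt.1 hb).2
    exact ⟨(mem_facesAt.1 ha).1, v, w, rfl, rfl, h⟩
  · rintro ⟨-, v, w, rfl, rfl, h⟩
    exact h

end LinkedFaces

lemma finite_and_ncard_le_card {P κ : Type*} [Fintype κ] {X : Set P} (R : P → κ → Prop)
    (hex : ∀ p ∈ X, ∃ c, R p c) (hinj : ∀ p p' c, R p c → R p' c → p = p') :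
    X.Finite ∧ X.ncard ≤ Fintype.card κ := by
  constructor
  · choose f hf using fun p : X => hex p p.2
    exact Finite.of_injective f fun p p' h =>
      Subtype.ext (hinj _ _ _ (hf p) (h ▸ hf p'))
  · simpa using ncard_le_card_mul_ncard (Set.finite_singleton ()) (fun p _ c => R p c)
      (fun p hp => ⟨(), rfl, hex p hp⟩) (fun p _ p' _ _ _ c h h' => hinj p p' c h h')

/-- Translation classes of connected structures of `n` faces are at most exponentially many. -/
lemma finite_classes_and_ncard_le (d : ℕ) : ∃ C : ℕ, ∀ (P : LinkedFaces d → Prop),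
    (∀ M, P M → M.Supported ∧ ConnectedBy M.faces fun a b => ∃ g, M.conn g a b) → ∀ n,
    (Quotient.mk (linkedSetoid d) '' {M | P M ∧ M.faces.card = n}).Finite ∧
    (Quotient.mk (linkedSetoid d) '' {M | P M ∧ M.faces.card = n}).ncard ≤ C ^ (n + 1) := by
  classical
  set D := (Fin d → Fin 5) × (Fin d × Bool → Fin d × Bool → Prop) with hD
  -- A class is coded by a traversal of `2 * n` labelled steps, each with `Fintype.card D` choices,
  -- and by the parities of the coordinates of its starting cell.
  refine ⟨Fintype.card D ^ 2 * 2 ^ d, fun P hP n => ?_⟩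
  have key := finite_and_ncard_le_card (κ := List.Vector D (2 * n) × (Fin d → Bool))
    (X := Quotient.mk (linkedSetoid d) '' {M | P M ∧ M.faces.card = n})
    (fun p c => ∃ M : LinkedFaces d, Quotient.mk (linkedSetoid d) M = p ∧ M.Supported ∧
      ∃ r : Cell d, (∀ i, c.2 i = true ↔ Odd (r i)) ∧
        visited r c.1.toList = (fun f => (f, M.label f)) '' (M.faces : Set (Cell d))) ?_ ?_
  · refine ⟨key.1, key.2.trans ?_⟩
    rw [Fintype.card_prod, card_vector, Fintype.card_fun, Fintype.card_bool, Fintype.card_fin,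
      mul_pow, ← pow_mul, pow_succ' (2 ^ d)]
    have h1 : 0 < Fintype.card D := Fintype.card_pos
    have h2 : 1 ≤ (2 ^ d) ^ n := Nat.one_le_pow _ _ (by positivity)
    have h3 : Fintype.card D ^ (2 * n) ≤ Fintype.card D ^ (2 * (n + 1)) :=
      Nat.pow_le_pow_right h1 (by omega)
    calc _ ≤ Fintype.card D ^ (2 * (n + 1)) * (2 ^ d * 1) := by
          rw [mul_one]; exact Nat.mul_le_mul_right _ h3
      _ ≤ _ := by gcongr
  · rintro _ ⟨M, ⟨hM, hn⟩, rfl⟩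
    obtain ⟨hsup, hcon⟩ := hP M hM
    obtain ⟨r, hr⟩ := hcon.1
    have hcon' : ConnectedBy M.faces fun a b => ∃ g, Neighbours a g ∧ Neighbours b g := by
      refine connectedBy_congr (fun a _ b _ _ => ?_) hcon
      rintro ⟨g, hg⟩
      exact ⟨g, (mem_facesAt.1 (hsup _ _ _ hg).1).2, (mem_facesAt.1 (hsup _ _ _ hg).2.1).2⟩
    obtain ⟨l, hl, hv⟩ := exists_visited_eq (fun a b ⟨g, h, h'⟩ => ⟨g, h', h⟩)
      (fun a b ⟨g, h, h'⟩ => exists_disp_of_neighbours h h') hcon' M.label hr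
    exact ⟨(⟨l, by rw [hl, hn]⟩, fun i => decide (Odd (r i))), M, rfl, hsup, r,
      fun i => by simp, hv⟩
  · rintro _ _ c ⟨M, rfl, hM, r, hr, hv⟩ ⟨N, rfl, hN, r', hr', hv'⟩
    -- Equal parities make the starting cells lattice translates of each other, and the common
    -- displacements carry this translation over to all visited cells.
    obtain ⟨t, rfl⟩ := exists_shift_eq_of_parity (r := r) (r' := r')
      (fun i => by rw [← hr, ← hr'])
    rw [shift_eq_add, visited_add, hv, Set.image_image] at hv'
    have hmem : ∀ f k, (f ∈ M.faces ∧ M.label f = k) ↔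
        (shift t f ∈ N.faces ∧ N.label (shift t f) = k) := by
      intro f k
      have h1 := Set.ext_iff.1 hv' (shift t f, k)
      simp only [Set.mem_image, Finset.mem_coe, Prod.mk.injEq] at h1
      constructor
      · rintro ⟨hf, rfl⟩
        obtain ⟨x, hx, rfl, h2⟩ := h1.1 ⟨f, hf, rfl, rfl⟩
        exact ⟨hx, h2⟩
      · rintro ⟨hf, rfl⟩
        obtain ⟨x, hx, h2, h3⟩ := h1.2 ⟨_, hf, rfl, rfl⟩
        obtain rfl : x = f := shift_injective t h2
        exact ⟨hx, h3⟩
    have hfaces : ∀ f, f ∈ M.faces ↔ shift t f ∈ N.faces := fun f => by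
      simpa using exists_congr (hmem f)
    refine Quotient.sound ⟨t, ?_, fun g a b => ?_⟩
    · ext c
      have e : shift t (shift (-t) c) = c := by simpa using shift_neg (-t) c
      rw [Finset.mem_image]
      constructor
      · intro hc
        exact ⟨shift (-t) c, (hfaces _).2 (by rwa [e]), e⟩
      · rintro ⟨f, hf, rfl⟩
        exact (hfaces f).1 hf
    · rw [hM.conn_iff, hN.conn_iff, ← hfaces]
      refine and_congr_right fun ha => exists_congr fun v => exists_congr fun w => ?_
      rw [((hmem a (M.label a)).1 ⟨ha, rfl⟩).2]
      refine and_congr ?_ (and_congr_left fun _ => ?_)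
      · rw [shift_eq_add, shift_eq_add, add_right_comm, add_left_inj]
      · rw [shift_eq_add, shift_eq_add]
        generalize (fun i => 2 * t i : Cell d) = T
        rw [show a + T + unit v + unit w = a + unit v + unit w + T by abel, add_left_inj]

/-- A set of faces in which any two faces at a common hyperedge are connected. -/
def fullLink (S : Finset (Cell d)) : LinkedFaces d :=
  ⟨S, fun g a b => a ∈ facesAt S g ∧ b ∈ facesAt S g ∧ a ≠ b⟩

lemma supported_fullLink (S : Finset (Cell d)) : (fullLink S).Supported :=
  fun _ _ _ h => h

lemma fullLink_equiv_iff {S T : Finset (Cell d)} :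
    linkedSetoid d (fullLink S) (fullLink T) ↔ faceSetoid d S T := by
  constructor
  · rintro ⟨t, h, -⟩
    exact ⟨t, h⟩
  · rintro ⟨t, rfl⟩
    refine ⟨t, rfl, fun g a b => ?_⟩
    have hm : ∀ c, c ∈ facesAt S g ↔ shift t c ∈ facesAt (S.image (shift t)) (shift t g) := by
      intro c
      rw [mem_facesAt, mem_facesAt, neighbours_shift, Finset.mem_image]
      refine and_congr_left fun _ => ⟨fun h => ⟨c, h, rfl⟩, ?_⟩
      rintro ⟨c', h, h'⟩
      rwa [← shift_injective t h']
    change _ ∧ _ ∧ _ ↔ _ ∧ _ ∧ _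
    rw [← hm, ← hm, (shift_injective t).ne_iff]

/-- Carries the three counts of bare sets of faces over to linked faces, where the common machinery
applies. -/
lemma ncard_faceClasses_eq (A : Set (Finset (Cell d))) :
    (Quotient.mk (faceSetoid d) '' A).ncard =
      (Quotient.mk (linkedSetoid d) '' (fullLink '' A)).ncard ∧
    ((Quotient.mk (linkedSetoid d) '' (fullLink '' A)).Finite →
      (Quotient.mk (faceSetoid d) '' A).Finite) := by
  set F : Quotient (faceSetoid d) → Quotient (linkedSetoid d) :=
    Quotient.map fullLink fun S T h => fullLink_equiv_iff.2 h with hF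
  have hinj : Function.Injective F := by
    rintro ⟨S⟩ ⟨T⟩ h
    exact Quotient.sound (fullLink_equiv_iff.1 (Quotient.exact h))
  have e : Quotient.mk (linkedSetoid d) '' (fullLink '' A) =
      F '' (Quotient.mk (faceSetoid d) '' A) := by
    rw [Set.image_image, Set.image_image]; rfl
  rw [e, Set.ncard_image_of_injective _ hinj]
  exact ⟨rfl, fun h => h.of_finite_image hinj.injOn⟩

lemma connectedBy_fullLink_iff {S : Finset (Cell d)} :
    (ConnectedBy S fun a b => ∃ g, (fullLink S).conn g a b) ↔
      ConnectedBy S fun a b => ∃ g, Neighbours a g ∧ Neighbours b g := by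
  constructor
  · refine connectedBy_congr fun a _ b _ _ => ?_
    rintro ⟨g, h⟩
    exact ⟨g, (mem_facesAt.1 h.1).2, (mem_facesAt.1 h.2.1).2⟩
  · refine connectedBy_congr fun a ha b hb hab => ?_
    rintro ⟨g, h, h'⟩
    exact ⟨g, mem_facesAt.2 ⟨ha, h⟩, mem_facesAt.2 ⟨hb, h'⟩, hab⟩


/-! ### Classes of linked faces and their gluing -/

/-- The number of translation classes of the structures with `n` faces and property `P`. -/
noncomputable def classCount (P : LinkedFaces d → Prop) (n : ℕ) : ℕ :=
  (Quotient.mk (linkedSetoid d) '' {M | P M ∧ M.faces.card = n}).ncard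

/-- A local condition on the faces at a hyperedge and their connections. -/
abbrev LocalCond (d : ℕ) : Type :=
  Cell d → Finset (Cell d) → (Cell d → Cell d → Prop) → Prop

/-- Connected structures made of `k`-cubes that satisfy a local condition at every hyperedge. -/
structure InClass (k : ℕ) (Loc : LocalCond d) (M : LinkedFaces d) : Prop where
  cube : ∀ f ∈ M.faces, IsCube k f
  supp : M.Supported
  loc : ∀ g, Loc g (facesAt M.faces g) (M.conn g)
  conn : ConnectedBy M.faces fun a b => ∃ g, M.conn g a b

/-- The connection of two faces. -/
def pairRel (f f' : Cell d) : Cell d → Cell d → Prop :=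
  fun a b => (a = f ∧ b = f') ∨ (a = f' ∧ b = f)

/-- The local conditions hold for at most two faces, which are connected. -/
structure LocalCond.Basic (Loc : LocalCond d) : Prop where
  empty : ∀ g, Loc g ∅ fun _ _ => False
  single : ∀ g f, Loc g {f} fun _ _ => False
  pair : ∀ g f f', f ≠ f' → Loc g {f, f'} (pairRel f f')

lemma finite_classes_inClass {P : LinkedFaces d → Prop} {Loc : LocalCond d}
    (hP : ∀ M, P M → InClass k Loc M) (n : ℕ) :
    (Quotient.mk (linkedSetoid d) '' {M | P M ∧ M.faces.card = n}).Finite := by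
  obtain ⟨C, hC⟩ := finite_classes_and_ncard_le d
  exact (hC P (fun M h => ⟨(hP M h).supp, (hP M h).conn⟩) n).1

lemma classCount_mono {P P' : LinkedFaces d → Prop} {Loc : LocalCond d}
    (hP : ∀ M, P' M → InClass k Loc M) (h : ∀ M, P M → P' M) (n : ℕ) :
    classCount P n ≤ classCount P' n :=
  Set.ncard_le_ncard (Set.image_mono fun M hM => ⟨h M hM.1, hM.2⟩) (finite_classes_inClass hP n)

/-- The structure with a single face. -/
def singleLink (f : Cell d) : LinkedFaces d := ⟨{f}, fun _ _ _ => False⟩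

lemma facesAt_singleton (f g : Cell d) : facesAt {f} g = ∅ ∨ facesAt {f} g = {f} := by
  rw [← Finset.subset_singleton_iff]
  exact facesAt_subset _ _

lemma connectedBy_singleton (f : Cell d) (r : Cell d → Cell d → Prop) :
    ConnectedBy {f} r := by
  refine ⟨⟨f, by simp⟩, fun a ha b hb => ?_⟩
  rw [Finset.mem_singleton] at ha hb
  rw [ha, hb]

lemma inClass_singleLink {Loc : LocalCond d} (hL : Loc.Basic) {f : Cell d} (hf : IsCube k f) :
    InClass k Loc (singleLink f) where
  cube := by simpa [singleLink] using hf
  supp := fun _ _ _ h => h.elim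
  loc := fun g => by
    change Loc g (facesAt {f} g) _
    rcases facesAt_singleton f g with h | h <;> rw [h]
    · exact hL.empty g
    · exact hL.single g f
  conn := connectedBy_singleton f _

lemma ConnectedBy.union {A B : Finset (Cell d)} {r r₁ r₂ : Cell d → Cell d → Prop}
    (hA : ConnectedBy A r₁) (hB : ConnectedBy B r₂) (h₁ : ∀ a b, r₁ a b → r a b)
    (h₂ : ∀ a b, r₂ a b → r a b) {a b : Cell d} (ha : a ∈ A) (hb : b ∈ B) (hab : r a b)
    (hba : r b a) : ConnectedBy (A ∪ B) r := by
  have hA' : ∀ u ∈ A, ∀ v ∈ A,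
      Relation.ReflTransGen (fun a b => a ∈ A ∪ B ∧ b ∈ A ∪ B ∧ r a b) u v := by
    intro u hu v hv
    induction hA.2 u hu v hv with
    | refl => exact .refl
    | tail _ h ih =>
      exact (ih h.1).tail
        ⟨Finset.mem_union_left _ h.1, Finset.mem_union_left _ h.2.1, h₁ _ _ h.2.2⟩
  have hB' : ∀ u ∈ B, ∀ v ∈ B,
      Relation.ReflTransGen (fun a b => a ∈ A ∪ B ∧ b ∈ A ∪ B ∧ r a b) u v := by
    intro u hu v hv
    induction hB.2 u hu v hv with
    | refl => exact .refl
    | tail _ h ih =>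
      exact (ih h.1).tail
        ⟨Finset.mem_union_right _ h.1, Finset.mem_union_right _ h.2.1, h₂ _ _ h.2.2⟩
  have ha' := Finset.mem_union_left B ha
  have hb' := Finset.mem_union_right A hb
  refine ⟨⟨a, ha'⟩, fun u hu v hv => ?_⟩
  rcases Finset.mem_union.1 hu with hu | hu <;> rcases Finset.mem_union.1 hv with hv | hv
  · exact hA' u hu v hv
  · exact ((hA' u hu a ha).tail ⟨ha', hb', hab⟩).trans (hB' b hb v hv)
  · exact ((hB' u hu b hb).tail ⟨hb', ha', hba⟩).trans (hA' a ha v hv)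
  · exact hB' u hu v hv

/-- `T` lies to the right of `S`, touching the plane of the hyperedge `g` in the direction `x`
by a single face that neighbours `g`. -/
structure Joinable (x : Fin d) (S T : Finset (Cell d)) (g : Cell d) : Prop where
  notMem : x ∉ halfInt g
  left : ∀ a ∈ S, a x ≤ g x
  mem : g + unit (x, true) ∈ T
  right : ∀ b ∈ T, b = g + unit (x, true) ∨ g x + 2 ≤ b x
  nonempty : (facesAt S g).Nonempty

/-- The connections at `g` after gluing a face `f` to all faces of `S`. -/
def glueRel (S : LinkedFaces d) (g f : Cell d) : Cell d → Cell d → Prop :=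
  fun a b => S.conn g a b ∨ (a = f ∧ b ∈ facesAt S.faces g) ∨ (b = f ∧ a ∈ facesAt S.faces g)

/-- The union of `S` and `T`, glued at the hyperedge `g`. -/
def joinLink (x : Fin d) (S T : LinkedFaces d) (g : Cell d) : LinkedFaces d :=
  ⟨S.faces ∪ T.faces, fun h a b => T.conn h a b ∨
    (h = g ∧ glueRel S g (g + unit (x, true)) a b) ∨ S.conn h a b⟩

lemma add_unit_true_apply (c : Cell d) (x : Fin d) : (c + unit (x, true)) x = c x + 1 := by
  simp [unit_apply]

lemma apply_le_of_neighbours {f g : Cell d} (h : Neighbours f g) (i : Fin d) :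
    f i ≤ g i + 1 ∧ g i ≤ f i + 1 := by
  obtain ⟨v, -, rfl⟩ := neighbours_iff'.1 h
  rw [Pi.add_apply, unit_apply]
  split_ifs <;> constructor <;> omega

lemma facesAt_union (S T : Finset (Cell d)) (g : Cell d) :
    facesAt (S ∪ T) g = facesAt S g ∪ facesAt T g := by
  classical
  simp [facesAt, Finset.filter_union]

/-- Only a face with `x` as a half-integer dimension has a hyperedge further right than itself. Its
doubled coordinate is odd, hence strictly below the even `X`, and the hyperedge gets no further than
`X`. -/
lemma facesAt_eq_empty_of_lt {x : Fin d} {S : Finset (Cell d)} {X : ℤ} (hX : ¬ Odd X)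
    (hS : ∀ a ∈ S, a x ≤ X) {g : Cell d} (hg : X < g x) : facesAt S g = ∅ := by
  rw [Finset.eq_empty_iff_forall_notMem]
  intro a ha
  obtain ⟨haS, hn⟩ := mem_facesAt.1 ha
  obtain ⟨v, hv, rfl⟩ := neighbours_iff.1 hn
  have h1 := hS a haS
  rw [Pi.add_apply] at hg
  by_cases hvx : x = v.1
  · subst hvx
    rw [mem_halfInt] at hv
    have h3 : a v.1 ≠ X := fun e => hX (e ▸ hv)
    rcases unit_self v with h | h <;> rw [h] at hg <;> omega
  · rw [unit_apply_of_ne hvx] at hg; omega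

namespace Joinable

variable {x : Fin d} {S T : Finset (Cell d)} {g : Cell d}

lemma lt_right (h : Joinable x S T g) {b : Cell d} (hb : b ∈ T) : g x < b x := by
  rcases h.right b hb with rfl | hb
  · rw [add_unit_true_apply]; omega
  · omega

lemma disjoint (h : Joinable x S T g) : Disjoint S T :=
  Finset.disjoint_left.2 fun a ha hb => absurd (h.left a ha) (not_le.2 (h.lt_right hb))

lemma facesAt_right (h : Joinable x S T g) : facesAt T g = {g + unit (x, true)} := by
  ext b
  rw [mem_facesAt, Finset.mem_singleton]
  constructor
  · rintro ⟨hb, hn⟩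
    rcases h.right b hb with hb | hb
    · exact hb
    · have := (apply_le_of_neighbours hn x).1; omega
  · rintro rfl
    exact ⟨h.mem, neighbours_of_add_unit h.notMem⟩

lemma facesAt_right_of_le (h : Joinable x S T g) {g' : Cell d} (hg : g' ≠ g) (hx : g' x ≤ g x) :
    facesAt T g' = ∅ := by
  rw [Finset.eq_empty_iff_forall_notMem]
  intro b hb
  obtain ⟨hb, hn⟩ := mem_facesAt.1 hb
  rcases h.right b hb with rfl | hb
  · obtain ⟨v, hv, rfl⟩ := neighbours_iff.1 hn
    rw [Pi.add_apply, add_unit_true_apply] at hx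
    by_cases hvx : x = v.1
    · obtain ⟨y, b⟩ := v
      simp only at hvx
      subst hvx
      cases b
      · exact hg (by rw [add_assoc, unit_true, unit_false]; abel)
      · rw [unit_apply] at hx; simp at hx
    · rw [unit_apply_of_ne hvx] at hx; omega
  · have := (apply_le_of_neighbours hn x).1; omega

lemma facesAt_left_of_lt (h : Joinable x S T g) {g' : Cell d} (hx : g x < g' x) :
    facesAt S g' = ∅ :=
  facesAt_eq_empty_of_lt (by simpa [mem_halfInt] using h.notMem) h.left hx

end Joinable

lemma LinkedFaces.Supported.not_conn_of_subset_singleton {M : LinkedFaces d} (hM : M.Supported)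
    {g f : Cell d} (h : facesAt M.faces g ⊆ {f}) (a b : Cell d) : ¬ M.conn g a b := fun hc => by
  obtain ⟨ha, hb, hab⟩ := hM g a b hc
  exact hab ((Finset.mem_singleton.1 (h ha)).trans (Finset.mem_singleton.1 (h hb)).symm)

/-- Apart from `g`, hyperedges in or left of its hyperplane see only `S`, and those to the right see
only `T`. So `hloc` is the only new local condition to check. -/
lemma inClass_joinLink {x : Fin d} {Loc : LocalCond d} {S T : LinkedFaces d} {g : Cell d}
    (hS : InClass k Loc S) (hT : InClass k Loc T) (h : Joinable x S.faces T.faces g)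
    (hloc : Loc g (insert (g + unit (x, true)) (facesAt S.faces g))
      (glueRel S g (g + unit (x, true)))) : InClass k Loc (joinLink x S T g) where
  cube := by
    intro f hf
    rcases Finset.mem_union.1 hf with hf | hf
    · exact hS.cube f hf
    · exact hT.cube f hf
  supp := by
    intro g' a b hab
    change a ∈ facesAt (S.faces ∪ T.faces) g' ∧ b ∈ facesAt (S.faces ∪ T.faces) g' ∧ _
    rw [facesAt_union, Finset.mem_union, Finset.mem_union]
    have hne : ∀ c ∈ facesAt S.faces g, c ≠ g + unit (x, true) := by
      rintro c hc rfl
      exact Finset.disjoint_left.1 h.disjoint (mem_facesAt.1 hc).1 h.mem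
    have hmem : g + unit (x, true) ∈ facesAt T.faces g := by simp [h.facesAt_right]
    rcases hab with hab | ⟨rfl, hab | ⟨rfl, hb⟩ | ⟨rfl, ha⟩⟩ | hab
    · obtain ⟨h1, h2, h3⟩ := hT.supp _ _ _ hab
      exact ⟨.inr h1, .inr h2, h3⟩
    · obtain ⟨h1, h2, h3⟩ := hS.supp _ _ _ hab
      exact ⟨.inl h1, .inl h2, h3⟩
    · exact ⟨.inr hmem, .inl hb, (hne _ hb).symm⟩
    · exact ⟨.inl ha, .inr hmem, hne _ ha⟩
    · obtain ⟨h1, h2, h3⟩ := hS.supp _ _ _ hab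
      exact ⟨.inl h1, .inl h2, h3⟩
  loc := by
    intro g'
    change Loc g' (facesAt (S.faces ∪ T.faces) g') _
    rw [facesAt_union]
    by_cases hg : g' = g
    · subst hg
      convert hloc using 1
      · rw [h.facesAt_right, Finset.union_comm, Finset.insert_eq]
      · ext a b
        have := hT.supp.not_conn_of_subset_singleton h.facesAt_right.subset a b
        simp only [joinLink, glueRel, true_and]
        tauto
    · rcases le_or_gt (g' x) (g x) with hx | hx
      · have he := h.facesAt_right_of_le hg hx
        convert hS.loc g' using 1
        · rw [he, Finset.union_empty]
        · ext a b
          have := hT.supp.not_conn_of_subset_singleton (f := a) (g := g') (by simp [he]) a b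
          simp only [joinLink]
          tauto
      · have he := h.facesAt_left_of_lt hx
        convert hT.loc g' using 1
        · rw [he, Finset.empty_union]
        · ext a b
          have := hS.supp.not_conn_of_subset_singleton (f := a) (g := g') (by simp [he]) a b
          simp only [joinLink]
          tauto
  conn := by
    obtain ⟨f, hf⟩ := h.nonempty
    exact hS.conn.union hT.conn (fun a b ⟨g, hg⟩ => ⟨g, .inr (.inr hg)⟩)
      (fun a b ⟨g, hg⟩ => ⟨g, .inl hg⟩) (mem_facesAt.1 hf).1 h.mem
      ⟨g, .inr (.inl ⟨rfl, .inr (.inr ⟨rfl, hf⟩)⟩)⟩ ⟨g, .inr (.inl ⟨rfl, .inr (.inl ⟨rfl, hf⟩)⟩)⟩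

/-! ### Recovering the pieces -/

/-- `S` is the part of `U` on its own set of faces. -/
structure Induced (S U : LinkedFaces d) : Prop where
  conn_iff : ∀ g a b, S.conn g a b ↔ U.conn g a b ∧ a ∈ S.faces ∧ b ∈ S.faces

/-- `A` consists of the members of `U` up to some level in the direction `x`. -/
def IsLower (x : Fin d) (A U : Finset (Cell d)) : Prop :=
  A ⊆ U ∧ ∃ α : ℤ, ∀ c ∈ U, c ∈ A ↔ c x ≤ α

lemma IsLower.image_shift {x : Fin d} {A₁ A₂ U₁ U₂ : Finset (Cell d)} (h₁ : IsLower x A₁ U₁)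
    (h₂ : IsLower x A₂ U₂) {t : Fin d → ℤ} (hU : U₂ = U₁.image (shift t))
    (hc : A₁.card = A₂.card) : A₂ = A₁.image (shift t) := by
  obtain ⟨s₁, α, hα⟩ := h₁
  obtain ⟨s₂, β, hβ⟩ := h₂
  have hsub : A₁.image (shift t) ⊆ U₂ := hU ▸ Finset.image_subset_image s₁
  have h1 : ∀ c ∈ U₂, c ∈ A₁.image (shift t) ↔ c x ≤ α + 2 * t x := by
    intro c hc
    rw [hU, Finset.mem_image] at hc
    obtain ⟨f, hf, rfl⟩ := hc
    rw [Finset.mem_image]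
    have : (∃ a ∈ A₁, shift t a = shift t f) ↔ f ∈ A₁ :=
      ⟨fun ⟨a, ha, e⟩ => shift_injective t e ▸ ha, fun h => ⟨f, h, rfl⟩⟩
    rw [this, hα f hf, shift]
    omega
  have hcard : (A₁.image (shift t)).card = A₂.card := by
    rw [Finset.card_image_of_injective _ (shift_injective t), hc]
  rcases le_total (α + 2 * t x) β with h | h
  · refine (Finset.eq_of_subset_of_card_le (fun c hc => ?_) hcard.ge).symm
    exact (hβ c (hsub hc)).2 (((h1 c (hsub hc)).1 hc).trans h)
  · refine Finset.eq_of_subset_of_card_le (fun c hc => ?_) hcard.le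
    exact (h1 c (s₂ hc)).2 (((hβ c (s₂ hc)).1 hc).trans h)

lemma Induced.equiv {S₁ S₂ U₁ U₂ : LinkedFaces d} (h₁ : Induced S₁ U₁) (h₂ : Induced S₂ U₂)
    {t : Fin d → ℤ} (hU : ∀ g a b, U₂.conn (shift t g) (shift t a) (shift t b) ↔ U₁.conn g a b)
    (hS : S₂.faces = S₁.faces.image (shift t)) : linkedSetoid d S₁ S₂ := by
  refine ⟨t, hS, fun g a b => ?_⟩
  have : ∀ f, shift t f ∈ S₂.faces ↔ f ∈ S₁.faces := fun f => by
    rw [hS, Finset.mem_image]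
    exact ⟨fun ⟨a, ha, e⟩ => shift_injective t e ▸ ha, fun h => ⟨f, h, rfl⟩⟩
  rw [h₁.conn_iff, h₂.conn_iff, hU, this, this]

lemma Joinable.isLower {x : Fin d} {S T : Finset (Cell d)} {g : Cell d}
    (h : Joinable x S T g) : IsLower x S (S ∪ T) := by
  refine ⟨Finset.subset_union_left, g x, fun c hc => ⟨h.left c, fun hx => ?_⟩⟩
  rcases Finset.mem_union.1 hc with hc | hc
  · exact hc
  · exact absurd hx (not_le.2 (h.lt_right hc))

lemma Joinable.induced_left {x : Fin d} {S T : LinkedFaces d} {g : Cell d}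
    (h : Joinable x S.faces T.faces g) (hS : S.Supported) (hT : T.Supported) :
    Induced S (joinLink x S T g) := by
  refine ⟨fun g' a b => ⟨fun hab => ?_, ?_⟩⟩
  · obtain ⟨h1, h2, -⟩ := hS _ _ _ hab
    exact ⟨.inr (.inr hab), (mem_facesAt.1 h1).1, (mem_facesAt.1 h2).1⟩
  · rintro ⟨hab | ⟨rfl, hab | ⟨rfl, -⟩ | ⟨rfl, -⟩⟩ | hab, ha, hb⟩
    · exact absurd (mem_facesAt.1 (hT _ _ _ hab).1).1 (Finset.disjoint_left.1 h.disjoint ha)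
    · exact hab
    · exact absurd h.mem (Finset.disjoint_left.1 h.disjoint ha)
    · exact absurd h.mem (Finset.disjoint_left.1 h.disjoint hb)
    · exact hab

lemma Joinable.induced_right {x : Fin d} {S T : LinkedFaces d} {g : Cell d}
    (h : Joinable x S.faces T.faces g) (hS : S.Supported) (hT : T.Supported) :
    Induced T (joinLink x S T g) := by
  refine ⟨fun g' a b => ⟨fun hab => ?_, ?_⟩⟩
  · obtain ⟨h1, h2, -⟩ := hT _ _ _ hab
    exact ⟨.inl hab, (mem_facesAt.1 h1).1, (mem_facesAt.1 h2).1⟩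
  · have hn : ∀ c ∈ T.faces, ∀ g, c ∉ facesAt S.faces g := fun c hc g hc' =>
      Finset.disjoint_left.1 h.disjoint (mem_facesAt.1 hc').1 hc
    rintro ⟨hab | ⟨rfl, hab | ⟨-, hb'⟩ | ⟨-, ha'⟩⟩ | hab, ha, hb⟩
    · exact hab
    · exact absurd (hS _ _ _ hab).1 (hn a ha _)
    · exact absurd hb' (hn b hb _)
    · exact absurd ha' (hn a ha _)
    · exact absurd (hS _ _ _ hab).1 (hn a ha _)

/-- The left piece is a lower part of known size and the right piece is its complement. Both carry
the connections induced from the union, so gluing is injective on classes. -/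
lemma joinLink_equiv {x : Fin d} {S₁ S₂ T₁ T₂ : LinkedFaces d} {g₁ g₂ : Cell d}
    (h₁ : Joinable x S₁.faces T₁.faces g₁) (h₂ : Joinable x S₂.faces T₂.faces g₂)
    (hS₁ : S₁.Supported) (hS₂ : S₂.Supported) (hT₁ : T₁.Supported) (hT₂ : T₂.Supported)
    (hc : S₁.faces.card = S₂.faces.card)
    (h : linkedSetoid d (joinLink x S₁ T₁ g₁) (joinLink x S₂ T₂ g₂)) :
    linkedSetoid d S₁ S₂ ∧ linkedSetoid d T₁ T₂ := by
  obtain ⟨t, hU, hconn⟩ := h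
  have hS := h₁.isLower.image_shift h₂.isLower hU hc
  refine ⟨(h₁.induced_left hS₁ hT₁).equiv (h₂.induced_left hS₂ hT₂) hconn hS,
    (h₁.induced_right hS₁ hT₁).equiv (h₂.induced_right hS₂ hT₂) hconn ?_⟩
  have e : ∀ {S T : Finset (Cell d)} {g}, Joinable x S T g → T = (S ∪ T) \ S := fun h => by
    rw [Finset.union_sdiff_left, sdiff_eq_left.2 h.disjoint.symm]
  rw [e h₂, e h₁, Finset.image_sdiff _ _ (shift_injective t), ← hS]
  congr 1

/-! ### Structures with a single rightmost face -/

/-- `f` is the only rightmost face in the direction `x`, and has `x` as a half-integer dimension. -/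
structure RightEnd (x : Fin d) (S : Finset (Cell d)) (f : Cell d) : Prop where
  mem : f ∈ S
  half : x ∈ halfInt f
  lt : ∀ a ∈ S, a = f ∨ a x < f x

/-- A single face can be glued to `M` at the hyperedge `g` on the right. -/
structure Extendable (k : ℕ) (x : Fin d) (Loc : LocalCond d) (M : LinkedFaces d) (g : Cell d) :
    Prop where
  join : Joinable x M.faces {g + unit (x, true)} g
  loc : Loc g (insert (g + unit (x, true)) (facesAt M.faces g))
      (glueRel M g (g + unit (x, true)))

lemma isCube_of_neighbours {f f' g : Cell d} (h : Neighbours f g) (h' : Neighbours f' g)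
    (hf : IsCube k f) : IsCube k f' := by
  obtain ⟨v, hv, rfl⟩ := neighbours_iff'.1 h
  obtain ⟨w, hw, rfl⟩ := neighbours_iff'.1 h'
  rw [IsCube, halfInt_add_unit_insert hv, Finset.card_insert_of_notMem hv] at hf
  rw [IsCube, halfInt_add_unit_insert hw, Finset.card_insert_of_notMem hw, hf]

lemma Extendable.inClass {x : Fin d} {Loc : LocalCond d} (hL : Loc.Basic) {M : LinkedFaces d}
    {g : Cell d} (hM : InClass k Loc M) (h : Extendable k x Loc M g) :
    InClass k Loc (joinLink x M (singleLink (g + unit (x, true))) g) ∧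
      RightEnd x (joinLink x M (singleLink (g + unit (x, true))) g).faces (g + unit (x, true)) ∧
      (joinLink x M (singleLink (g + unit (x, true))) g).faces.card = M.faces.card + 1 := by
  obtain ⟨f, hf⟩ := h.join.nonempty
  have hcube := isCube_of_neighbours (mem_facesAt.1 hf).2 (neighbours_of_add_unit (v := (x, true)) h.join.notMem)
    (hM.cube f (mem_facesAt.1 hf).1)
  refine ⟨inClass_joinLink hM (inClass_singleLink hL hcube) h.join h.loc, ⟨?_, ?_, ?_⟩, ?_⟩
  · exact Finset.mem_union_right _ (Finset.mem_singleton_self _)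
  · rw [halfInt_add_unit_insert h.join.notMem]; simp
  · intro a ha
    rcases Finset.mem_union.1 ha with ha | ha
    · right
      have := h.join.left a ha
      rw [add_unit_true_apply]
      omega
    · exact .inl (Finset.mem_singleton.1 ha)
  · exact (Finset.card_union_of_disjoint h.join.disjoint).trans (by simp)

/-- The added face is the unique rightmost one, so deleting it recovers the structure and no code is
needed. -/
lemma classCount_extendable_le {x : Fin d} {Loc : LocalCond d} (hL : Loc.Basic) (n : ℕ) :
    classCount (fun M => InClass k Loc M ∧ ∃ g, Extendable k x Loc M g) n ≤
      classCount (fun M => InClass k Loc M ∧ ∃ f, RightEnd x M.faces f) (n + 1) := by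
  have key := ncard_classes_le (κ := Unit) (sα := linkedSetoid d) (sγ := linkedSetoid d)
    (A := {M | (InClass k Loc M ∧ ∃ g, Extendable k x Loc M g) ∧ M.faces.card = n})
    (finite_classes_inClass (P := fun M => InClass k Loc M ∧ ∃ f, RightEnd x M.faces f)
      (fun M h => h.1) (n + 1))
    (fun M U _ => ∃ g, Extendable k x Loc M g ∧
      U = joinLink x M (singleLink (g + unit (x, true))) g) ?_ ?_
  · simpa [classCount] using key
  · rintro M ⟨⟨hM, g, hg⟩, hn⟩
    obtain ⟨h1, h2, h3⟩ := hg.inClass hL hM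
    exact ⟨_, ⟨⟨h1, _, h2⟩, by rw [h3, hn]⟩, (), g, hg, rfl⟩
  · rintro M M' _ _ _ ⟨⟨hM, -⟩, hn⟩ ⟨⟨hM', -⟩, hn'⟩ ⟨g, hg, rfl⟩ ⟨g', hg', rfl⟩ h
    exact (joinLink_equiv hg.join hg'.join hM.supp hM'.supp (fun _ _ _ h => False.elim h)
      (fun _ _ _ h => False.elim h) (hn.trans hn'.symm) h).1

/-- Any other face position at this hyperedge lies further right than `f`. Hence gluing there
creates a hyperedge with two faces, which every `Basic` condition allows. -/
lemma facesAt_eq_singleton_of_rightmost {x : Fin d} {S : Finset (Cell d)} {f : Cell d}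
    (hf : f ∈ S) (hx : x ∈ halfInt f) (hmax : ∀ a ∈ S, a x ≤ f x) :
    facesAt S (f + unit (x, true)) = {f} := by
  ext a
  rw [mem_facesAt, Finset.mem_singleton]
  constructor
  · rintro ⟨ha, hn⟩
    obtain ⟨v, hv, rfl⟩ := neighbours_iff'.1 hn
    have h1 := hmax _ ha
    rw [Pi.add_apply, add_unit_true_apply] at h1
    obtain ⟨y, b⟩ := v
    by_cases hxy : x = y
    · subst hxy
      cases b
      · rw [unit_true, unit_false]; abel
      · rw [unit_apply] at h1; simp at h1
    · rw [unit_apply_of_ne hxy] at h1; omega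
  · rintro rfl
    exact ⟨hf, neighbours_add_unit (v := (x, true)) hx⟩

lemma glueRel_eq_pairRel {M : LinkedFaces d} (hM : M.Supported) {g f f' : Cell d}
    (h : facesAt M.faces g = {f}) : glueRel M g f' = pairRel f' f := by
  ext a b
  have := hM.not_conn_of_subset_singleton h.subset a b
  simp only [glueRel, pairRel, h, Finset.mem_singleton]
  tauto

lemma joinable_of_rightmost {x : Fin d} {S T : Finset (Cell d)} {f : Cell d}
    (hf : f ∈ S) (hx : x ∈ halfInt f) (hmax : ∀ a ∈ S, a x ≤ f x)
    (hT : f + unit (x, true) + unit (x, true) ∈ T)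
    (hT' : ∀ b ∈ T, b = f + unit (x, true) + unit (x, true) ∨ f x + 3 ≤ b x) :
    Joinable x S T (f + unit (x, true)) where
  notMem := by rw [halfInt_add_unit (v := (x, true)) hx]; simp
  left := fun a ha => by rw [add_unit_true_apply]; have := hmax a ha; omega
  mem := hT
  right := fun b hb => by rw [add_unit_true_apply]; have := hT' b hb; exact this.imp_right fun h => by omega
  nonempty := by simp [facesAt_eq_singleton_of_rightmost hf hx hmax]

lemma loc_glueRel_of_rightmost {x : Fin d} {Loc : LocalCond d} (hL : Loc.Basic)
    {M : LinkedFaces d} (hM : M.Supported) {f : Cell d} (hf : f ∈ M.faces)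
    (hx : x ∈ halfInt f) (hmax : ∀ a ∈ M.faces, a x ≤ f x) :
    Loc (f + unit (x, true))
      (insert (f + unit (x, true) + unit (x, true)) (facesAt M.faces (f + unit (x, true))))
      (glueRel M (f + unit (x, true)) (f + unit (x, true) + unit (x, true))) := by
  have h := facesAt_eq_singleton_of_rightmost hf hx hmax
  rw [glueRel_eq_pairRel hM h, h]
  refine hL.pair _ _ _ fun e => ?_
  have := congrFun e x
  rw [add_unit_true_apply, add_unit_true_apply] at this
  omega

lemma extendable_of_rightmost {x : Fin d} {Loc : LocalCond d} (hL : Loc.Basic)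
    {M : LinkedFaces d} (hM : InClass k Loc M) {f : Cell d} (hf : f ∈ M.faces)
    (hx : x ∈ halfInt f) (hmax : ∀ a ∈ M.faces, a x ≤ f x) :
    Extendable k x Loc M (f + unit (x, true)) :=
  ⟨joinable_of_rightmost hf hx hmax (Finset.mem_singleton_self _)
    fun _ hb => .inl (Finset.mem_singleton.1 hb), loc_glueRel_of_rightmost hL hM.supp hf hx hmax⟩

lemma RightEnd.le {x : Fin d} {S : Finset (Cell d)} {f : Cell d} (h : RightEnd x S f) {a : Cell d}
    (ha : a ∈ S) : a x ≤ f x := by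
  rcases h.lt a ha with rfl | h
  · exact le_rfl
  · exact h.le

/-- A single rightmost face along `x` can be continued straight ahead indefinitely; this equalizes
hyperareas when different ways of capping are compared. -/
lemma classCount_rightEnd_le_add {x : Fin d} {Loc : LocalCond d} (hL : Loc.Basic) (n m : ℕ) :
    classCount (fun M => InClass k Loc M ∧ ∃ f, RightEnd x M.faces f) n ≤
      classCount (fun M => InClass k Loc M ∧ ∃ f, RightEnd x M.faces f) (n + m) := by
  induction m with
  | zero => exact le_rfl
  | succ m ih =>
    refine ih.trans (le_trans ?_ (classCount_extendable_le hL (n + m)))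
    refine classCount_mono (Loc := Loc) (fun M h => h.1) (fun M h => ?_) _
    obtain ⟨hM, f, hf⟩ := h
    exact ⟨hM, _, extendable_of_rightmost hL hM hf.mem hf.half fun a ha => hf.le ha⟩


/-! ### Turning configurations around -/

/-- The point reflection composed with a permutation of the coordinates and a translation. -/
def turn (π : Equiv.Perm (Fin d)) (t : Fin d → ℤ) : Cell d ≃ Cell d where
  toFun c := fun i => -c (π i) + 2 * t i
  invFun c := fun i => -(c (π.symm i) - 2 * t (π.symm i))
  left_inv c := by ext i; simp
  right_inv c := by ext i; simp

lemma turn_apply (π : Equiv.Perm (Fin d)) (t : Fin d → ℤ) (c : Cell d) (i : Fin d) :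
    turn π t c i = -c (π i) + 2 * t i := rfl

lemma mem_halfInt_turn {π : Equiv.Perm (Fin d)} {t : Fin d → ℤ} {c : Cell d} {i : Fin d} :
    i ∈ halfInt (turn π t c) ↔ π i ∈ halfInt c := by
  rw [mem_halfInt, mem_halfInt, turn_apply]
  constructor <;> intro h <;> grind

lemma halfInt_turn (π : Equiv.Perm (Fin d)) (t : Fin d → ℤ) (c : Cell d) :
    halfInt (turn π t c) = (halfInt c).map π.symm.toEmbedding := by
  ext i
  rw [mem_halfInt_turn, Finset.mem_map_equiv]
  rfl

lemma isCube_turn {π : Equiv.Perm (Fin d)} {t : Fin d → ℤ} {c : Cell d} :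
    IsCube k (turn π t c) ↔ IsCube k c := by
  rw [IsCube, IsCube, halfInt_turn, Finset.card_map]

lemma turn_add_unit (π : Equiv.Perm (Fin d)) (t : Fin d → ℤ) (c : Cell d) (v : Fin d × Bool) :
    turn π t (c + unit v) = turn π t c + unit (π.symm v.1, !v.2) := by
  ext i
  rw [turn_apply, Pi.add_apply, Pi.add_apply, turn_apply, unit_apply, unit_apply]
  have : π i = v.1 ↔ i = π.symm v.1 := by rw [Equiv.eq_symm_apply]
  simp only [this]
  cases v.2 <;> split_ifs <;> simp_all <;> ring

lemma neighbours_turn {π : Equiv.Perm (Fin d)} {t : Fin d → ℤ} {f g : Cell d} :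
    Neighbours (turn π t f) (turn π t g) ↔ Neighbours f g := by
  rw [neighbours_iff, neighbours_iff]
  constructor
  · rintro ⟨v, hv, h⟩
    refine ⟨(π v.1, !v.2), by simpa [mem_halfInt_turn] using hv, ?_⟩
    apply (turn π t).injective
    rw [h, turn_add_unit]
    simp
  · rintro ⟨v, hv, rfl⟩
    exact ⟨_, by simpa [mem_halfInt_turn] using hv, turn_add_unit π t f v⟩

lemma facesAt_image_turn (π : Equiv.Perm (Fin d)) (t : Fin d → ℤ) (S : Finset (Cell d))
    (g : Cell d) : facesAt (S.image (turn π t)) (turn π t g) = (facesAt S g).image (turn π t) := by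
  ext f
  simp only [mem_facesAt, Finset.mem_image]
  constructor
  · rintro ⟨⟨a, ha, rfl⟩, h⟩
    exact ⟨a, ⟨ha, neighbours_turn.1 h⟩, rfl⟩
  · rintro ⟨a, ⟨ha, h⟩, rfl⟩
    exact ⟨⟨a, ha, rfl⟩, neighbours_turn.2 h⟩

/-- The image of a structure under a symmetry of the lattice. -/
def turnLink (π : Equiv.Perm (Fin d)) (t : Fin d → ℤ) (M : LinkedFaces d) : LinkedFaces d :=
  ⟨M.faces.image (turn π t),
    fun g a b => M.conn ((turn π t).symm g) ((turn π t).symm a) ((turn π t).symm b)⟩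

/-- A local condition that is invariant under the symmetries `turn`. -/
def LocalCond.Invariant (Loc : LocalCond d) : Prop :=
  ∀ π t g F r, Loc g F r → Loc (turn π t g) (F.image (turn π t))
    (fun a b => r ((turn π t).symm a) ((turn π t).symm b))

lemma connectedBy_image {S : Finset (Cell d)} {r r' : Cell d → Cell d → Prop}
    (e : Cell d → Cell d) (h : ∀ a b, r a b → r' (e a) (e b)) (hS : ConnectedBy S r) :
    ConnectedBy (S.image e) r' := by
  refine ⟨hS.1.image e, fun f hf f' hf' => ?_⟩
  obtain ⟨a, ha, rfl⟩ := Finset.mem_image.1 hf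
  obtain ⟨b, hb, rfl⟩ := Finset.mem_image.1 hf'
  exact (hS.2 a ha b hb).lift e fun u v huv =>
    ⟨Finset.mem_image_of_mem e huv.1, Finset.mem_image_of_mem e huv.2.1, h u v huv.2.2⟩

lemma inClass_turnLink {Loc : LocalCond d} (hI : Loc.Invariant) (π : Equiv.Perm (Fin d))
    (t : Fin d → ℤ) {M : LinkedFaces d} (hM : InClass k Loc M) :
    InClass k Loc (turnLink π t M) where
  cube := by
    intro f hf
    obtain ⟨a, ha, rfl⟩ := Finset.mem_image.1 hf
    exact isCube_turn.2 (hM.cube a ha)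
  supp := by
    intro g a b h
    obtain ⟨g, rfl⟩ := (turn π t).surjective g
    obtain ⟨a, rfl⟩ := (turn π t).surjective a
    obtain ⟨b, rfl⟩ := (turn π t).surjective b
    simp only [turnLink, Equiv.symm_apply_apply] at h
    obtain ⟨h1, h2, h3⟩ := hM.supp _ _ _ h
    change _ ∈ facesAt (M.faces.image _) _ ∧ _ ∈ facesAt (M.faces.image _) _ ∧ _
    rw [facesAt_image_turn]
    exact ⟨Finset.mem_image_of_mem _ h1, Finset.mem_image_of_mem _ h2, (turn π t).injective.ne h3⟩
  loc := by
    intro g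
    obtain ⟨g, rfl⟩ := (turn π t).surjective g
    change Loc _ (facesAt (M.faces.image _) _) _
    rw [facesAt_image_turn]
    simp only [turnLink, Equiv.symm_apply_apply]
    exact hI π t g _ _ (hM.loc g)
  conn := connectedBy_image _ (fun a b ⟨g, h⟩ => ⟨turn π t g, by simpa [turnLink] using h⟩) hM.conn

lemma card_turnLink (π : Equiv.Perm (Fin d)) (t : Fin d → ℤ) (M : LinkedFaces d) :
    (turnLink π t M).faces.card = M.faces.card :=
  Finset.card_image_of_injective _ (turn π t).injective

/-- Up to translation a turn depends only on `π`, which is therefore the only code needed to undo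
it. -/
lemma exists_shift_turn_eq (π : Equiv.Perm (Fin d)) (t t' s : Fin d → ℤ) :
    ∃ u : Fin d → ℤ, ∀ c, turn π t' (shift u c) = shift s (turn π t c) := by
  refine ⟨fun i => t' (π.symm i) - t (π.symm i) - s (π.symm i), fun c => ?_⟩
  ext i
  simp only [shift, turn_apply, Equiv.symm_apply_apply]
  ring

lemma image_eq_of_image_turn_eq {π : Equiv.Perm (Fin d)} {t t' s : Fin d → ℤ}
    {u : Fin d → ℤ} (hu : ∀ c, turn π t' (shift u c) = shift s (turn π t c))
    {S S' : Finset (Cell d)}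
    (h : S'.image (turn π t') = (S.image (turn π t)).image (shift s)) :
    S' = S.image (shift u) := by
  apply Finset.image_injective (turn π t').injective
  rw [h, Finset.image_image, Finset.image_image]
  exact Finset.image_congr fun c _ => (hu c).symm

lemma turnLink_equiv {π : Equiv.Perm (Fin d)} {t t' : Fin d → ℤ} {M M' : LinkedFaces d}
    (h : linkedSetoid d (turnLink π t M) (turnLink π t' M')) : linkedSetoid d M M' := by
  obtain ⟨s, hf, hc⟩ := h
  obtain ⟨u, hu⟩ := exists_shift_turn_eq π t t' s
  refine ⟨u, image_eq_of_image_turn_eq hu hf, fun g a b => ?_⟩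
  have := hc (turn π t g) (turn π t a) (turn π t b)
  simpa only [← hu, turnLink, Equiv.symm_apply_apply] using this

/-- Extend a bijection of `A` onto `B` to a permutation and follow it by the transposition of `x`
and its image. Both lie in `B`, so `B` is preserved. -/
lemma exists_perm_fixing {A B : Finset (Fin d)} {x : Fin d} (hA : x ∈ A) (hB : x ∈ B)
    (h : A.card = B.card) :
    ∃ π : Equiv.Perm (Fin d), π x = x ∧ ∀ i, i ∈ A ↔ π i ∈ B := by
  classical
  obtain ⟨e⟩ : Nonempty ({i // i ∈ A} ≃ {i // i ∈ B}) :=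
    ⟨Fintype.equivOfCardEq (by simpa using h)⟩
  have h1 : ∀ i, i ∈ A ↔ e.extendSubtype i ∈ B := fun i =>
    ⟨fun hi => e.extendSubtype_mem i hi, fun hi => by
      by_contra hn
      exact e.extendSubtype_not_mem i hn hi⟩
  refine ⟨Equiv.swap (e.extendSubtype x) x * e.extendSubtype, by simp, fun i => ?_⟩
  rw [h1, Equiv.Perm.mul_apply]
  have hx := (h1 x).1 hA
  rcases eq_or_ne (e.extendSubtype i) (e.extendSubtype x) with hi | hi
  · rw [hi, Equiv.swap_apply_left]; simp [hx, hB]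
  · rcases eq_or_ne (e.extendSubtype i) x with hi' | hi'
    · rw [hi', Equiv.swap_apply_right]; simp [hx, hB]
    · rw [Equiv.swap_apply_of_ne_of_ne hi hi']

/-- A face can be turned around onto any other one of the same dimension whose orientation shares
the direction `x`. -/
lemma exists_turn_eq {x : Fin d} {f f' : Cell d} (hf : IsCube k f) (hf' : IsCube k f')
    (h : x ∈ halfInt f ↔ x ∈ halfInt f') :
    ∃ π t, π x = x ∧ turn π t f = f' := by
  obtain ⟨π, hx, hπ⟩ : ∃ π : Equiv.Perm (Fin d), π x = x ∧
      ∀ i, i ∈ halfInt f' ↔ π i ∈ halfInt f := by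
    by_cases hx : x ∈ halfInt f
    · exact exists_perm_fixing (h.1 hx) hx (hf'.trans hf.symm)
    · obtain ⟨π, h1, h2⟩ := exists_perm_fixing (A := (halfInt f')ᶜ) (B := (halfInt f)ᶜ) (x := x)
        (by simpa [h] using hx) (by simpa using hx)
        (by rw [Finset.card_compl, Finset.card_compl, hf', hf])
      exact ⟨π, h1, fun i => by simpa using not_congr (h2 i)⟩
  obtain ⟨t, ht⟩ := exists_shift_eq_of_parity (r := turn π 0 f) (r' := f') fun i => by
    rw [← mem_halfInt, ← mem_halfInt, mem_halfInt_turn, hπ]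
  refine ⟨π, t, hx, ?_⟩
  rw [← ht]
  ext i
  simp [shift, turn_apply]

/-- The second structure is turned around so that its rightmost face becomes its leftmost one and
continues the end of the first. The pair is recovered from the result and the permutation, whence
the factor. -/
lemma classCount_rightEnd_mul_le {x : Fin d} {Loc : LocalCond d} (hL : Loc.Basic)
    (hI : Loc.Invariant) (n m : ℕ) :
    classCount (fun M => InClass k Loc M ∧ ∃ f, RightEnd x M.faces f) n *
      classCount (fun M => InClass k Loc M ∧ ∃ f, RightEnd x M.faces f) m ≤
    Fintype.card (Equiv.Perm (Fin d)) * classCount (InClass k Loc) (n + m) := by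
  refine ncard_classes_mul_le (sα := linkedSetoid d) (sβ := linkedSetoid d)
    (sγ := linkedSetoid d) (finite_classes_inClass (fun M h => h) (n + m))
    (fun S T U π => ∃ t g, Joinable x S.faces (turnLink π t T).faces g ∧
      (turnLink π t T).Supported ∧ U = joinLink x S (turnLink π t T) g) ?_ ?_
  · rintro S ⟨⟨hS, f, hf⟩, hn⟩ T ⟨⟨hT, f', hf'⟩, hm⟩
    have hxf : x ∉ halfInt (f + unit (x, true)) := by
      rw [halfInt_add_unit (v := (x, true)) hf.half]; simp
    obtain ⟨π, t, hx, ht⟩ := exists_turn_eq (x := x) (hT.cube f' hf'.mem)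
      (f' := f + unit (x, true) + unit (x, true)) (isCube_of_neighbours
        (neighbours_add_unit (v := (x, true)) hf.half)
        (neighbours_of_add_unit (v := (x, true)) hxf) (hS.cube f hf.mem))
      (by rw [halfInt_add_unit_insert (v := (x, true)) hxf]; simp [hf'.half])
    have hT' := inClass_turnLink hI π t hT
    have hj : Joinable x S.faces (turnLink π t T).faces (f + unit (x, true)) := by
      refine joinable_of_rightmost hf.mem hf.half (fun a ha => hf.le ha)
        (Finset.mem_image.2 ⟨f', hf'.mem, ht⟩) fun b hb => ?_
      obtain ⟨a, ha, rfl⟩ := Finset.mem_image.1 hb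
      rcases hf'.lt a ha with rfl | hlt
      · exact .inl ht
      · right
        have h1 := congrFun ht x
        rw [add_unit_true_apply, add_unit_true_apply, turn_apply, hx] at h1
        rw [turn_apply, hx]
        omega
    refine ⟨_, ⟨inClass_joinLink hS hT' hj
      (loc_glueRel_of_rightmost hL hS.supp hf.mem hf.half fun a ha => hf.le ha), ?_⟩,
      π, t, _, hj, hT'.supp, rfl⟩
    rw [← hn, ← hm, ← card_turnLink π t T]
    exact Finset.card_union_of_disjoint hj.disjoint
  · rintro S S' T T' _ _ π ⟨⟨hS, -⟩, hn⟩ ⟨⟨hS', -⟩, hn'⟩ - - ⟨t, g, hj, hT, rfl⟩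
      ⟨t', g', hj', hT', rfl⟩ h
    obtain ⟨h1, h2⟩ := joinLink_equiv hj hj' hS.supp hS'.supp hT hT' (hn.trans hn'.symm) h
    exact ⟨h1, turnLink_equiv h2⟩

lemma exists_isCube_mem_halfInt (hk : 1 ≤ k) (hkd : k ≤ d) (x : Fin d) :
    ∃ f : Cell d, IsCube k f ∧ x ∈ halfInt f := by
  obtain ⟨J, hJ, hJk⟩ := Finset.exists_superset_card_eq (s := {x}) (n := k) (by simpa) (by simpa)
  have h : halfInt (fun i => if i ∈ J then 1 else 0 : Cell d) = J := by
    ext i; rw [mem_halfInt]; split_ifs with h <;> simp [h]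
  exact ⟨_, by rw [IsCube, h, hJk], by rw [h]; exact hJ (by simp)⟩

lemma classCount_rightEnd_pos (hk : 1 ≤ k) (hkd : k ≤ d) (x : Fin d) {Loc : LocalCond d}
    (hL : Loc.Basic) (n : ℕ) :
    0 < classCount (fun M => InClass k Loc M ∧ ∃ f, RightEnd x M.faces f) (n + 1) := by
  rw [add_comm]
  refine lt_of_lt_of_le ?_ (classCount_rightEnd_le_add hL 1 n)
  obtain ⟨f, hf, hx⟩ := exists_isCube_mem_halfInt hk hkd x
  refine (Set.ncard_pos (finite_classes_inClass (fun M h => h.1) 1)).2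
    ⟨_, singleLink f, ⟨⟨inClass_singleLink hL hf, f, by simp [singleLink], hx, ?_⟩, ?_⟩, rfl⟩
  · intro a ha
    exact .inl (Finset.mem_singleton.1 ha)
  · simp [singleLink]

lemma classCount_inClass_pos (hk : 1 ≤ k) (hkd : k ≤ d) {Loc : LocalCond d}
    (hL : Loc.Basic) {n : ℕ} (hn : 1 ≤ n) : 0 < classCount (InClass k Loc) n := by
  obtain ⟨m, rfl⟩ := Nat.exists_eq_add_of_le' hn
  exact (classCount_rightEnd_pos hk hkd ⟨0, by omega⟩ hL m).trans_le
    (classCount_mono (Loc := Loc) (fun M h => h) (fun M h => h.1) _)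

/-- The growth constant of a class exists as soon as its members can be changed, in a controlled
way, into members with a single rightmost face. -/
lemma exists_growth_of_rightEnd (hk : 1 ≤ k) (hkd : k ≤ d) (x : Fin d) {Loc : LocalCond d}
    (hL : Loc.Basic) (hI : Loc.Invariant) {K p : ℕ}
    (hcap : ∀ n, classCount (InClass k Loc) n ≤
      K * classCount (fun M => InClass k Loc M ∧ ∃ f, RightEnd x M.faces f) (n + p)) :
    ∃ μ : ℝ, Tendsto (fun n : ℕ => (classCount (InClass k Loc) n : ℝ) ^ ((1 : ℝ) / n))
      atTop (𝓝 μ) := by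
  obtain ⟨C, hC⟩ := finite_classes_and_ncard_le d
  refine exists_tendsto_rpow_of_supermul (K := K * K * Fintype.card (Equiv.Perm (Fin d)))
    (p := p + p) (N := 1) (C := C) (fun i j => ?_)
    (fun n hn => classCount_inClass_pos hk hkd hL hn)
    fun n => (hC (InClass k Loc) (fun M h => ⟨h.supp, h.conn⟩) n).2
  refine (Nat.mul_le_mul (hcap i) (hcap j)).trans ?_
  have := classCount_rightEnd_mul_le (k := k) (x := x) hL hI (i + p) (j + p)
  rw [show i + p + (j + p) = i + j + (p + p) by ring] at this
  calc _ = K * K * (_ * _) := by ring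
    _ ≤ K * K * _ := Nat.mul_le_mul_left _ this
    _ = _ := by ring


/-! ### Fixed polyominoids -/

/-- All faces at a hyperedge are connected. -/
def locXD : LocalCond d := fun _ F r => ∀ a b, r a b ↔ a ∈ F ∧ b ∈ F ∧ a ≠ b

lemma basic_locXD : (locXD : LocalCond d).Basic where
  empty := by simp [locXD]
  single := fun _ f a b => by
    simp only [Finset.mem_singleton, false_iff]
    rintro ⟨rfl, rfl, h⟩
    exact h rfl
  pair := fun _ f f' hne a b => by
    simp only [pairRel, Finset.mem_insert, Finset.mem_singleton]
    grind

lemma mem_image_turn {π : Equiv.Perm (Fin d)} {t : Fin d → ℤ} {F : Finset (Cell d)} {a : Cell d} :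
    a ∈ F.image (turn π t) ↔ (turn π t).symm a ∈ F := by
  rw [Finset.mem_image]
  constructor
  · rintro ⟨c, hc, rfl⟩; simpa using hc
  · intro h; exact ⟨_, h, by simp⟩

lemma invariant_locXD : (locXD : LocalCond d).Invariant := by
  intro π t g F r h a b
  beta_reduce
  rw [h, mem_image_turn, mem_image_turn, (turn π t).symm.injective.ne_iff]

lemma exists_rightmost (x : Fin d) {S : Finset (Cell d)} (hS : S.Nonempty) :
    ∃ f ∈ S, ∀ a ∈ S, a x ≤ f x := Finset.exists_max_image S (fun c => c x) hS

lemma joinable_single_of_notMem {x : Fin d} {S : Finset (Cell d)} {f : Cell d} {v : Fin d × Bool}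
    (hf : f ∈ S) (hx : x ∉ halfInt f) (hv : v.1 ∈ halfInt f) (hmax : ∀ a ∈ S, a x ≤ f x) :
    Joinable x S {f + unit v + unit (x, true)} (f + unit v) where
  notMem := by rw [halfInt_add_unit hv]; simp [hx]
  left := fun a ha => by
    rw [Pi.add_apply, unit_apply_of_ne (by rintro rfl; exact hx hv), add_zero]
    exact hmax a ha
  mem := Finset.mem_singleton_self _
  right := fun b hb => .inl (Finset.mem_singleton.1 hb)
  nonempty := ⟨f, mem_facesAt.2 ⟨hf, neighbours_add_unit hv⟩⟩

/-- If the rightmost face is perpendicular to `x`, a new face in the direction `x` is attached at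
any of its hyperedges. Other faces meeting there do no harm, as a polyominoid has no bound on their
number. -/
lemma extendable_of_inClass_locXD (hk : 1 ≤ k) (x : Fin d) {M : LinkedFaces d}
    (hM : InClass k locXD M) : ∃ g, Extendable k x locXD M g := by
  obtain ⟨f, hf, hmax⟩ := exists_rightmost x hM.conn.1
  by_cases hx : x ∈ halfInt f
  · exact ⟨_, extendable_of_rightmost basic_locXD hM hf hx hmax⟩
  · obtain ⟨j, hj⟩ : (halfInt f).Nonempty := by
      rw [← Finset.card_pos, hM.cube f hf]; exact hk
    have hJ := joinable_single_of_notMem (v := (j, true)) hf hx hj hmax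
    refine ⟨_, hJ, fun a b => ?_⟩
    have hne : ∀ c ∈ facesAt M.faces (f + unit (j, true)),
        c ≠ f + unit (j, true) + unit (x, true) := by
      rintro c hc rfl
      exact Finset.disjoint_left.1 hJ.disjoint (mem_facesAt.1 hc).1 hJ.mem
    have := hM.loc (f + unit (j, true)) a b
    simp only [glueRel, this, Finset.mem_insert]
    grind

lemma fullLink_image_isXD (n : ℕ) :
    fullLink '' {S : Finset (Cell d) | IsXD k S ∧ S.card = n} =
      {M | InClass k locXD M ∧ M.faces.card = n} := by
  ext M
  constructor
  · rintro ⟨S, ⟨hS, hn⟩, rfl⟩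
    exact ⟨⟨hS.1, supported_fullLink S, fun g a b => Iff.rfl,
      connectedBy_fullLink_iff.2 hS.2⟩, hn⟩
  · rintro ⟨hM, hn⟩
    have e : fullLink M.faces = M := by
      ext1
      · rfl
      · ext g a b
        exact (hM.loc g a b).symm
    exact ⟨M.faces, ⟨⟨hM.cube, connectedBy_fullLink_iff.1 (by rw [e]; exact hM.conn)⟩, hn⟩, e⟩

lemma countXD_eq (d k n : ℕ) : countXD d k n = classCount (InClass (d := d) k locXD) n := by
  rw [countXD, classCount, (ncard_faceClasses_eq _).1, fullLink_image_isXD]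

theorem exists_growth_countXD (hk : 1 ≤ k) (hkd : k ≤ d) :
    ∃ μ : ℝ, Tendsto (fun n : ℕ => (countXD d k n : ℝ) ^ ((1 : ℝ) / n)) atTop (𝓝 μ) := by
  simp only [countXD_eq]
  set x : Fin d := ⟨0, by omega⟩
  refine exists_growth_of_rightEnd (K := 1) (p := 1) hk hkd x basic_locXD invariant_locXD
    fun n => ?_
  rw [one_mul]
  exact (classCount_mono (Loc := locXD) (fun M h => h.1)
    (fun M hM => ⟨hM, extendable_of_inClass_locXD hk x hM⟩) n).trans
      (classCount_extendable_le basic_locXD n)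

/-! ### Self-osculating and self-avoiding manifolds -/

/-- The local condition for self-osculating manifolds and, if `sam` holds, for self-avoiding
manifolds. -/
def locSOM (sam : Prop) : LocalCond d := fun g F r =>
  IsPairing F r ∧ (2 < F.card → Osculating g F r) ∧ (sam → F.card ≤ 2)

lemma isPairing_empty : IsPairing (∅ : Finset (Cell d)) fun _ _ => False := by
  simp [IsPairing]

lemma isPairing_singleton (f : Cell d) : IsPairing {f} fun _ _ => False := by
  refine ⟨fun _ _ h => h.elim, fun _ _ h => h, fun _ _ _ h => h.elim, by simp, fun _ => ?_⟩
  exact ⟨f, by simp, by simp⟩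

lemma isPairing_pair {f f' : Cell d} (h : f ≠ f') : IsPairing {f, f'} (pairRel f f') := by
  refine ⟨?_, ?_, ?_, ?_, ?_⟩
  · simp only [pairRel, Finset.mem_insert, Finset.mem_singleton]; grind
  · simp only [pairRel]; grind
  · simp only [pairRel]; grind
  · intro _ a ha
    simp only [Finset.mem_insert, Finset.mem_singleton] at ha
    rcases ha with rfl | rfl
    · exact ⟨f', .inl ⟨rfl, rfl⟩⟩
    · exact ⟨f, .inr ⟨rfl, rfl⟩⟩
  · rw [Finset.card_pair h]
    intro h; exact absurd h (by decide)

lemma basic_locSOM (sam : Prop) : (locSOM sam : LocalCond d).Basic where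
  empty := fun _ => ⟨isPairing_empty, by simp, by simp⟩
  single := fun _ f => ⟨isPairing_singleton f, by simp, by simp⟩
  pair := fun _ f f' h => ⟨isPairing_pair h, by simp [Finset.card_pair h],
    by simp [Finset.card_pair h]⟩

/-- Pairings are transported along bijections. -/
lemma IsPairing.image {F : Finset (Cell d)} {r : Cell d → Cell d → Prop} (h : IsPairing F r)
    (e : Cell d ≃ Cell d) : IsPairing (F.image e) fun a b => r (e.symm a) (e.symm b) := by
  obtain ⟨h1, h2, h3, h4, h5⟩ := h
  have hm : ∀ a, a ∈ F.image e ↔ e.symm a ∈ F := fun a => by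
    rw [Finset.mem_image]
    exact ⟨fun ⟨c, hc, e⟩ => by simpa [← e] using hc, fun h => ⟨_, h, by simp⟩⟩
  have hcard : (F.image e).card = F.card := Finset.card_image_of_injective _ e.injective
  refine ⟨fun a b hab => ?_, fun a b hab => h2 _ _ hab,
    fun a b c hab hac => e.symm.injective (h3 _ _ _ hab hac), fun hE a ha => ?_, fun hO => ?_⟩
  · obtain ⟨ha, hb, hne⟩ := h1 _ _ hab
    exact ⟨(hm a).2 ha, (hm b).2 hb, fun e => hne (by rw [e])⟩
  · rw [hcard] at hE
    obtain ⟨b, hb⟩ := h4 hE _ ((hm a).1 ha)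
    exact ⟨e b, by simpa using hb⟩
  · rw [hcard] at hO
    obtain ⟨a, ⟨ha, hn⟩, hu⟩ := h5 hO
    refine ⟨e a, ⟨Finset.mem_image_of_mem e ha, fun b => by simpa using hn _⟩, fun c hc => ?_⟩
    rw [← hu (e.symm c) ⟨(hm c).1 hc.1, fun b => by simpa using hc.2 (e b)⟩, e.apply_symm_apply]

lemma turn_sub_turn (π : Equiv.Perm (Fin d)) (t : Fin d → ℤ) (a b : Cell d) :
    turn π t a - turn π t b = fun i => -(a - b) (π i) := by
  ext i
  rw [Pi.sub_apply, Pi.sub_apply, turn_apply, turn_apply]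
  ring

lemma PairsOsculate.turn {g : Cell d} {r : Cell d → Cell d → Prop} (h : PairsOsculate g r)
    (π : Equiv.Perm (Fin d)) (t : Fin d → ℤ) :
    PairsOsculate (turn π t g)
      fun a b => r ((RestrictedManifold.turn π t).symm a)
        ((RestrictedManifold.turn π t).symm b) := by
  intro f₁ f₂ f₃ f₄ h12 h34 hne
  obtain ⟨f₁, rfl⟩ := (RestrictedManifold.turn π t).surjective f₁
  obtain ⟨f₂, rfl⟩ := (RestrictedManifold.turn π t).surjective f₂
  obtain ⟨f₃, rfl⟩ := (RestrictedManifold.turn π t).surjective f₃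
  obtain ⟨f₄, rfl⟩ := (RestrictedManifold.turn π t).surjective f₄
  simp only [Equiv.symm_apply_apply] at h12 h34
  obtain ⟨hnd, hs⟩ := h f₁ f₂ f₃ f₄ h12 h34 (fun e => hne (by
    have := congrArg (Sym2.map (RestrictedManifold.turn π t)) e
    simpa using this))
  refine ⟨by simpa using List.Nodup.map (RestrictedManifold.turn π t).injective hnd, fun hst => ?_⟩
  rw [turn_sub_turn, turn_sub_turn] at hst ⊢
  have h1 := hs (by
    ext i
    have := congrFun hst (π.symm i)
    simp only [Pi.neg_apply, Equiv.apply_symm_apply] at this ⊢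
    linarith)
  rw [← h1, dotProduct, dotProduct, ← Equiv.sum_comp π fun i => (f₃ - g) i * (f₄ - g) i]
  exact Finset.sum_congr rfl fun i _ => by ring

lemma invariant_locSOM (sam : Prop) : (locSOM sam : LocalCond d).Invariant := by
  rintro π t g F r ⟨h1, h2, h3⟩
  have hcard : (F.image (turn π t)).card = F.card :=
    Finset.card_image_of_injective _ (turn π t).injective
  refine ⟨h1.image _, ?_, by rwa [hcard]⟩
  rw [hcard]
  intro hc
  obtain ⟨hE, hO⟩ := h2 hc
  refine ⟨fun h => (hE (hcard ▸ h)).turn π t, fun h => ?_⟩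
  obtain ⟨a, ha, hl, y, hy, hyg, hr⟩ := hO (hcard ▸ h)
  refine ⟨turn π t a, Finset.mem_image_of_mem _ ha, fun b => by simpa using hl _, turn π t y,
    fun h => hy (by simpa using mem_image_turn.1 h), neighbours_turn.2 hyg, ?_⟩
  convert hr.turn π t using 1
  ext b c
  simp only [addPair, Equiv.symm_apply_eq]

lemma isSOM_iff {M : LinkedFaces d} : IsSOM k M ↔ InClass k (locSOM False) M := by
  constructor
  · rintro ⟨h1, h2, h3, h4⟩
    exact ⟨h1, fun g a b h => (h2 g).1 a b h, fun g => ⟨h2 g, h3 g, False.elim⟩, h4⟩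
  · rintro ⟨h1, -, h3, h4⟩
    exact ⟨h1, fun g => (h3 g).1, fun g => (h3 g).2.1, h4⟩

lemma countSOM_eq (d k n : ℕ) :
    countSOM d k n = classCount (InClass (d := d) k (locSOM False)) n := by
  simp only [countSOM, classCount, isSOM_iff]

/-- With at most two faces there is no choice of pairing. Hence a SAM is the same as a linked
structure with at most two faces at each hyperedge. -/
lemma isPairing_iff_of_card_le_two {F : Finset (Cell d)} {r : Cell d → Cell d → Prop}
    (h : F.card ≤ 2) : IsPairing F r ↔ ∀ a b, r a b ↔ a ∈ F ∧ b ∈ F ∧ a ≠ b := by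
  constructor
  · rintro ⟨h1, h2, h3, h4, h5⟩ a b
    refine ⟨h1 a b, fun ⟨ha, hb, hab⟩ => ?_⟩
    have h2 : F.card = 2 := le_antisymm h (Finset.one_lt_card.2 ⟨a, ha, b, hb, hab⟩)
    obtain ⟨c, hc⟩ := h4 (by rw [h2]; decide) a ha
    obtain ⟨-, hcF, hac⟩ := h1 a c hc
    obtain ⟨u, v, -, rfl⟩ := Finset.card_eq_two.1 h2
    simp only [Finset.mem_insert, Finset.mem_singleton] at ha hb hcF
    obtain rfl : c = b := by grind
    exact hc
  · intro hr
    have h0 : F.card = 0 ∨ F.card = 1 ∨ F.card = 2 := by omega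
    rcases h0 with h0 | h0 | h0
    · obtain rfl := Finset.card_eq_zero.1 h0
      convert isPairing_empty (d := d) using 1
      ext a b; simp [hr]
    · obtain ⟨f, rfl⟩ := Finset.card_eq_one.1 h0
      convert isPairing_singleton f using 1
      ext a b; simp [hr]; grind
    · obtain ⟨f, f', hne, rfl⟩ := Finset.card_eq_two.1 h0
      convert isPairing_pair hne using 1
      ext a b; simp only [hr, pairRel, Finset.mem_insert, Finset.mem_singleton]; grind

lemma fullLink_image_isSAM (n : ℕ) :
    fullLink '' {S : Finset (Cell d) | IsSAM k S ∧ S.card = n} =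
      {M | InClass k (locSOM True) M ∧ M.faces.card = n} := by
  ext M
  constructor
  · rintro ⟨S, ⟨hS, hn⟩, rfl⟩
    refine ⟨⟨hS.1.1, supported_fullLink S, fun g => ⟨?_, fun h => ?_, fun _ => hS.2 g⟩,
      connectedBy_fullLink_iff.2 hS.1.2⟩, hn⟩
    · exact (isPairing_iff_of_card_le_two (hS.2 g)).2 fun a b => Iff.rfl
    · exact absurd (hS.2 g) (not_le.2 h)
  · rintro ⟨hM, hn⟩
    have hc : ∀ g, (facesAt M.faces g).card ≤ 2 := fun g => (hM.loc g).2.2 trivial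
    have e : fullLink M.faces = M := by
      ext1
      · rfl
      · ext g a b
        exact ((isPairing_iff_of_card_le_two (hc g)).1 (hM.loc g).1 a b).symm
    exact ⟨M.faces, ⟨⟨⟨hM.cube, connectedBy_fullLink_iff.1 (by rw [e]; exact hM.conn)⟩, hc⟩,
      hn⟩, e⟩

lemma countSAM_eq (d k n : ℕ) :
    countSAM d k n = classCount (InClass (d := d) k (locSOM True)) n := by
  rw [countSAM, classCount, (ncard_faceClasses_eq _).1, fullLink_image_isSAM]


/-! ### Changing the pairing at a hyperedge -/

/-- Connectedness as the absence of non-constant invariant two-colourings. In this form two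
obstructions can be combined by `↔`, as the next two lemmas do. -/
lemma connectedBy_iff_coloring {S : Finset (Cell d)} {r : Cell d → Cell d → Prop}
    (hr : ∀ a b, r a b → r b a) : ConnectedBy S r ↔ S.Nonempty ∧ ∀ p : Cell d → Prop,
      (∀ a ∈ S, ∀ b ∈ S, r a b → (p a ↔ p b)) → ∀ a ∈ S, ∀ b ∈ S, p a ↔ p b := by
  constructor
  · refine fun h => ⟨h.1, fun p hp a ha b hb => ?_⟩
    induction h.2 a ha b hb with
    | refl => rfl
    | tail _ h ih => exact (ih h.1).trans (hp _ h.1 _ h.2.1 h.2.2)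
  · refine fun h => ⟨h.1, fun a ha b hb => ?_⟩
    refine (h.2 (fun v => Relation.ReflTransGen (fun a b => a ∈ S ∧ b ∈ S ∧ r a b) a v)
      (fun u hu v hv huv => ⟨fun h => h.tail ⟨hu, hv, huv⟩, fun h => h.tail ⟨hv, hu, hr _ _ huv⟩⟩)
      a ha b hb).1 .refl

lemma pairRel_symm {f f' a b : Cell d} (h : pairRel f f' a b) : pairRel f f' b a :=
  h.symm.imp And.symm And.symm

/-- Two links `a b` and `c e` of a connected graph can be replaced by `a c` and `b e` or by
`a e` and `b c` in such a way that it stays connected. -/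
lemma ConnectedBy.swap {S : Finset (Cell d)} {s : Cell d → Cell d → Prop}
    (hs : ∀ a b, s a b → s b a) {a b c e : Cell d} (ha : a ∈ S) (hb : b ∈ S) (hc : c ∈ S)
    (he : e ∈ S) (h : ConnectedBy S fun u v => s u v ∨ pairRel a b u v ∨ pairRel c e u v) :
    (ConnectedBy S fun u v => s u v ∨ pairRel a c u v ∨ pairRel b e u v) ∨
    ConnectedBy S fun u v => s u v ∨ pairRel a e u v ∨ pairRel b c u v := by
  have hsymm : ∀ x y z w : Cell d, ∀ u v, (s u v ∨ pairRel x y u v ∨ pairRel z w u v) →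
      (s v u ∨ pairRel x y v u ∨ pairRel z w v u) := fun x y z w u v =>
    Or.imp (hs u v) (Or.imp pairRel_symm pairRel_symm)
  rw [connectedBy_iff_coloring (hsymm _ _ _ _)] at h ⊢
  rw [connectedBy_iff_coloring (hsymm _ _ _ _)]
  by_contra hcon
  simp only [not_or, not_and, not_forall] at hcon
  obtain ⟨h1, h2⟩ := hcon
  obtain ⟨p, hp, u₁, hu₁, v₁, hv₁, hne₁⟩ := h1 h.1
  obtain ⟨q, hq, u₂, hu₂, v₂, hv₂, hne₂⟩ := h2 h.1
  have hps : ∀ u ∈ S, ∀ v ∈ S, s u v → (p u ↔ p v) := fun u hu v hv h => hp u hu v hv (.inl h)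
  have hqs : ∀ u ∈ S, ∀ v ∈ S, s u v → (q u ↔ q v) := fun u hu v hv h => hq u hu v hv (.inl h)
  have hpac := hp a ha c hc (.inr (.inl (.inl ⟨rfl, rfl⟩)))
  have hpbe := hp b hb e he (.inr (.inr (.inl ⟨rfl, rfl⟩)))
  have hqae := hq a ha e he (.inr (.inl (.inl ⟨rfl, rfl⟩)))
  have hqbc := hq b hb c hc (.inr (.inr (.inl ⟨rfl, rfl⟩)))
  have key : ∀ w : Cell d → Prop, (∀ u ∈ S, ∀ v ∈ S, s u v → (w u ↔ w v)) → (w a ↔ w b) →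
      (w c ↔ w e) → ∀ u ∈ S, ∀ v ∈ S, w u ↔ w v := by
    intro w hw hab hce
    refine h.2 w fun u hu v hv huv => ?_
    rcases huv with huv | (⟨rfl, rfl⟩ | ⟨rfl, rfl⟩) | (⟨rfl, rfl⟩ | ⟨rfl, rfl⟩)
    · exact hw u hu v hv huv
    · exact hab
    · exact hab.symm
    · exact hce
    · exact hce.symm
  have hp' : ¬ (p a ↔ p b) := fun hab => by
    have := key p hps hab (hpac.symm.trans (hab.trans hpbe)) u₁ hu₁ v₁ hv₁
    exact hne₁ this
  have hq' : ¬ (q a ↔ q b) := fun hab => by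
    have := key q hqs hab (hqbc.symm.trans (hab.symm.trans hqae)) u₂ hu₂ v₂ hv₂
    exact hne₂ this
  -- If both replacements were disconnected, with colourings `p` and `q`, then from `a` to `b` both
  -- colours change, and likewise from `c` to `e`. So `p ↔ q` respects the original links, yet it
  -- differs at `a` and `c`, since `p` agrees there and `q` does not.
  have := key (fun u => p u ↔ q u) (fun u hu v hv h => iff_congr (hps u hu v hv h)
    (hqs u hu v hv h)) (by clear * - hpac hpbe hqae hqbc hp' hq'; grind)
    (by clear * - hpac hpbe hqae hqbc hp' hq'; grind) a ha c hc
  clear * - this hpac hpbe hqae hqbc hp' hq'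
  grind

/-- A link `b c` of a connected graph can be replaced by a link `l b` or `l c` in such a way that
the graph stays connected. -/
lemma ConnectedBy.move {S : Finset (Cell d)} {s : Cell d → Cell d → Prop}
    (hs : ∀ a b, s a b → s b a) {l b c : Cell d} (hl : l ∈ S) (hb : b ∈ S) (hc : c ∈ S)
    (h : ConnectedBy S fun u v => s u v ∨ pairRel b c u v) :
    (ConnectedBy S fun u v => s u v ∨ pairRel l b u v) ∨
    ConnectedBy S fun u v => s u v ∨ pairRel l c u v := by
  have hsymm : ∀ x y : Cell d, ∀ u v, (s u v ∨ pairRel x y u v) → (s v u ∨ pairRel x y v u) :=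
    fun x y u v => Or.imp (hs u v) pairRel_symm
  rw [connectedBy_iff_coloring (hsymm _ _)] at h ⊢
  rw [connectedBy_iff_coloring (hsymm _ _)]
  by_contra hcon
  simp only [not_or, not_and, not_forall] at hcon
  obtain ⟨h1, h2⟩ := hcon
  obtain ⟨p, hp, u₁, hu₁, v₁, hv₁, hne₁⟩ := h1 h.1
  obtain ⟨q, hq, u₂, hu₂, v₂, hv₂, hne₂⟩ := h2 h.1
  have hps : ∀ u ∈ S, ∀ v ∈ S, s u v → (p u ↔ p v) := fun u hu v hv h => hp u hu v hv (.inl h)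
  have hqs : ∀ u ∈ S, ∀ v ∈ S, s u v → (q u ↔ q v) := fun u hu v hv h => hq u hu v hv (.inl h)
  have hplb := hp l hl b hb (.inr (.inl ⟨rfl, rfl⟩))
  have hqlc := hq l hl c hc (.inr (.inl ⟨rfl, rfl⟩))
  have key : ∀ w : Cell d → Prop, (∀ u ∈ S, ∀ v ∈ S, s u v → (w u ↔ w v)) → (w b ↔ w c) →
      ∀ u ∈ S, ∀ v ∈ S, w u ↔ w v := by
    intro w hw hbc
    refine h.2 w fun u hu v hv huv => ?_
    rcases huv with huv | (⟨rfl, rfl⟩ | ⟨rfl, rfl⟩)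
    · exact hw u hu v hv huv
    · exact hbc
    · exact hbc.symm
  have hp' : ¬ (p b ↔ p c) := fun hbc => by
    exact hne₁ (key p hps hbc u₁ hu₁ v₁ hv₁)
  have hq' : ¬ (q b ↔ q c) := fun hbc => by
    exact hne₂ (key q hqs hbc u₂ hu₂ v₂ hv₂)
  -- Both `p` and `q` distinguish `b` from `c`, so `p ↔ q` respects the link `b c`. But `p` agrees
  -- at `l` and `b` while `q` does not, so it is not constant.
  have := key (fun u => p u ↔ q u) (fun u hu v hv h => iff_congr (hps u hu v hv h)
    (hqs u hu v hv h)) (by clear * - hplb hqlc hp' hq'; grind) l hl b hb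
  clear * - this hplb hqlc hp' hq'
  grind

/-- The position opposite to `a` with respect to `g`. -/
def opposite (g a : Cell d) : Cell d := g + g - a

lemma opposite_opposite (g a : Cell d) : opposite g (opposite g a) = a := by
  simp [opposite]

lemma opposite_add_unit (g : Cell d) (v : Fin d × Bool) :
    opposite g (g + unit v) = g + unit (v.1, !v.2) := by
  rw [opposite, ← neg_unit]; abel

lemma Neighbours.opposite {f g : Cell d} (h : Neighbours f g) : Neighbours (opposite g f) g := by
  obtain ⟨v, hv, rfl⟩ := neighbours_iff'.1 h
  rw [opposite_add_unit]
  exact neighbours_of_add_unit (v := (v.1, !v.2)) hv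

lemma Neighbours.opposite_ne {f g : Cell d} (h : Neighbours f g) :
    RestrictedManifold.opposite g f ≠ f := by
  obtain ⟨v, hv, rfl⟩ := neighbours_iff'.1 h
  rw [opposite_add_unit, Ne, add_right_inj, unit_injective.eq_iff]
  intro h
  have := congrArg Prod.snd h
  simp at this

lemma sub_eq_neg_sub_iff {g a b : Cell d} : a - g = -(b - g) ↔ b = opposite g a := by
  rw [opposite]
  constructor
  · intro h
    have : b = g - (a - g) := by rw [h]; abel
    rw [this]; abel
  · rintro rfl; abel

lemma dotProduct_eq_zero_of_ne_opposite {g a b : Cell d} (ha : Neighbours a g)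
    (hb : Neighbours b g) (hab : a ≠ b) (h : b ≠ opposite g a) : (a - g) ⬝ᵥ (b - g) = 0 := by
  obtain ⟨v, -, rfl⟩ := neighbours_iff'.1 ha
  obtain ⟨w, -, rfl⟩ := neighbours_iff'.1 hb
  rw [add_sub_cancel_left, add_sub_cancel_left]
  have hvw : v.1 ≠ w.1 := by
    intro e
    rw [opposite_add_unit] at h
    obtain ⟨i, b⟩ := v
    obtain ⟨j, c⟩ := w
    simp only at e
    subst e
    cases b <;> cases c <;> simp_all
  rw [unit, single_dotProduct, unit_apply_of_ne hvw, mul_zero]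

/-- Two distinct positions at `g` are opposite or perpendicular. The osculating condition is
therefore violated only by two different straight pairs, that is, pairs of opposite positions. -/
lemma pairsOsculate_of_straight {g : Cell d} {r : Cell d → Cell d → Prop}
    (hn : ∀ a b, r a b → Neighbours a g ∧ a ≠ b) (hs : ∀ a b, r a b → r b a)
    (hu : ∀ a b c, r a b → r a c → b = c)
    (h1 : ∀ a c, r a (opposite g a) → r c (opposite g c) → c = a ∨ c = opposite g a) :
    PairsOsculate g r := by
  intro f₁ f₂ f₃ f₄ h12 h34 hne
  have e13 : f₁ ≠ f₃ := by
    rintro rfl; exact hne (by rw [hu _ _ _ h12 h34])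
  have e14 : f₁ ≠ f₄ := by
    rintro rfl; exact hne (by rw [hu _ _ _ h12 (hs _ _ h34), Sym2.eq_swap])
  have e23 : f₂ ≠ f₃ := by
    rintro rfl; exact hne (by rw [hu _ _ _ (hs _ _ h12) h34, Sym2.eq_swap])
  have e24 : f₂ ≠ f₄ := by
    rintro rfl; exact hne (by rw [hu _ _ _ (hs _ _ h12) (hs _ _ h34)])
  have e12 := (hn _ _ h12).2
  have e34 := (hn _ _ h34).2
  refine ⟨by simp [e12, e13, e14, e23, e24, e34], fun hst => ?_⟩
  rw [sub_eq_neg_sub_iff] at hst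
  subst hst
  refine dotProduct_eq_zero_of_ne_opposite (hn _ _ h34).1 (hn _ _ (hs _ _ h34)).1 e34 ?_
  rintro rfl
  rcases h1 _ _ h12 h34 with h | h
  · exact e13 h.symm
  · exact e23 h.symm

lemma even_card_of_involution {α : Type*} [DecidableEq α] {F : Finset α} (σ : α → α)
    (h1 : ∀ a ∈ F, σ a ∈ F) (h2 : ∀ a ∈ F, σ a ≠ a) (h3 : ∀ a ∈ F, σ (σ a) = a) :
    Even F.card := by
  have : ∑ _a ∈ F, (1 : ZMod 2) = 0 :=
    Finset.sum_involution (fun a _ => σ a) (fun a ha => by decide) (fun a ha _ => h2 a ha)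
      (fun a ha => h1 a ha) (fun a ha => h3 a ha)
  rw [Finset.sum_const, nsmul_eq_mul, mul_one, ZMod.natCast_eq_zero_iff_even] at this
  exact this

/-- Two pairings with the same lone faces. -/
lemma IsPairing.of_same_domain {F : Finset (Cell d)} {r r' : Cell d → Cell d → Prop}
    (h : IsPairing F r) (h1 : ∀ a b, r' a b → a ∈ F ∧ b ∈ F ∧ a ≠ b)
    (h2 : ∀ a b, r' a b → r' b a) (h3 : ∀ a b c, r' a b → r' a c → b = c)
    (hd : ∀ a, (∃ b, r' a b) ↔ ∃ b, r a b) : IsPairing F r' := by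
  refine ⟨h1, h2, h3, fun hE a ha => (hd a).2 (h.2.2.2.1 hE a ha), fun hO => ?_⟩
  have hd' : ∀ a, (∀ b, ¬ r' a b) ↔ ∀ b, ¬ r a b := fun a => by
    simpa using not_congr (hd a)
  simpa only [hd'] using h.2.2.2.2 hO

/-- The part of a pairing that does not involve the faces in `X`. -/
def avoid (r : Cell d → Cell d → Prop) (X : Set (Cell d)) : Cell d → Cell d → Prop :=
  fun u v => r u v ∧ u ∉ X ∧ v ∉ X

section Repair

variable {F : Finset (Cell d)} {r : Cell d → Cell d → Prop}

lemma isPairing_swap (h : IsPairing F r) {a b c e : Cell d} (hab : r a b) (hce : r c e)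
    (hac : a ≠ c) (hae : a ≠ e) :
    IsPairing F fun u v => avoid r {a, b, c, e} u v ∨ pairRel a c u v ∨ pairRel b e u v := by
  have h0 := h
  obtain ⟨h1, h2, h3, -, -⟩ := h
  have hba := h2 _ _ hab
  have hec := h2 _ _ hce
  obtain ⟨haF, hbF, hab'⟩ := h1 _ _ hab
  obtain ⟨hcF, heF, hce'⟩ := h1 _ _ hce
  have hbc : b ≠ c := by rintro rfl; exact hae (h3 _ _ _ hba hce)
  have hbe : b ≠ e := by rintro rfl; exact hac (h3 _ _ _ hba hec)
  refine h0.of_same_domain ?_ ?_ ?_ ?_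
  · rintro u v (h | (⟨rfl, rfl⟩ | ⟨rfl, rfl⟩) | (⟨rfl, rfl⟩ | ⟨rfl, rfl⟩))
    · exact h1 _ _ h.1
    · exact ⟨haF, hcF, hac⟩
    · exact ⟨hcF, haF, hac.symm⟩
    · exact ⟨hbF, heF, hbe⟩
    · exact ⟨heF, hbF, hbe.symm⟩
  · rintro u v (h | h)
    · exact .inl ⟨h2 _ _ h.1, h.2.2, h.2.1⟩
    · exact .inr (h.imp pairRel_symm pairRel_symm)
  · rintro u v w (h | (⟨rfl, rfl⟩ | ⟨rfl, rfl⟩) | (⟨rfl, rfl⟩ | ⟨rfl, rfl⟩))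
      (h' | (⟨h5, rfl⟩ | ⟨h5, rfl⟩) | (⟨h5, rfl⟩ | ⟨h5, rfl⟩))
    · exact h3 _ _ _ h.1 h'.1
    all_goals try have := h.2.1
    all_goals try have := h'.2.1
    all_goals simp_all
  · intro u
    have hav : ∀ u, u ∉ ({a, b, c, e} : Set (Cell d)) → ∀ v, r u v →
        v ∉ ({a, b, c, e} : Set (Cell d)) := by
      intro u hu v huv hv
      have hvu := h2 _ _ huv
      simp only [Set.mem_insert_iff, Set.mem_singleton_iff, not_or] at hu hv
      rcases hv with rfl | rfl | rfl | rfl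
      · exact hu.2.1 (h3 _ _ _ hvu hab)
      · exact hu.1 (h3 _ _ _ hvu hba)
      · exact hu.2.2.2 (h3 _ _ _ hvu hce)
      · exact hu.2.2.1 (h3 _ _ _ hvu hec)
    by_cases hu : u ∈ ({a, b, c, e} : Set (Cell d))
    · refine iff_of_true ?_ ?_ <;> rcases hu with rfl | rfl | rfl | rfl
      · exact ⟨c, .inr (.inl (.inl ⟨rfl, rfl⟩))⟩
      · exact ⟨e, .inr (.inr (.inl ⟨rfl, rfl⟩))⟩
      · exact ⟨a, .inr (.inl (.inr ⟨rfl, rfl⟩))⟩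
      · exact ⟨b, .inr (.inr (.inr ⟨rfl, rfl⟩))⟩
      · exact ⟨_, hab⟩
      · exact ⟨_, hba⟩
      · exact ⟨_, hce⟩
      · exact ⟨_, hec⟩
    · refine exists_congr fun v => ⟨?_, fun h => .inl ⟨h, hu, hav u hu v h⟩⟩
      rintro (h | (⟨rfl, rfl⟩ | ⟨rfl, rfl⟩) | (⟨rfl, rfl⟩ | ⟨rfl, rfl⟩))
      · exact h.1
      all_goals simp at hu

lemma isPairing_move (h : IsPairing F r) (hO : Odd F.card) {l b c : Cell d} (hl : l ∈ F)
    (hlone : ∀ v, ¬ r l v) (hbc : r b c) :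
    IsPairing F fun u v => avoid r {b, c} u v ∨ pairRel l b u v := by
  obtain ⟨h1, h2, h3, -, h5⟩ := h
  have hcb := h2 _ _ hbc
  obtain ⟨hbF, hcF, hbc'⟩ := h1 _ _ hbc
  have hlb : l ≠ b := by rintro rfl; exact hlone _ hbc
  have hlc : l ≠ c := by rintro rfl; exact hlone _ hcb
  have huniq : ∀ u ∈ F, (∀ v, ¬ r u v) → u = l := fun u hu huv =>
    (h5 hO).unique ⟨hu, huv⟩ ⟨hl, hlone⟩
  refine ⟨?_, ?_, ?_, fun hE => absurd hO (Nat.not_odd_iff_even.2 hE), fun _ => ⟨c, ⟨hcF, ?_⟩, ?_⟩⟩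
  · rintro u v (h | (⟨rfl, rfl⟩ | ⟨rfl, rfl⟩))
    · exact h1 _ _ h.1
    · exact ⟨hl, hbF, hlb⟩
    · exact ⟨hbF, hl, hlb.symm⟩
  · rintro u v (h | h)
    · exact .inl ⟨h2 _ _ h.1, h.2.2, h.2.1⟩
    · exact .inr (pairRel_symm h)
  · rintro u v w (h | (⟨rfl, rfl⟩ | ⟨rfl, rfl⟩)) (h' | (⟨h5, rfl⟩ | ⟨h5, rfl⟩))
    · exact h3 _ _ _ h.1 h'.1
    · subst h5; exact absurd h.1 (hlone _)
    · subst h5; exact absurd h.2.1 (by simp)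
    · exact absurd h'.1 (hlone _)
    · rfl
    · exact absurd h5 hlb
    · exact absurd h'.2.1 (by simp)
    · exact absurd h5.symm hlb
    · rfl
  · rintro v (h | (⟨h, -⟩ | ⟨h, -⟩))
    · exact h.2.1 (by simp)
    · exact hlc h.symm
    · exact hbc' h.symm
  · rintro u ⟨hu, huv⟩
    by_contra huc
    have hub : u ≠ b := by rintro rfl; exact huv l (.inr (.inr ⟨rfl, rfl⟩))
    have hul : u ≠ l := by rintro rfl; exact huv b (.inr (.inl ⟨rfl, rfl⟩))
    refine hul (huniq u hu fun v hv => huv v (.inl ⟨hv, by simp [hub, huc], ?_⟩))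
    have hvu := h2 _ _ hv
    rintro (rfl | rfl)
    · exact huc (h3 _ _ _ hvu hbc)
    · exact hub (h3 _ _ _ hvu hcb)

open Classical in
/-- The members of `F` that are paired with the opposite position. -/
noncomputable def straight (g : Cell d) (F : Finset (Cell d)) (r : Cell d → Cell d → Prop) :
    Finset (Cell d) := F.filter fun a => r a (opposite g a)

end Repair


section Repair

variable {F : Finset (Cell d)} {r : Cell d → Cell d → Prop} {g : Cell d}

lemma mem_straight {a : Cell d} : a ∈ straight g F r ↔ a ∈ F ∧ r a (opposite g a) := by
  simp [straight]

lemma opposite_injective : Function.Injective (opposite g) := fun a b h => by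
  rw [← opposite_opposite g a, h, opposite_opposite]

/-- The new pairs join positions of different straight pairs, so neither of them is straight, and
the old straight pairs are gone. -/
lemma card_straight_swap_lt (h : IsPairing F r) {a c : Cell d} (hab : r a (opposite g a))
    (hac : a ≠ c) (hae : a ≠ opposite g c) :
    (straight g F fun u v => avoid r {a, opposite g a, c, opposite g c} u v ∨ pairRel a c u v ∨
      pairRel (opposite g a) (opposite g c) u v).card < (straight g F r).card := by
  refine Finset.card_lt_card ((Finset.ssubset_iff_of_subset fun u hu => ?_).2
    ⟨a, mem_straight.2 ⟨(h.1 _ _ hab).1, hab⟩, fun ha => ?_⟩)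
  · obtain ⟨huF, hu⟩ := mem_straight.1 hu
    refine mem_straight.2 ⟨huF, ?_⟩
    rcases hu with hu | (⟨rfl, h⟩ | ⟨rfl, h⟩) | (⟨rfl, h⟩ | ⟨rfl, h⟩)
    · exact hu.1
    · exact absurd (by rw [← h, opposite_opposite]) hae
    · exact absurd h.symm hae
    · exact absurd (by simpa [opposite_opposite] using h) hae
    · rw [opposite_opposite] at h
      exact absurd (by rw [h, opposite_opposite]) hae
  · rcases (mem_straight.1 ha).2 with h | (⟨-, h⟩ | ⟨h, -⟩) | (⟨h, h'⟩ | ⟨h, -⟩)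
    · exact h.2.1 (by simp)
    · exact hae (by rw [← h, opposite_opposite])
    · exact hac h
    · exact hac (opposite_injective h')
    · exact hae h

lemma avoid_or_pairRel (h : IsPairing F r) {b c : Cell d} (hbc : r b c) (u v : Cell d) :
    r u v ↔ avoid r {b, c} u v ∨ pairRel b c u v := by
  obtain ⟨-, h2, h3, -, -⟩ := h
  have hcb := h2 _ _ hbc
  constructor
  · intro huv
    have hvu := h2 _ _ huv
    by_cases hub : u = b
    · subst hub; exact .inr (.inl ⟨rfl, h3 _ _ _ huv hbc⟩)
    by_cases huc : u = c
    · subst huc; exact .inr (.inr ⟨rfl, h3 _ _ _ huv hcb⟩)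
    refine .inl ⟨huv, by simp [hub, huc], ?_⟩
    rintro (rfl | rfl)
    · exact huc (h3 _ _ _ hvu hbc)
    · exact hub (h3 _ _ _ hvu hcb)
  · rintro (h | ⟨rfl, rfl⟩ | ⟨rfl, rfl⟩)
    · exact h.1
    · exact hbc
    · exact hcb

lemma avoid_or_pairRel_or_pairRel (h : IsPairing F r) {a b c e : Cell d} (hab : r a b)
    (hce : r c e) (u v : Cell d) :
    r u v ↔ avoid r {a, b, c, e} u v ∨ pairRel a b u v ∨ pairRel c e u v := by
  have h1 := avoid_or_pairRel h hab u v
  have h2 := avoid_or_pairRel h hce u v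
  have h3 : pairRel a b u v → r u v := fun h => h1.2 (.inr h)
  have h4 : pairRel c e u v → r u v := fun h => h2.2 (.inr h)
  simp only [avoid, Set.mem_insert_iff, Set.mem_singleton_iff] at h1 h2 ⊢
  tauto

/-- Induction on the number of straight faces at `g`, with `h` standing for the connections at the
other hyperedges. Two straight pairs are re-paired crosswise, in whichever way keeps the set
connected. Once at most one is left, an even number of faces is in order; for an odd number a
partner for the lone face must be found that does not make a second straight pair. -/
lemma exists_repair {S : Finset (Cell d)} {h : Cell d → Cell d → Prop}
    (hh : ∀ a b, h a b → h b a) (hF : F = facesAt S g) (hp : IsPairing F r)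
    (hc : ConnectedBy S fun u v => h u v ∨ r u v) :
    ∃ r', IsPairing F r' ∧ (ConnectedBy S fun u v => h u v ∨ r' u v) ∧ Osculating g F r' := by
  induction hn : (straight g F r).card using Nat.strong_induction_on generalizing r with
  | _ n ih =>
  obtain ⟨h1, h2, h3, h4, h5⟩ := id hp
  have hFS : ∀ a ∈ F, a ∈ S := fun a ha => facesAt_subset S g (hF ▸ ha)
  have hFn : ∀ a ∈ F, Neighbours a g := fun a ha => by
    rw [hF] at ha
    exact (mem_facesAt.1 ha).2
  by_cases hcase : ∃ a c, r a (opposite g a) ∧ r c (opposite g c) ∧ a ≠ c ∧ a ≠ opposite g c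
  · obtain ⟨a, c, hab, hce, hac, hae⟩ := hcase
    have hs : ∀ u v, (h u v ∨ avoid r {a, opposite g a, c, opposite g c} u v) →
        (h v u ∨ avoid r {a, opposite g a, c, opposite g c} v u) := fun u v =>
      Or.imp (hh u v) fun h => ⟨h2 _ _ h.1, h.2.2, h.2.1⟩
    obtain ⟨ha, hb, -⟩ := h1 _ _ hab
    obtain ⟨hc', he, -⟩ := h1 _ _ hce
    have hconn := ConnectedBy.swap hs (hFS _ ha) (hFS _ hb) (hFS _ hc') (hFS _ he)
      (connectedBy_congr (fun u _ v _ _ huv => by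
        rwa [avoid_or_pairRel_or_pairRel hp hab hce, ← or_assoc] at huv) hc)
    rcases hconn with hconn | hconn
    · exact ih _ (hn ▸ card_straight_swap_lt hp hab hac hae) (isPairing_swap hp hab hce hac hae)
        (connectedBy_congr (fun u _ v _ _ huv => or_assoc.1 huv) hconn) rfl
    · have e : opposite g (opposite g c) = c := opposite_opposite g c
      have hlt := card_straight_swap_lt (c := opposite g c) hp hab hae (by rwa [e])
      have hpair := isPairing_swap hp hab (h2 _ _ hce) hae hac
      have eset : ({a, opposite g a, opposite g c, c} : Set (Cell d)) =
          {a, opposite g a, c, opposite g c} := by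
        rw [Set.pair_comm (opposite g c)]
      rw [e] at hlt
      rw [eset] at hlt hpair
      exact ih _ (hn ▸ hlt) hpair
        (connectedBy_congr (fun u _ v _ _ huv => or_assoc.1 huv) hconn) rfl
  · have hone : ∀ a c, r a (opposite g a) → r c (opposite g c) → c = a ∨ c = opposite g a := by
      intro a c ha hc
      by_contra hne
      rw [not_or] at hne
      refine hcase ⟨a, c, ha, hc, Ne.symm hne.1, fun h => hne.2 ?_⟩
      rw [h, opposite_opposite]
    have hnb : ∀ a b, r a b → Neighbours a g ∧ a ≠ b := fun a b hab =>
      ⟨hFn a (h1 _ _ hab).1, (h1 _ _ hab).2.2⟩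
    rcases Nat.even_or_odd F.card with hE | hO
    · exact ⟨r, hp, hc, fun _ => pairsOsculate_of_straight hnb h2 h3 hone,
        fun hO => absurd hO (Nat.not_odd_iff_even.2 hE)⟩
    · obtain ⟨l, ⟨hl, hlone⟩, -⟩ := h5 hO
      have add : ∀ y, y ∉ F → Neighbours y g →
          (∀ a c, addPair r l y a (opposite g a) → addPair r l y c (opposite g c) →
            c = a ∨ c = opposite g a) → Osculating g F r := by
        intro y hy hyg hst
        have hly : l ≠ y := by rintro rfl; exact hy hl
        have hry : ∀ v, ¬ r v y := fun v hv => hy (h1 _ _ hv).2.1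
        refine ⟨fun hE => absurd hO (Nat.not_odd_iff_even.2 hE), fun _ =>
          ⟨l, hl, hlone, y, hy, hyg, pairsOsculate_of_straight ?_ ?_ ?_ hst⟩⟩
        · rintro a b (h | ⟨rfl, rfl⟩ | ⟨rfl, rfl⟩)
          · exact hnb a b h
          · exact ⟨hFn _ hl, hly⟩
          · exact ⟨hyg, hly.symm⟩
        · rintro a b (h | ⟨rfl, rfl⟩ | ⟨rfl, rfl⟩)
          · exact .inl (h2 _ _ h)
          · exact .inr (.inr ⟨rfl, rfl⟩)
          · exact .inr (.inl ⟨rfl, rfl⟩)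
        · rintro a b c (h | ⟨rfl, rfl⟩ | ⟨rfl, rfl⟩) (h' | ⟨h5, rfl⟩ | ⟨h5, rfl⟩)
          · exact h3 _ _ _ h h'
          · subst h5; exact absurd h (hlone _)
          · subst h5; exact absurd (h2 _ _ h) (hry _)
          · exact absurd h' (hlone _)
          · rfl
          · exact absurd h5 hly
          · exact absurd (h2 _ _ h') (hry _)
          · exact absurd h5.symm hly
          · rfl
      -- By parity `F` is not closed under taking opposites. The free position opposite `z` is the
      -- candidate partner of the lone face `l`.
      obtain ⟨z, hz, hzF⟩ : ∃ z ∈ F, opposite g z ∉ F := by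
        by_contra! hcon
        exact Nat.not_even_iff_odd.2 hO (even_card_of_involution (opposite g) hcon
          (fun a ha => (hFn a ha).opposite_ne) fun a _ => opposite_opposite g a)
      have hyg : Neighbours (opposite g z) g := (hFn z hz).opposite
      -- The candidate completes a straight pair only if `z = l`. This hurts only if a straight pair
      -- `b c` is present already; then the link `b c` is moved to `l`, giving fewer straight faces
      -- because the position opposite `l` is empty.
      by_cases hzl : z = l
      · subst hzl
        by_cases hst : ∃ b, r b (opposite g b)
        · obtain ⟨b, hbc⟩ := hst
          set c := opposite g b with hcdef
          obtain ⟨hb, hc', -⟩ := h1 _ _ hbc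
          have hs : ∀ u v, (h u v ∨ avoid r {b, c} u v) → (h v u ∨ avoid r {b, c} v u) :=
            fun u v => Or.imp (hh u v) fun h => ⟨h2 _ _ h.1, h.2.2, h.2.1⟩
          have hconn := ConnectedBy.move hs (hFS _ hl) (hFS _ hb) (hFS _ hc')
            (connectedBy_congr (fun u _ v _ _ huv => by
              rwa [avoid_or_pairRel hp hbc, ← or_assoc] at huv) hc)
          have hlt : ∀ b' c', r b' c' → r b' (opposite g b') →
              (straight g F fun u v => avoid r {b', c'} u v ∨ pairRel z b' u v).card < n := by
            intro b' c' hb' hst'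
            rw [← hn]
            refine Finset.card_lt_card ((Finset.ssubset_iff_of_subset fun u hu => ?_).2
              ⟨b', mem_straight.2 ⟨(h1 _ _ hb').1, hst'⟩, fun ha => ?_⟩)
            · obtain ⟨huF, hu⟩ := mem_straight.1 hu
              refine mem_straight.2 ⟨huF, ?_⟩
              rcases hu with hu | ⟨rfl, h⟩ | ⟨rfl, h⟩
              · exact hu.1
              · exact absurd (h1 _ _ hb').1 (h ▸ hzF)
              · exact hst'
            · rcases (mem_straight.1 ha).2 with h | ⟨h, -⟩ | ⟨-, h⟩
              · exact h.2.1 (by simp)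
              · exact hlone _ (h ▸ hb')
              · refine hzF ?_
                rw [← h, opposite_opposite]
                exact (h1 _ _ hb').1
          rcases hconn with hconn | hconn
          · exact ih _ (hlt b c hbc hbc) (isPairing_move hp hO hl hlone hbc)
              (connectedBy_congr (fun u _ v _ _ huv => or_assoc.1 huv) hconn) rfl
          · rw [Set.pair_comm] at hconn
            exact ih _ (hlt c b (h2 _ _ hbc) (by rw [hcdef, opposite_opposite]; exact h2 _ _ hbc))
              (isPairing_move hp hO hl hlone (h2 _ _ hbc))
              (connectedBy_congr (fun u _ v _ _ huv => or_assoc.1 huv) hconn) rfl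
        · refine ⟨r, hp, hc, add _ hzF hyg ?_⟩
          rintro a c (ha | ⟨rfl, ha⟩ | ⟨rfl, ha⟩) (hc | ⟨rfl, hc⟩ | ⟨rfl, hc⟩)
          any_goals exact absurd ⟨_, ha⟩ hst
          any_goals exact absurd ⟨_, hc⟩ hst
          · exact .inl rfl
          · exact .inr rfl
          · exact .inr (opposite_opposite g _).symm
          · exact .inl rfl
      · refine ⟨r, hp, hc, add _ hzF hyg ?_⟩
        have hno : ∀ a, addPair r l (opposite g z) a (opposite g a) → r a (opposite g a) := by
          rintro a (ha | ⟨rfl, ha⟩ | ⟨rfl, ha⟩)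
          · exact ha
          · exact absurd (opposite_injective ha).symm hzl
          · rw [opposite_opposite] at ha; exact absurd ha hzl
        exact fun a c ha hc => hone a c (hno a ha) (hno c hc)

end Repair

/-- The pairings at finitely many hyperedges can be changed so that the osculating condition
holds there and the set of faces stays connected. -/
lemma exists_repair_finset {S : Finset (Cell d)} {c : Cell d → Cell d → Cell d → Prop}
    (hp : ∀ g, IsPairing (facesAt S g) (c g)) (hc : ConnectedBy S fun a b => ∃ g, c g a b)
    (G : Finset (Cell d)) :
    ∃ c' : Cell d → Cell d → Cell d → Prop, (∀ g ∉ G, c' g = c g) ∧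
      (∀ g, IsPairing (facesAt S g) (c' g)) ∧ (ConnectedBy S fun a b => ∃ g, c' g a b) ∧
      ∀ g ∈ G, Osculating g (facesAt S g) (c' g) := by
  classical
  induction G using Finset.induction_on with
  | empty => exact ⟨c, fun _ _ => rfl, hp, hc, by simp⟩
  | insert g G hg ih =>
    obtain ⟨c₁, h1, h2, h3, h4⟩ := ih
    obtain ⟨r, hr1, hr2, hr3⟩ := exists_repair (S := S) (F := facesAt S g) (g := g) (r := c₁ g)
      (h := fun a b => ∃ g' ≠ g, c₁ g' a b)
      (fun a b ⟨g', hg', hab⟩ => ⟨g', hg', (h2 g').2.1 _ _ hab⟩) rfl (h2 g)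
      (connectedBy_congr (fun a _ b _ _ ⟨g', hab⟩ => by
        by_cases e : g' = g
        · subst e; exact .inr hab
        · exact .inl ⟨g', e, hab⟩) h3)
    refine ⟨Function.update c₁ g r, fun g' hg' => ?_, fun g' => ?_, ?_, fun g' hg' => ?_⟩
    · rw [Finset.mem_insert, not_or] at hg'
      rw [Function.update_of_ne hg'.1, h1 g' hg'.2]
    · by_cases e : g' = g
      · subst e; rwa [Function.update_self]
      · rw [Function.update_of_ne e]; exact h2 g'
    · refine connectedBy_congr (fun a _ b _ _ hab => ?_) hr2
      rcases hab with ⟨g', hg', hab⟩ | hab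
      · exact ⟨g', by rwa [Function.update_of_ne hg']⟩
      · exact ⟨g, by rwa [Function.update_self]⟩
    · by_cases e : g' = g
      · subst e; rwa [Function.update_self]
      · rw [Function.update_of_ne e]
        exact h4 g' ((Finset.mem_insert.1 hg').resolve_left e)


/-! ### Replacing a rightmost face by a tube -/

/-- The cells `f ± e_j` with `j` a half-integer dimension of `f`. -/
def bd (f : Cell d) : Finset (Cell d) :=
  (halfInt f ×ˢ (Finset.univ : Finset Bool)).image fun v => f + unit v

lemma mem_bd {f g : Cell d} : g ∈ bd f ↔ ∃ v, v.1 ∈ halfInt f ∧ g = f + unit v := by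
  simp only [bd, Finset.mem_image, Finset.mem_product, Finset.mem_univ, and_true, eq_comm]

lemma mem_bd_iff_neighbours {f g : Cell d} : g ∈ bd f ↔ Neighbours f g := by
  rw [mem_bd, neighbours_iff]

lemma card_bd (f : Cell d) : (bd f).card = 2 * (halfInt f).card := by
  rw [bd, Finset.card_image_of_injective _ fun v w h => unit_injective (add_left_cancel h),
    Finset.card_product]
  simp [mul_comm]

/-- The faces `f ± e_j + e_x`, which join `f` to its translate in the direction `x`. -/
def sides (x : Fin d) (f : Cell d) : Finset (Cell d) := (bd f).image fun g => g + unit (x, true)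

lemma mem_sides {x : Fin d} {f c : Cell d} :
    c ∈ sides x f ↔ ∃ v, v.1 ∈ halfInt f ∧ c = f + unit v + unit (x, true) := by
  simp only [sides, Finset.mem_image, mem_bd]
  constructor
  · rintro ⟨g, ⟨v, hv, rfl⟩, rfl⟩; exact ⟨v, hv, rfl⟩
  · rintro ⟨v, hv, rfl⟩; exact ⟨_, ⟨v, hv, rfl⟩, rfl⟩

lemma card_sides (x : Fin d) (f : Cell d) : (sides x f).card = 2 * (halfInt f).card := by
  rw [sides, Finset.card_image_of_injective _ (add_left_injective _), card_bd]

lemma mem_halfInt_shift {t : Fin d → ℤ} {c : Cell d} {i : Fin d} :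
    i ∈ halfInt (shift t c) ↔ i ∈ halfInt c := by
  rw [mem_halfInt, mem_halfInt, shift]
  constructor <;> intro h <;> grind

lemma halfInt_shift (t : Fin d → ℤ) (c : Cell d) : halfInt (shift t c) = halfInt c := by
  ext i; exact mem_halfInt_shift

lemma shift_add_right (t : Fin d → ℤ) (a b : Cell d) : shift t (a + b) = shift t a + b := by
  ext i; simp only [shift, Pi.add_apply]; ring

lemma sides_shift (x : Fin d) (t : Fin d → ℤ) (f : Cell d) :
    sides x (shift t f) = (sides x f).image (shift t) := by
  ext c
  simp only [Finset.mem_image, mem_sides, halfInt_shift]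
  constructor
  · rintro ⟨v, hv, rfl⟩; exact ⟨_, ⟨v, hv, rfl⟩, by rw [shift_add_right, shift_add_right]⟩
  · rintro ⟨_, ⟨v, hv, rfl⟩, rfl⟩; exact ⟨v, hv, by rw [shift_add_right, shift_add_right]⟩

/-- The sides at `f ± e_j` differ by twice a unit vector. Two sides over `f'` differ so only if they
are opposite in the direction `j`, and then their midpoints agree. Hence a tube determines the face
it replaced. -/
lemma sides_injective {x : Fin d} {f f' : Cell d} (hf : (halfInt f).Nonempty)
    (h : sides x f ⊆ sides x f') : f = f' := by
  obtain ⟨j, hj⟩ := hf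
  obtain ⟨v, -, hv⟩ := mem_sides.1 (h (mem_sides.2 ⟨(j, true), hj, rfl⟩))
  obtain ⟨w, -, hw⟩ := mem_sides.1 (h (mem_sides.2 ⟨(j, false), hj, rfl⟩))
  rw [add_left_inj] at hv hw
  have h1 : unit v j - unit w j = 2 := by
    have e1 := congrFun hv j
    have e2 := congrFun hw j
    simp only [Pi.add_apply] at e1 e2
    have e3 : unit (j, true) j = (1 : ℤ) := by simp [unit_apply]
    have e4 : unit (j, false) j = (-1 : ℤ) := by simp [unit_apply]
    rw [e3] at e1
    rw [e4] at e2
    linarith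
  have hv' : v = (j, true) := by
    rw [unit_apply, unit_apply] at h1
    obtain ⟨a, b⟩ := v
    obtain ⟨a', b'⟩ := w
    cases b <;> cases b' <;> split_ifs at h1 <;> simp_all
  rw [hv', add_left_inj] at hv
  exact hv

lemma eq_or_eq_of_unit_add_unit {v w v' w' : Fin d × Bool} (hvw : v.1 ≠ w.1)
    (h : (unit v + unit w : Cell d) = unit v' + unit w') : v' = v ∨ v' = w := by
  have h1 := congrFun h v.1
  have h2 := congrFun h w.1
  have h3 := congrFun h v'.1
  simp only [Pi.add_apply, unit_apply] at h1 h2 h3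
  obtain ⟨a, b⟩ := v
  obtain ⟨a', b'⟩ := w
  obtain ⟨a'', b''⟩ := v'
  obtain ⟨a''', b'''⟩ := w'
  simp only [Prod.mk.injEq] at *
  cases b <;> cases b' <;> cases b'' <;> cases b''' <;> simp at h1 h2 h3 ⊢ <;> grind

section Tube

variable {x : Fin d} {s : Cell d}

lemma unit_apply_of_notMem (hx : x ∉ halfInt s) {v : Fin d × Bool} (hv : v.1 ∈ halfInt s) :
    unit v x = 0 := unit_apply_of_ne (by rintro rfl; exact hx hv)

lemma side_apply (hx : x ∉ halfInt s) {c : Cell d} (hc : c ∈ sides x s) : c x = s x + 1 := by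
  obtain ⟨v, hv, rfl⟩ := mem_sides.1 hc
  rw [add_unit_true_apply, Pi.add_apply, unit_apply_of_notMem hx hv, add_zero]

lemma notMem_halfInt_add_unit (hx : x ∉ halfInt s) {v : Fin d × Bool} (hv : v.1 ∈ halfInt s) :
    x ∉ halfInt (s + unit v) := by rw [halfInt_add_unit hv]; simp [hx]

lemma halfInt_side (hx : x ∉ halfInt s) {v : Fin d × Bool} (hv : v.1 ∈ halfInt s) :
    halfInt (s + unit v + unit (x, true)) = insert x ((halfInt s).erase v.1) := by
  rw [halfInt_add_unit_insert (v := (x, true)) (notMem_halfInt_add_unit hx hv),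
    halfInt_add_unit hv]

/-- A side only meets the hyperedges of `s` in the hyperplane of `s`. -/
lemma neighbours_side_of_le (hx : x ∉ halfInt s) {c g : Cell d} (hc : c ∈ sides x s)
    (hn : Neighbours c g) (hg : g x ≤ s x) : Neighbours s g ∧ c = g + unit (x, true) := by
  have hcx := side_apply hx hc
  obtain ⟨v, hv, rfl⟩ := mem_sides.1 hc
  obtain ⟨w, hw, rfl⟩ := neighbours_iff.1 hn
  have hwx : w = (x, false) := by
    rw [Pi.add_apply, hcx, unit_apply] at hg
    obtain ⟨i, b⟩ := w
    cases b <;> simp at hg ⊢ <;> split_ifs at hg <;> omega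
  subst hwx
  have e : s + unit v + unit (x, true) + unit (x, false) = s + unit v := by
    rw [unit_true, unit_false]; abel
  rw [e]
  exact ⟨neighbours_add_unit hv, rfl⟩

lemma neighbours_side (hx : x ∉ halfInt s) {g : Cell d} (hg : Neighbours s g) :
    g + unit (x, true) ∈ sides x s ∧ Neighbours (g + unit (x, true)) g ∧ g x = s x := by
  obtain ⟨v, hv, rfl⟩ := neighbours_iff.1 hg
  exact ⟨mem_sides.2 ⟨v, hv, rfl⟩,
    neighbours_of_add_unit (v := (x, true)) (notMem_halfInt_add_unit hx hv),
    by rw [Pi.add_apply, unit_apply_of_notMem hx hv, add_zero]⟩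

/-- Relative to the centre of the cube over `s`, such a hyperedge is a sum of two unit vectors in
different directions. The sum determines its summands, and any side at the hyperedge is given by one
of them. -/
lemma card_facesAt_sides_le (hx : x ∉ halfInt s) {g : Cell d} (hg : s x < g x) :
    (facesAt (sides x s) g).card ≤ 2 := by
  rcases (facesAt (sides x s) g).eq_empty_or_nonempty with h | ⟨c, hc⟩
  · simp [h]
  obtain ⟨hc, hn⟩ := mem_facesAt.1 hc
  have hcx := side_apply hx hc
  obtain ⟨v, hv, rfl⟩ := mem_sides.1 hc
  obtain ⟨w, hw, rfl⟩ := neighbours_iff.1 hn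
  rw [halfInt_side hx hv, Finset.mem_insert, Finset.mem_erase] at hw
  refine (Finset.card_le_card (t := {s + unit v + unit (x, true),
    s + unit w + unit (x, true)}) fun c' hc' => ?_).trans (Finset.card_le_two)
  obtain ⟨hc', hn'⟩ := mem_facesAt.1 hc'
  have hcx' := side_apply hx hc'
  obtain ⟨v', hv', rfl⟩ := mem_sides.1 hc'
  obtain ⟨w', hw', e⟩ := neighbours_iff.1 hn'
  rw [Finset.mem_insert, Finset.mem_singleton]
  have e' : (unit v + unit w : Cell d) = unit v' + unit w' := by
    have : s + unit (x, true) + (unit v + unit w) = s + unit (x, true) + (unit v' + unit w') := by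
      calc _ = s + unit v + unit (x, true) + unit w := by abel
        _ = _ := by rw [e]; abel
    exact add_left_cancel this
  have hvw : v.1 ≠ w.1 := by
    rcases hw with hw | hw
    · rw [hw]; rintro h; exact hx (h ▸ hv)
    · exact hw.1.symm
  rcases eq_or_eq_of_unit_add_unit hvw e' with rfl | rfl
  · exact .inl rfl
  · exact .inr rfl

/-- The faces of `S` with `s` replaced by the sides over it. -/
def tubeFaces (x : Fin d) (S : Finset (Cell d)) (s : Cell d) : Finset (Cell d) :=
  S.erase s ∪ sides x s

open Classical in
/-- The connections after `s` has been replaced by the sides over it. -/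
noncomputable def tubeConn (x : Fin d) (M : LinkedFaces d) (s : Cell d) :
    Cell d → Cell d → Cell d → Prop := fun g a b =>
  if g x ≤ s x then
    -- At a hyperedge of `s` the side standing on it takes the place of `s` in the pairing; above
    -- the hyperplane at most two sides meet, and they are connected.
    if Neighbours s g then
      M.conn g (Equiv.swap s (g + unit (x, true)) a) (Equiv.swap s (g + unit (x, true)) b)
    else M.conn g a b
  else a ∈ facesAt (sides x s) g ∧ b ∈ facesAt (sides x s) g ∧ a ≠ b

/-- `s` is a rightmost face of `S` that is perpendicular to the direction `x`. -/
structure Cap (x : Fin d) (S : Finset (Cell d)) (s : Cell d) : Prop where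
  mem : s ∈ S
  half : x ∉ halfInt s
  le : ∀ a ∈ S, a x ≤ s x

variable {S : Finset (Cell d)}

namespace Cap

lemma notMem_sides (h : Cap x S s) {a : Cell d} (ha : a ∈ S) : a ∉ sides x s := fun hs => by
  have := side_apply h.half hs
  have := h.le a ha
  omega

lemma facesAt_eq_empty (h : Cap x S s) {g : Cell d} (hg : s x < g x) : facesAt S g = ∅ :=
  facesAt_eq_empty_of_lt (by simpa [mem_halfInt] using h.half) h.le hg

lemma facesAt_tube_of_lt (h : Cap x S s) {g : Cell d} (hg : s x < g x) :
    facesAt (tubeFaces x S s) g = facesAt (sides x s) g := by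
  rw [tubeFaces, facesAt_union]
  have : facesAt (S.erase s) g = ∅ := by
    rw [Finset.eq_empty_iff_forall_notMem]
    intro a ha
    have ha' := mem_facesAt.1 ha
    have : a ∈ facesAt S g := mem_facesAt.2 ⟨Finset.mem_of_mem_erase ha'.1, ha'.2⟩
    rw [h.facesAt_eq_empty hg] at this
    simp at this
  rw [this, Finset.empty_union]

lemma facesAt_tube_of_not (h : Cap x S s) {g : Cell d} (hg : g x ≤ s x) (hn : ¬ Neighbours s g) :
    facesAt (tubeFaces x S s) g = facesAt S g := by
  ext a
  rw [mem_facesAt, mem_facesAt, tubeFaces, Finset.mem_union, Finset.mem_erase]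
  constructor
  · rintro ⟨ha | ha, hag⟩
    · exact ⟨ha.2, hag⟩
    · exact absurd (neighbours_side_of_le h.half ha hag hg).1 hn
  · rintro ⟨ha, hag⟩
    exact ⟨.inl ⟨by rintro rfl; exact hn hag, ha⟩, hag⟩

lemma facesAt_tube_of_neighbours (h : Cap x S s) {g : Cell d} (hn : Neighbours s g) :
    facesAt (tubeFaces x S s) g =
      (facesAt S g).image (Equiv.swap s (g + unit (x, true))) := by
  obtain ⟨h1, h2, h3⟩ := neighbours_side h.half hn
  have h4 : g + unit (x, true) ∉ S := fun hS => h.notMem_sides hS h1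
  ext a
  have hm : a ∈ (facesAt S g).image (Equiv.swap s (g + unit (x, true))) ↔
      Equiv.swap s (g + unit (x, true)) a ∈ facesAt S g := by
    rw [Finset.mem_image]
    constructor
    · rintro ⟨c, hc, rfl⟩; simpa using hc
    · intro h; exact ⟨_, h, by simp⟩
  rw [hm, mem_facesAt, mem_facesAt, tubeFaces, Finset.mem_union, Finset.mem_erase]
  by_cases e1 : a = s
  · subst e1
    rw [Equiv.swap_apply_left]
    refine iff_of_false ?_ fun h => h4 h.1
    rintro ⟨h | h', -⟩
    · exact h.1 rfl
    · exact h.notMem_sides h.mem h'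
  by_cases e2 : a = g + unit (x, true)
  · subst e2
    rw [Equiv.swap_apply_right]
    exact iff_of_true ⟨.inr h1, h2⟩ ⟨h.mem, hn⟩
  rw [Equiv.swap_apply_of_ne_of_ne e1 e2]
  refine and_congr_left fun hag => ⟨?_, fun h => .inl ⟨e1, h⟩⟩
  rintro (ha | ha)
  · exact ha.2
  · exact absurd (neighbours_side_of_le h.half ha hag h3.le).2 e2

lemma disjoint (h : Cap x S s) : Disjoint (S.erase s) (sides x s) :=
  Finset.disjoint_left.2 fun _ ha => h.notMem_sides (Finset.mem_of_mem_erase ha)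

lemma card_tube (h : Cap x S s) (hs : IsCube k s) :
    (tubeFaces x S s).card + 1 = S.card + 2 * k := by
  rw [tubeFaces, Finset.card_union_of_disjoint h.disjoint, card_sides, hs,
    ← Finset.card_erase_add_one h.mem]
  omega

lemma isLower (h : Cap x S s) : IsLower x (S.erase s) (tubeFaces x S s) := by
  refine ⟨Finset.subset_union_left, s x, fun c hc => ?_⟩
  rcases Finset.mem_union.1 hc with hc | hc
  · exact iff_of_true hc (h.le c (Finset.mem_of_mem_erase hc))
  · refine iff_of_false (fun h' => Finset.disjoint_left.1 h.disjoint h' hc) ?_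
    rw [side_apply h.half hc]
    omega

end Cap

lemma isPairing_tubeConn {M : LinkedFaces d} (h : Cap x M.faces s)
    (hM : ∀ g, IsPairing (facesAt M.faces g) (M.conn g)) (g : Cell d) :
    IsPairing (facesAt (tubeFaces x M.faces s) g) (tubeConn x M s g) := by
  by_cases hg : g x ≤ s x
  · by_cases hn : Neighbours s g
    · rw [h.facesAt_tube_of_neighbours hn]
      convert (hM g).image (Equiv.swap s (g + unit (x, true))) using 1
      ext a b
      simp [tubeConn, hg, hn]
    · rw [h.facesAt_tube_of_not hg hn]
      convert hM g using 1
      ext a b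
      simp [tubeConn, hg, hn]
  · rw [h.facesAt_tube_of_lt (not_le.1 hg)]
    rw [isPairing_iff_of_card_le_two (card_facesAt_sides_le h.half (not_le.1 hg))]
    intro a b
    simp [tubeConn, hg]

lemma tubeConn_sides (hx : x ∉ halfInt s) (M : LinkedFaces d) {v w : Fin d × Bool}
    (hv : v.1 ∈ halfInt s) (hw : w.1 ∈ halfInt s) (hvw : v.1 ≠ w.1) :
    tubeConn x M s (s + unit v + unit (x, true) + unit w) (s + unit v + unit (x, true))
      (s + unit w + unit (x, true)) := by
  have hxv := unit_apply_of_notMem hx hv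
  have hxw := unit_apply_of_notMem hx hw
  have hg : ¬ (s + unit v + unit (x, true) + unit w) x ≤ s x := by
    rw [Pi.add_apply, add_unit_true_apply, Pi.add_apply, hxv, hxw]
    omega
  rw [tubeConn, if_neg hg]
  refine ⟨mem_facesAt.2 ⟨mem_sides.2 ⟨v, hv, rfl⟩, neighbours_add_unit ?_⟩,
    mem_facesAt.2 ⟨mem_sides.2 ⟨w, hw, rfl⟩, ?_⟩, fun e => ?_⟩
  · rw [halfInt_side hx hv]; simp [hw, hvw.symm]
  · have e : s + unit v + unit (x, true) + unit w = s + unit w + unit (x, true) + unit v := by abel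
    rw [e]
    exact neighbours_add_unit (by rw [halfInt_side hx hw]; simp [hv, hvw])
  · rw [add_left_inj, add_right_inj] at e
    exact hvw (by rw [unit_injective e])

/-- For `2 ≤ k`, sides in different directions are adjacent, and opposite sides are joined through a
third one. So all sides are connected and serve together as `s` did. -/
lemma connectedBy_tubeConn {M : LinkedFaces d} (h : Cap x M.faces s) (hs : IsCube k s)
    (hk : 2 ≤ k) (hM : ∀ g, IsPairing (facesAt M.faces g) (M.conn g))
    (hc : ConnectedBy M.faces fun a b => ∃ g, M.conn g a b) :
    ConnectedBy (tubeFaces x M.faces s) fun a b => ∃ g, tubeConn x M s g a b := by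
  have hcard : 1 < (halfInt s).card := by rw [hs]; omega
  obtain ⟨i, hi, j, hj, hij⟩ := Finset.one_lt_card.1 hcard
  have hi' : s + unit (i, true) + unit (x, true) ∈ sides x s := mem_sides.2 ⟨(i, true), hi, rfl⟩
  rw [connectedBy_iff_coloring fun a b ⟨g, hg⟩ => ⟨g, (isPairing_tubeConn h hM g).2.1 _ _ hg⟩]
  refine ⟨⟨_, Finset.mem_union_right _ hi'⟩, fun p hp => ?_⟩
  have hadj : ∀ v w : Fin d × Bool, v.1 ∈ halfInt s → w.1 ∈ halfInt s → v.1 ≠ w.1 →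
      (p (s + unit v + unit (x, true)) ↔ p (s + unit w + unit (x, true))) := fun v w hv hw hvw =>
    hp _ (Finset.mem_union_right _ (mem_sides.2 ⟨v, hv, rfl⟩)) _
      (Finset.mem_union_right _ (mem_sides.2 ⟨w, hw, rfl⟩)) ⟨_, tubeConn_sides h.half M hv hw hvw⟩
  have hside : ∀ c ∈ sides x s, p c ↔ p (s + unit (i, true) + unit (x, true)) := by
    intro c hc
    obtain ⟨v, hv, rfl⟩ := mem_sides.1 hc
    by_cases hvi : v.1 = i
    · exact (hadj v (j, true) hv hj (hvi.trans_ne hij)).trans (hadj (j, true) (i, true) hj hi hij.symm)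
    · exact hadj v (i, true) hv hi hvi
  -- A colouring of the tube structure becomes one of `M` when `s` receives the common colour of the
  -- sides.
  have hconn := ((connectedBy_iff_coloring fun a b ⟨g, hg⟩ => ⟨g, (hM g).2.1 _ _ hg⟩).1 hc).2
    (fun c => (c = s ∧ p (s + unit (i, true) + unit (x, true))) ∨ (c ≠ s ∧ p c)) (by
    have hnew : ∀ g b, M.conn g s b → (p b ↔ p (s + unit (i, true) + unit (x, true))) := by
      intro g b hg
      obtain ⟨hsg, hbg, hsb⟩ := (hM g).1 _ _ hg
      have hn := (mem_facesAt.1 hsg).2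
      obtain ⟨h1, h2, h3⟩ := neighbours_side h.half hn
      have hbS := (mem_facesAt.1 hbg).1
      rw [← hside _ h1]
      refine hp _ (Finset.mem_union_left _ (Finset.mem_erase.2 ⟨hsb.symm, hbS⟩)) _
        (Finset.mem_union_right _ h1) ⟨g, ?_⟩
      have hbne : b ≠ g + unit (x, true) := by rintro rfl; exact h.notMem_sides hbS h1
      rw [tubeConn, if_pos h3.le, if_pos hn, Equiv.swap_apply_right,
        Equiv.swap_apply_of_ne_of_ne hsb.symm hbne]
      exact (hM g).2.1 _ _ hg
    rintro a ha b hb ⟨g, hg⟩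
    have hba := (hM g).2.1 _ _ hg
    by_cases has : a = s
    · subst has
      have hba' : b ≠ a := fun e => ((hM g).1 _ _ hg).2.2 e.symm
      simp [hnew g b hg, hba']
    by_cases hbs : b = s
    · subst hbs
      simp [hnew g a hba, has]
    simp only [has, hbs, false_and, not_false_eq_true, true_and, false_or, ne_eq]
    refine hp _ (Finset.mem_union_left _ (Finset.mem_erase.2 ⟨has, ha⟩)) _
      (Finset.mem_union_left _ (Finset.mem_erase.2 ⟨hbs, hb⟩)) ⟨g, ?_⟩
    obtain ⟨hag, hbg, -⟩ := (hM g).1 _ _ hg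
    have hgx : g x ≤ s x := by
      by_contra hgx
      rw [h.facesAt_eq_empty (not_le.1 hgx)] at hag
      simp at hag
    rw [tubeConn, if_pos hgx]
    split_ifs with hn
    · have h1 := (neighbours_side h.half hn).1
      rw [Equiv.swap_apply_of_ne_of_ne has (by rintro rfl; exact h.notMem_sides ha h1),
        Equiv.swap_apply_of_ne_of_ne hbs (by rintro rfl; exact h.notMem_sides hb h1)]
      exact hg
    · exact hg)
  have hall : ∀ c ∈ tubeFaces x M.faces s, p c ↔ p (s + unit (i, true) + unit (x, true)) := by
    intro c hc
    rcases Finset.mem_union.1 hc with hc | hc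
    · obtain ⟨hcs, hcM⟩ := Finset.mem_erase.1 hc
      simpa [hcs] using hconn c hcM s h.mem
    · exact hside c hc
  exact fun a ha b hb => (hall a ha).trans (hall b hb).symm

/-- `U` is obtained from `M` by replacing the rightmost face `s` by a tube and changing the
pairings at the hyperedges of `s`. -/
structure IsTube (x : Fin d) (M : LinkedFaces d) (s : Cell d) (U : LinkedFaces d) : Prop where
  cap : Cap x M.faces s
  faces : U.faces = tubeFaces x M.faces s
  conn : ∀ g, ¬ Neighbours s g → U.conn g = tubeConn x M s g

/-- Only at the hyperedges of `s` do old faces meet a face pointing in a new direction, so pairings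
are repaired just there. The numbers of faces at these hyperedges are unchanged, which preserves the
bound for SAMs. The sides are rightmost and contain the direction `x`, so the result is extendable.
-/
lemma exists_isTube {sam : Prop} {M : LinkedFaces d} (h : Cap x M.faces s) (hk : 2 ≤ k)
    (hM : InClass k (locSOM sam) M) :
    ∃ U, IsTube x M s U ∧ InClass k (locSOM sam) U ∧ ∃ f ∈ U.faces, x ∈ halfInt f ∧
      ∀ a ∈ U.faces, a x ≤ f x := by
  have hs := hM.cube s h.mem
  have hp : ∀ g, IsPairing (facesAt M.faces g) (M.conn g) := fun g => (hM.loc g).1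
  obtain ⟨c, h1, h2, h3, h4⟩ := exists_repair_finset (isPairing_tubeConn h hp)
    (connectedBy_tubeConn h hs hk hp hM.conn) (bd s)
  have hcard : ∀ g, Neighbours s g → (facesAt (tubeFaces x M.faces s) g).card =
      (facesAt M.faces g).card := fun g hn => by
    rw [h.facesAt_tube_of_neighbours hn, Finset.card_image_of_injective _ (Equiv.injective _)]
  refine ⟨⟨tubeFaces x M.faces s, c⟩, ⟨h, rfl, fun g hg => h1 g (by rwa [mem_bd_iff_neighbours])⟩,
    ⟨?_, fun g a b hab => (h2 g).1 a b hab, fun g => ⟨h2 g, ?_⟩, h3⟩, ?_⟩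
  · intro f hf
    rcases Finset.mem_union.1 hf with hf | hf
    · exact hM.cube f (Finset.mem_of_mem_erase hf)
    · obtain ⟨v, hv, rfl⟩ := mem_sides.1 hf
      exact isCube_of_neighbours (neighbours_add_unit hv) (neighbours_of_add_unit (v := (x, true))
        (notMem_halfInt_add_unit h.half hv)) hs
  · dsimp only
    by_cases hn : Neighbours s g
    · exact ⟨fun _ => h4 g (mem_bd_iff_neighbours.2 hn),
        fun hsam => (hcard g hn).le.trans ((hM.loc g).2.2 hsam)⟩
    · rw [h1 g (by rwa [mem_bd_iff_neighbours])]
      by_cases hg : g x ≤ s x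
      · have e : tubeConn x M s g = M.conn g := by ext a b; simp [tubeConn, hg, hn]
        rw [h.facesAt_tube_of_not hg hn, e]
        exact (hM.loc g).2
      · rw [h.facesAt_tube_of_lt (not_le.1 hg)]
        have := card_facesAt_sides_le h.half (not_le.1 hg)
        exact ⟨fun h => absurd this (not_le.2 h), fun _ => this⟩
  · obtain ⟨j, hj⟩ : (halfInt s).Nonempty := by rw [← Finset.card_pos, hs]; omega
    have hm : s + unit (j, true) + unit (x, true) ∈ sides x s := mem_sides.2 ⟨(j, true), hj, rfl⟩
    refine ⟨_, Finset.mem_union_right _ hm, ?_, fun a ha => ?_⟩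
    · rw [halfInt_side (v := (j, true)) h.half hj]; simp
    · rw [side_apply h.half hm]
      rcases Finset.mem_union.1 ha with ha | ha
      · exact (h.le a (Finset.mem_of_mem_erase ha)).trans (by omega)
      · exact (side_apply h.half ha).le

end Tube


lemma image_shift_mem_iff {S : Finset (Cell d)} {t : Fin d → ℤ} {c : Cell d} :
    shift t c ∈ S.image (shift t) ↔ c ∈ S := by
  rw [Finset.mem_image]
  exact ⟨fun ⟨a, ha, e⟩ => shift_injective t e ▸ ha, fun h => ⟨c, h, rfl⟩⟩

lemma Cap.nonempty_halfInt {x : Fin d} {S : Finset (Cell d)} {s : Cell d} (h : Cap x S s)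
    (hS : ∀ f ∈ S, IsCube k f) (hk : 1 ≤ k) : (halfInt s).Nonempty := by
  rw [← Finset.card_pos, hS s h.mem]; exact hk

/-- Away from `s`, the original connections can be read off from the tube. -/
lemma IsTube.conn_iff {x : Fin d} {M U : LinkedFaces d} {s : Cell d} (h : IsTube x M s U)
    (hM : M.Supported) {g : Cell d} (hg : ¬ Neighbours s g) (a b : Cell d) :
    M.conn g a b ↔ U.conn g a b ∧ a ∈ M.faces ∧ b ∈ M.faces := by
  rw [h.conn g hg, tubeConn, if_neg hg]
  split_ifs with hx
  · refine ⟨fun hab => ⟨hab, ?_⟩, fun hab => hab.1⟩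
    obtain ⟨h1, h2, -⟩ := hM _ _ _ hab
    exact ⟨(mem_facesAt.1 h1).1, (mem_facesAt.1 h2).1⟩
  · refine iff_of_false (fun hab => ?_) fun hab => ?_
    · have := (hM _ _ _ hab).1
      rw [h.cap.facesAt_eq_empty (not_le.1 hx)] at this
      simp at this
    · exact h.cap.notMem_sides hab.2.1 (mem_facesAt.1 hab.1.1).1

/-- The faces other than `s` form a lower part of known size, and the remaining sides determine `s`.
Only the pairings at the hyperedges of `s` were lost in the repair; `hcode` supplies them. -/
lemma IsTube.equiv {x : Fin d} {M₁ M₂ U₁ U₂ : LinkedFaces d} {s₁ s₂ : Cell d}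
    (h₁ : IsTube x M₁ s₁ U₁) (h₂ : IsTube x M₂ s₂ U₂) (hM₁ : M₁.Supported) (hM₂ : M₂.Supported)
    (hs : (halfInt s₂).Nonempty) (hc : M₁.faces.card = M₂.faces.card)
    (hcode : ∀ v a b : Fin d × Bool,
      M₁.conn (s₁ + unit v) (s₁ + unit v + unit a) (s₁ + unit v + unit b) ↔
      M₂.conn (s₂ + unit v) (s₂ + unit v + unit a) (s₂ + unit v + unit b))
    (h : linkedSetoid d U₁ U₂) : linkedSetoid d M₁ M₂ := by
  obtain ⟨t, hU, hconn⟩ := h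
  have hl₁ := h₁.cap.isLower
  have hl₂ := h₂.cap.isLower
  rw [← h₁.faces] at hl₁
  rw [← h₂.faces] at hl₂
  have herase := hl₁.image_shift hl₂ hU (by
    rw [Finset.card_erase_of_mem h₁.cap.mem, Finset.card_erase_of_mem h₂.cap.mem, hc])
  have hsd : ∀ {M U : LinkedFaces d} {s}, IsTube x M s U →
      sides x s = U.faces \ M.faces.erase s := fun h => by
    rw [h.faces, tubeFaces, Finset.union_sdiff_left, sdiff_eq_left.2 h.cap.disjoint.symm]
  have hsides : sides x s₂ = sides x (shift t s₁) := by
    rw [sides_shift, hsd h₂, hsd h₁, Finset.image_sdiff _ _ (shift_injective t), ← herase, hU]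
  obtain rfl : s₂ = shift t s₁ := sides_injective hs hsides.subset
  have hfaces : M₂.faces = M₁.faces.image (shift t) := by
    rw [← Finset.insert_erase h₁.cap.mem, ← Finset.insert_erase h₂.cap.mem, herase,
      Finset.image_insert]
  refine ⟨t, hfaces, fun g a b => ?_⟩
  by_cases hg : Neighbours s₁ g
  · obtain ⟨v, hv, rfl⟩ := neighbours_iff.1 hg
    have key : ∀ a b, M₁.conn (s₁ + unit v) a b ∨
        M₂.conn (shift t (s₁ + unit v)) (shift t a) (shift t b) →
        ∃ u w, a = s₁ + unit v + unit u ∧ b = s₁ + unit v + unit w := by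
      intro a b hab
      have : Neighbours a (s₁ + unit v) ∧ Neighbours b (s₁ + unit v) := by
        rcases hab with hab | hab
        · obtain ⟨ha, hb, -⟩ := hM₁ _ _ _ hab
          exact ⟨(mem_facesAt.1 ha).2, (mem_facesAt.1 hb).2⟩
        · obtain ⟨ha, hb, -⟩ := hM₂ _ _ _ hab
          exact ⟨neighbours_shift.1 (mem_facesAt.1 ha).2, neighbours_shift.1 (mem_facesAt.1 hb).2⟩
      obtain ⟨u, -, hu⟩ := neighbours_iff'.1 this.1
      obtain ⟨w, -, hw⟩ := neighbours_iff'.1 this.2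
      exact ⟨u, w, hu, hw⟩
    constructor
    · intro hab
      obtain ⟨u, w, rfl, rfl⟩ := key a b (.inr hab)
      rw [hcode]
      simpa only [shift_add_right] using hab
    · intro hab
      obtain ⟨u, w, rfl, rfl⟩ := key a b (.inl hab)
      rw [hcode] at hab
      simpa only [shift_add_right] using hab
  · rw [h₁.conn_iff hM₁ hg, h₂.conn_iff hM₂ (by rwa [neighbours_shift]), hconn, hfaces,
      image_shift_mem_iff, image_shift_mem_iff]

lemma exists_classCount_cap_le (x : Fin d) (sam : Prop) (hk : 2 ≤ k) : ∃ K, ∀ n,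
    classCount (fun M => InClass k (locSOM sam) M ∧ ∃ s, Cap x M.faces s) (n + 1) ≤
      K * classCount (fun M => InClass k (locSOM sam) M ∧ ∃ g, Extendable k x (locSOM sam) M g)
          (n + 2 * k) := by
  classical
  refine ⟨Fintype.card (Fin d × Bool → Fin d × Bool → Fin d × Bool → Prop), fun n => ?_⟩
  refine ncard_classes_le (sα := linkedSetoid d) (sγ := linkedSetoid d)
    (finite_classes_inClass
      (P := fun M => InClass k (locSOM sam) M ∧ ∃ g, Extendable k x (locSOM sam) M g)
      (fun M h => h.1) (n + 2 * k))
    (fun M U code => ∃ s, IsTube x M s U ∧ ∀ v a b, code v a b ↔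
      M.conn (s + unit v) (s + unit v + unit a) (s + unit v + unit b)) ?_ ?_
  · rintro M ⟨⟨hM, s, hs⟩, hn⟩
    obtain ⟨U, hU, hUc, f, hf, hxf, hmax⟩ := exists_isTube hs hk hM
    refine ⟨U, ⟨⟨hUc, _, extendable_of_rightmost (basic_locSOM sam) hUc hf hxf hmax⟩, ?_⟩,
      fun v a b => M.conn (s + unit v) (s + unit v + unit a) (s + unit v + unit b), s, hU,
      fun _ _ _ => Iff.rfl⟩
    have := hs.card_tube (hM.cube s hs.mem)
    rw [hU.faces]
    omega
  · rintro M M' U U' code ⟨⟨hM, -⟩, hn⟩ ⟨⟨hM', -⟩, hn'⟩ ⟨s, hs, hc⟩ ⟨s', hs', hc'⟩ h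
    exact hs.equiv hs' hM.supp hM'.supp (hs'.cap.nonempty_halfInt hM'.cube (by omega))
      (hn.trans hn'.symm) (fun v a b => (hc v a b).symm.trans (hc' v a b)) h

lemma classCount_le_add {P P₁ P₂ : LinkedFaces d → Prop} {Loc : LocalCond d}
    (h₁ : ∀ M, P₁ M → InClass k Loc M) (h₂ : ∀ M, P₂ M → InClass k Loc M)
    (h : ∀ M, P M → P₁ M ∨ P₂ M) (n : ℕ) :
    classCount P n ≤ classCount P₁ n + classCount P₂ n := by
  refine le_trans (Set.ncard_le_ncard ?_ ((finite_classes_inClass h₁ n).union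
    (finite_classes_inClass h₂ n))) (Set.ncard_union_le _ _)
  rw [← Set.image_union]
  exact Set.image_mono fun M hM => (h M hM.1).imp (fun h => ⟨h, hM.2⟩) fun h => ⟨h, hM.2⟩

theorem exists_growth_locSOM (sam : Prop) (hk : 2 ≤ k) (hkd : k ≤ d) :
    ∃ μ : ℝ, Tendsto (fun n : ℕ => (classCount (InClass (d := d) k (locSOM sam)) n : ℝ) ^
      ((1 : ℝ) / n)) atTop (𝓝 μ) := by
  set x : Fin d := ⟨0, by omega⟩
  obtain ⟨K, hK⟩ := exists_classCount_cap_le x sam hk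
  have hL : (locSOM sam : LocalCond d).Basic := basic_locSOM sam
  refine exists_growth_of_rightEnd (K := 1 + K) (p := 2 * k) (by omega) hkd x hL
    (invariant_locSOM sam) fun n => ?_
  rcases n with _ | n
  · have h0 : classCount (InClass (d := d) k (locSOM sam)) 0 = 0 := by
      have : {M : LinkedFaces d | InClass k (locSOM sam) M ∧ M.faces.card = 0} = ∅ := by
        ext M
        simp only [Set.mem_ofPred_eq, Set.mem_empty_iff_false, iff_false]
        rintro ⟨hM, h0⟩
        have := Finset.card_pos.2 hM.conn.1
        omega
      rw [classCount, this]; simp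
    rw [h0]
    exact Nat.zero_le _
  -- A rightmost face either contains the direction `x`, so that one face can be added at once, or
  -- it is a cap and is first replaced by a tube.
  have h1 := classCount_le_add (P := InClass k (locSOM sam))
    (P₁ := fun M => InClass k (locSOM sam) M ∧ ∃ g, Extendable k x (locSOM sam) M g)
    (P₂ := fun M => InClass k (locSOM sam) M ∧ ∃ s, Cap x M.faces s) (Loc := locSOM sam)
    (fun M h => h.1) (fun M h => h.1) (fun M hM => by
      obtain ⟨f, hf, hmax⟩ := exists_rightmost x hM.conn.1
      by_cases hx : x ∈ halfInt f
      · exact .inl ⟨hM, _, extendable_of_rightmost hL hM hf hx hmax⟩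
      · exact .inr ⟨hM, f, hf, hx, hmax⟩) (n + 1)
  have h2 := hK n
  have h3 := classCount_extendable_le (k := k) (x := x) hL (n + 1)
  have h4 := classCount_extendable_le (k := k) (x := x) hL (n + 2 * k)
  -- The tube adds `2 * k - 1` faces before the final one. In the direct case as many are added
  -- straight ahead, so that both cases end at `n + 1 + 2 * k`.
  have h5 := classCount_rightEnd_le_add (k := k) (x := x) hL (n + 1 + 1) (2 * k - 1)
  rw [show n + 1 + 1 + (2 * k - 1) = n + 1 + 2 * k by omega] at h5
  rw [show n + 2 * k + 1 = n + 1 + 2 * k by omega] at h4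
  have h6 := Nat.mul_le_mul_left K h4
  rw [add_mul, one_mul]
  omega


/-! ### Cycles modulo two -/

/-- Every hyperedge is neighboured by none or two of the faces. -/
def IsCycle (S : Finset (Cell d)) : Prop :=
  ∀ g, (facesAt S g).card = 0 ∨ (facesAt S g).card = 2

/-- Two faces with a common hyperedge. -/
def Adjacent (a b : Cell d) : Prop := ∃ g, Neighbours a g ∧ Neighbours b g

lemma Adjacent.symm {a b : Cell d} (h : Adjacent a b) : Adjacent b a :=
  let ⟨g, h1, h2⟩ := h; ⟨g, h2, h1⟩

lemma isClosedSAM_iff {S : Finset (Cell d)} :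
    IsClosedSAM k S ↔ (∀ f ∈ S, IsCube k f) ∧ ConnectedBy S Adjacent ∧ IsCycle S := by
  constructor
  · rintro ⟨⟨⟨h1, h2⟩, -⟩, h4⟩
    refine ⟨h1, h2, fun g => ?_⟩
    rcases (facesAt S g).eq_empty_or_nonempty with h | h
    · exact .inl (by simp [h])
    · exact .inr (h4 g h)
  · rintro ⟨h1, h2, h3⟩
    refine ⟨⟨⟨h1, h2⟩, fun g => ?_⟩, fun g hg => ?_⟩
    · rcases h3 g with h | h <;> omega
    · exact (h3 g).resolve_left (Finset.card_pos.2 hg).ne'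

/-- Stokes' theorem modulo two: after exchanging the sums, every hyperedge is counted zero or two
times. -/
lemma IsCycle.sum_bd_eq_zero {S : Finset (Cell d)} (hS : IsCycle S) (w : Cell d → ZMod 2) :
    ∑ f ∈ S, ∑ g ∈ bd f, w g = 0 := by
  rw [Finset.sum_comm' (s' := fun g => facesAt S g) (t' := S.biUnion bd)]
  · refine Finset.sum_eq_zero fun g _ => ?_
    rw [Finset.sum_const]
    rcases hS g with h | h <;> rw [h]
    · simp
    · exact CharTwo.two_nsmul _
  · intro f g
    rw [mem_facesAt, Finset.mem_biUnion, mem_bd_iff_neighbours]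
    exact ⟨fun ⟨h1, h2⟩ => ⟨⟨h1, h2⟩, f, h1, mem_bd_iff_neighbours.2 h2⟩, fun h => h.1⟩

lemma sum_bd (f : Cell d) (w : Cell d → ZMod 2) :
    ∑ g ∈ bd f, w g = ∑ j ∈ halfInt f, (w (f + unit (j, true)) + w (f + unit (j, false))) := by
  rw [bd, Finset.sum_image fun v _ w _ h => unit_injective (add_left_cancel h),
    Finset.sum_product]
  simp

/-- A cochain whose coboundary takes the value one on all faces. -/
noncomputable def potential (g : Cell d) : ZMod 2 :=
  ∑ i ∈ Finset.univ.filter (fun i => ∀ j ∈ halfInt g, i < j), if (4 : ℤ) ∣ g i then 1 else 0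

/-- The hyperedges `f + e_j` and `f - e_j` differ only in the coordinate `j`, where their doubled
entries are consecutive even numbers, exactly one of them divisible by 4. So this pair contributes
one if `j` precedes all other half-integer dimensions of `f`, and zero otherwise; exactly one `j`
does so. -/
lemma sum_bd_potential {f : Cell d} (hf : (halfInt f).Nonempty) :
    ∑ g ∈ bd f, potential g = 1 := by
  rw [sum_bd]
  set m := (halfInt f).min' hf with hm
  have hmf : m ∈ halfInt f := Finset.min'_mem _ _
  have hle : ∀ j ∈ halfInt f, m ≤ j := fun j hj => Finset.min'_le _ _ hj
  have hterm : ∀ j ∈ halfInt f, potential (f + unit (j, true)) + potential (f + unit (j, false)) =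
      ∑ i ∈ Finset.univ.filter (fun i => ∀ j' ∈ (halfInt f).erase j, i < j'),
        if i = j then 1 else 0 := by
    intro j hj
    rw [potential, potential, halfInt_add_unit (v := (j, true)) hj,
      halfInt_add_unit (v := (j, false)) hj, ← Finset.sum_add_distrib]
    refine Finset.sum_congr rfl fun i _ => ?_
    by_cases hij : i = j
    · subst hij
      have ho := mem_halfInt.1 hj
      rw [if_pos rfl, Pi.add_apply, Pi.add_apply, unit_apply, unit_apply]
      simp only [if_true, Bool.false_eq_true, if_false]
      obtain ⟨c, hc⟩ := ho
      rcases Int.even_or_odd c with ⟨e, he⟩ | ⟨e, he⟩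
      · rw [if_neg (by omega), if_pos (by omega), zero_add]
      · rw [if_pos (by omega), if_neg (by omega), add_zero]
    · rw [if_neg hij, Pi.add_apply, Pi.add_apply, unit_apply_of_ne (v := (j, true)) hij,
        unit_apply_of_ne (v := (j, false)) hij]
      exact CharTwo.add_self_eq_zero _
  rw [Finset.sum_congr rfl hterm, Finset.sum_eq_single_of_mem m hmf]
  · rw [Finset.sum_ite_eq', if_pos]
    simp only [Finset.mem_filter, Finset.mem_univ, true_and, Finset.mem_erase]
    exact fun j hj => lt_of_le_of_ne (hle j hj.2) hj.1.symm
  · intro j hj hjm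
    rw [Finset.sum_ite_eq', if_neg]
    simp only [Finset.mem_filter, Finset.mem_univ, true_and, not_forall]
    exact ⟨m, Finset.mem_erase.2 ⟨hjm.symm, hmf⟩, not_lt.2 (hle j hj)⟩

lemma IsClosedSAM.even_card {S : Finset (Cell d)} (hk : 1 ≤ k) (hS : IsClosedSAM k S) :
    Even S.card := by
  obtain ⟨h1, -, h3⟩ := isClosedSAM_iff.1 hS
  have := h3.sum_bd_eq_zero potential
  rw [Finset.sum_congr rfl fun f hf => sum_bd_potential (Finset.card_pos.1 (by rw [h1 f hf]; exact hk)),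
    Finset.sum_const, nsmul_eq_mul, mul_one, ZMod.natCast_eq_zero_iff_even] at this
  exact this

theorem countClosedSAM_odd (hk : 1 ≤ k) {n : ℕ} (hn : Odd n) : countClosedSAM d k n = 0 := by
  have : {S : Finset (Cell d) | IsClosedSAM k S ∧ S.card = n} = ∅ := by
    ext S
    simp only [Set.mem_ofPred_eq, Set.mem_empty_iff_false, iff_false]
    rintro ⟨hS, rfl⟩
    exact Nat.not_even_iff_odd.2 hn (hS.even_card hk)
  rw [countClosedSAM, this]
  simp

/-- A rightmost face containing the direction `x` would be alone at its right hyperedge. -/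
lemma IsCycle.exists_cap {S : Finset (Cell d)} (hS : IsCycle S) (hne : S.Nonempty) (x : Fin d) :
    ∃ s, Cap x S s := by
  obtain ⟨f, hf, hmax⟩ := exists_rightmost x hne
  refine ⟨f, hf, fun hx => ?_, hmax⟩
  have := hS (f + unit (x, true))
  rw [facesAt_eq_singleton_of_rightmost hf hx hmax] at this
  simp at this

/-! ### Adding the boundary of a cube -/

lemma facesAt_bd {q g : Cell d} {v w : Fin d × Bool} (hv : v.1 ∈ halfInt q) (hw : w.1 ∈ halfInt q)
    (hvw : v.1 ≠ w.1) (hg : g = q + unit v + unit w) :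
    facesAt (bd q) g = {q + unit v, q + unit w} := by
  have hn : ∀ v w : Fin d × Bool, v.1 ∈ halfInt q → w.1 ∈ halfInt q → v.1 ≠ w.1 →
      Neighbours (q + unit v) (q + unit v + unit w) := fun v w hv hw hvw =>
    neighbours_add_unit (by rw [halfInt_add_unit hv]; simp [hw, hvw.symm])
  subst hg
  ext c
  rw [mem_facesAt, mem_bd, Finset.mem_insert, Finset.mem_singleton]
  constructor
  · rintro ⟨⟨v', hv', rfl⟩, hc⟩
    obtain ⟨w', -, e⟩ := neighbours_iff.1 hc
    rw [add_assoc, add_assoc, add_right_inj] at e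
    rcases eq_or_eq_of_unit_add_unit hvw e with rfl | rfl
    · exact .inl rfl
    · exact .inr rfl
  · rintro (rfl | rfl)
    · exact ⟨⟨v, hv, rfl⟩, hn v w hv hw hvw⟩
    · exact ⟨⟨w, hw, rfl⟩, by rw [add_right_comm]; exact hn w v hw hv hvw.symm⟩

lemma exists_of_mem_bd {q g c : Cell d} (hc : c ∈ bd q) (hn : Neighbours c g) :
    ∃ v w : Fin d × Bool, v.1 ∈ halfInt q ∧ w.1 ∈ halfInt q ∧ v.1 ≠ w.1 ∧ c = q + unit v ∧
      g = q + unit v + unit w := by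
  obtain ⟨v, hv, rfl⟩ := mem_bd.1 hc
  obtain ⟨w, hw, rfl⟩ := neighbours_iff.1 hn
  rw [halfInt_add_unit hv, Finset.mem_erase] at hw
  exact ⟨v, w, hv, hw.2, hw.1.symm, rfl, rfl⟩

lemma isCycle_bd (q : Cell d) : IsCycle (bd q) := by
  intro g
  rcases (facesAt (bd q) g).eq_empty_or_nonempty with h | ⟨c, hc⟩
  · exact .inl (by simp [h])
  · obtain ⟨hc, hn⟩ := mem_facesAt.1 hc
    obtain ⟨v, w, hv, hw, hvw, rfl, hg⟩ := exists_of_mem_bd hc hn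
    right
    rw [facesAt_bd hv hw hvw hg, Finset.card_pair]
    exact fun e => hvw (by rw [unit_injective (add_left_cancel e)])

lemma card_symmDiff_add {α : Type*} [DecidableEq α] (A B : Finset α) :
    (symmDiff A B).card + 2 * (A ∩ B).card = A.card + B.card := by
  have h : Disjoint (A \ B) (B \ A) := disjoint_sdiff_sdiff
  rw [symmDiff, Finset.sup_eq_union, Finset.card_union_of_disjoint h]
  have h1 := Finset.card_sdiff_add_card_inter A B
  have h2 := Finset.card_sdiff_add_card_inter B A
  rw [Finset.inter_comm B A] at h2
  omega

lemma facesAt_symmDiff (S T : Finset (Cell d)) (g : Cell d) :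
    facesAt (symmDiff S T) g = symmDiff (facesAt S g) (facesAt T g) := by
  ext a
  simp only [mem_facesAt, Finset.mem_symmDiff]
  tauto

/-- Every hyperedge of the cube `q` that is occupied by `S` is a hyperedge of a common face of
`S` and the boundary of `q`. -/
def Fits (S : Finset (Cell d)) (q : Cell d) : Prop :=
  ∀ g, ∀ c ∈ S, Neighbours c g → ∀ b ∈ bd q, Neighbours b g →
    ∃ a ∈ S, a ∈ bd q ∧ Neighbours a g

/-- Four faces at a hyperedge are the only danger. `Fits` makes the two pairs share a face there, so
zero or two remain. -/
lemma IsCycle.symmDiff_bd {S : Finset (Cell d)} (hS : IsCycle S) {q : Cell d} (h : Fits S q) :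
    IsCycle (symmDiff S (bd q)) := by
  intro g
  rw [facesAt_symmDiff]
  have h1 := hS g
  have h2 := isCycle_bd q g
  have h3 := card_symmDiff_add (facesAt S g) (facesAt (bd q) g)
  have h4 : (facesAt S g ∩ facesAt (bd q) g).card ≤ (facesAt S g).card :=
    Finset.card_le_card Finset.inter_subset_left
  rcases h1 with h1 | h1 <;> rcases h2 with h2 | h2
  · omega
  · omega
  · have : (facesAt S g ∩ facesAt (bd q) g).card ≤ (facesAt (bd q) g).card :=
      Finset.card_le_card Finset.inter_subset_right
    omega
  · obtain ⟨c, hc⟩ := Finset.card_pos.1 (by omega : 0 < (facesAt S g).card)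
    obtain ⟨b, hb⟩ := Finset.card_pos.1 (by omega : 0 < (facesAt (bd q) g).card)
    rw [mem_facesAt] at hc hb
    obtain ⟨a, haS, haq, hag⟩ := h g c hc.1 hc.2 b hb.1 hb.2
    have : 0 < (facesAt S g ∩ facesAt (bd q) g).card := Finset.card_pos.2
      ⟨a, Finset.mem_inter.2 ⟨mem_facesAt.2 ⟨haS, hag⟩, mem_facesAt.2 ⟨haq, hag⟩⟩⟩
    omega

/-- Colourings of the faces that agree on adjacent faces. -/
def IsColoring (S : Finset (Cell d)) (p : Cell d → Prop) : Prop :=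
  ∀ a ∈ S, ∀ b ∈ S, Adjacent a b → (p a ↔ p b)

lemma IsColoring.of_reflTransGen {S : Finset (Cell d)} {p : Cell d → Prop} (hp : IsColoring S p)
    {a b : Cell d} (h : Relation.ReflTransGen (fun a b => a ∈ S ∧ b ∈ S ∧ Adjacent a b) a b) :
    p a ↔ p b := by
  induction h with
  | refl => rfl
  | tail _ h ih => exact ih.trans (hp _ h.1 _ h.2.1 h.2.2)

/-- A colouring of the symmetric difference, extended to the deleted faces by the colour of `b₀`, is
a colouring of `S`. By `hconn` every old face is joined within `S` to a deleted one, so it has the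
colour of `b₀`; the new faces have it by `hq`. -/
lemma connectedBy_symmDiff_bd {S : Finset (Cell d)} (hS : IsCycle S) {q : Cell d}
    (hconn : ∀ c ∈ S, ∃ b ∈ S, b ∈ bd q ∧
      Relation.ReflTransGen (fun a b => a ∈ S ∧ b ∈ S ∧ Adjacent a b) c b)
    {b₀ : Cell d} (hb₀ : b₀ ∈ bd q) (hb₀S : b₀ ∉ S)
    (hq : ∀ p, IsColoring (symmDiff S (bd q)) p → ∀ b ∈ bd q, b ∉ S → (p b ↔ p b₀)) :
    ConnectedBy (symmDiff S (bd q)) Adjacent := by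
  have hmem : ∀ b ∈ bd q, b ∉ S → b ∈ symmDiff S (bd q) := fun b h1 h2 =>
    Finset.mem_symmDiff.2 (.inr ⟨h1, h2⟩)
  have hmem' : ∀ c ∈ S, c ∉ bd q → c ∈ symmDiff S (bd q) := fun b h1 h2 =>
    Finset.mem_symmDiff.2 (.inl ⟨h1, h2⟩)
  rw [connectedBy_iff_coloring fun a b h => h.symm]
  refine ⟨⟨b₀, hmem b₀ hb₀ hb₀S⟩, fun p hp => ?_⟩
  have hcross : ∀ c ∈ S, c ∉ bd q → ∀ c' ∈ S, c' ∈ bd q → Adjacent c c' → (p c ↔ p b₀) := by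
    rintro c hc hcq c' hc' hc'q ⟨g, hg, hg'⟩
    obtain ⟨v, w, hv, hw, hvw, rfl, rfl⟩ := exists_of_mem_bd hc'q hg'
    have hfaces := facesAt_bd hv hw hvw rfl
    set g := q + unit v + unit w with hgdef
    have hwm : q + unit w ∈ facesAt (bd q) g := by rw [hfaces]; simp
    obtain ⟨hwq, hwg⟩ := mem_facesAt.1 hwm
    -- The other face of `q` at `g` is new; otherwise `S` would have three faces there. It is
    -- adjacent to `c`, which passes on the colour of the new faces.
    have hwS : q + unit w ∉ S := by
      intro hwS
      have hsub : ({c, q + unit v, q + unit w} : Finset (Cell d)) ⊆ facesAt S g := by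
        intro a ha
        simp only [Finset.mem_insert, Finset.mem_singleton] at ha
        rcases ha with rfl | rfl | rfl
        · exact mem_facesAt.2 ⟨hc, hg⟩
        · exact mem_facesAt.2 ⟨hc', hg'⟩
        · exact mem_facesAt.2 ⟨hwS, hwg⟩
      have hcard := Finset.card_le_card hsub
      have hne : q + unit v ≠ q + unit w := fun e =>
        hvw (by rw [unit_injective (add_left_cancel e)])
      rw [Finset.card_insert_of_notMem, Finset.card_pair hne] at hcard
      · rcases hS g with h | h <;> omega
      · simp only [Finset.mem_insert, Finset.mem_singleton, not_or]
        exact ⟨by rintro rfl; exact hcq hc'q, by rintro rfl; exact hcq hwq⟩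
    rw [← hq p hp _ hwq hwS]
    exact hp c (hmem' c hc hcq) _ (hmem _ hwq hwS) ⟨g, hg, hwg⟩
  have hold : ∀ c ∈ S, c ∉ bd q → (p c ↔ p b₀) := by
    intro c hc hcq
    obtain ⟨b, hb, hbq, hcb⟩ := hconn c hc
    have hcol : IsColoring S fun c => (c ∈ bd q ∧ p b₀) ∨ (c ∉ bd q ∧ p c) := by
      intro a ha b hb hab
      by_cases haq : a ∈ bd q <;> by_cases hbq : b ∈ bd q
      · simp [haq, hbq]
      · simp [haq, hbq, hcross b hb hbq a ha haq hab.symm]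
      · simp [haq, hbq, hcross a ha haq b hb hbq hab]
      · simpa [haq, hbq] using hp a (hmem' a ha haq) b (hmem' b hb hbq) hab
    simpa [hcq, hbq] using hcol.of_reflTransGen hcb
  have hall : ∀ c ∈ symmDiff S (bd q), p c ↔ p b₀ := by
    intro c hc
    rcases Finset.mem_symmDiff.1 hc with ⟨h1, h2⟩ | ⟨h1, h2⟩
    · exact hold c h1 h2
    · exact hq p hp c h1 h2
  exact fun a ha b hb => (hall a ha).trans (hall b hb).symm

lemma isCube_of_mem_bd {q c : Cell d} (hq : IsCube (k + 1) q) (hc : c ∈ bd q) : IsCube k c := by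
  obtain ⟨v, hv, rfl⟩ := mem_bd.1 hc
  rw [IsCube, halfInt_add_unit hv, Finset.card_erase_of_mem hv, hq]
  rfl

lemma adjacent_of_mem_bd {q : Cell d} {v w : Fin d × Bool} (hv : v.1 ∈ halfInt q)
    (hw : w.1 ∈ halfInt q) (hvw : v.1 ≠ w.1) : Adjacent (q + unit v) (q + unit w) := by
  have := facesAt_bd hv hw hvw rfl
  have h1 : q + unit v ∈ facesAt (bd q) (q + unit v + unit w) := by rw [this]; simp
  have h2 : q + unit w ∈ facesAt (bd q) (q + unit v + unit w) := by rw [this]; simp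
  exact ⟨_, (mem_facesAt.1 h1).2, (mem_facesAt.1 h2).2⟩

lemma isClosedSAM_symmDiff_bd {S : Finset (Cell d)} (hS : ∀ f ∈ S, IsCube k f) (hc : IsCycle S)
    {q : Cell d} (hq : IsCube (k + 1) q) (hfit : Fits S q)
    (hconn : ∀ c ∈ S, ∃ b ∈ S, b ∈ bd q ∧
      Relation.ReflTransGen (fun a b => a ∈ S ∧ b ∈ S ∧ Adjacent a b) c b)
    {b₀ : Cell d} (hb₀ : b₀ ∈ bd q) (hb₀S : b₀ ∉ S)
    (hcol : ∀ p, IsColoring (symmDiff S (bd q)) p → ∀ b ∈ bd q, b ∉ S → (p b ↔ p b₀)) :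
    IsClosedSAM k (symmDiff S (bd q)) := by
  refine isClosedSAM_iff.2 ⟨fun f hf => ?_, connectedBy_symmDiff_bd hc hconn hb₀ hb₀S hcol,
    hc.symmDiff_bd hfit⟩
  rcases Finset.mem_symmDiff.1 hf with ⟨h, -⟩ | ⟨h, -⟩
  · exact hS f h
  · exact isCube_of_mem_bd hq h


/-! ### Joining closed manifolds -/

lemma mem_bd_add_unit {x : Fin d} {s c : Cell d} (hx : x ∉ halfInt s) :
    c ∈ bd (s + unit (x, true)) ↔
      c = s ∨ c = s + unit (x, true) + unit (x, true) ∨ c ∈ sides x s := by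
  have e : s + unit (x, true) + unit (x, false) = s := by rw [unit_true, unit_false]; abel
  rw [mem_bd, halfInt_add_unit_insert (v := (x, true)) hx, mem_sides]
  constructor
  · rintro ⟨⟨i, b⟩, hv, rfl⟩
    rcases Finset.mem_insert.1 hv with rfl | hv
    · cases b
      · exact .inl e
      · exact .inr (.inl rfl)
    · exact .inr (.inr ⟨_, hv, by abel⟩)
  · rintro (rfl | rfl | ⟨v, hv, rfl⟩)
    · exact ⟨(x, false), by simp, e.symm⟩
    · exact ⟨(x, true), by simp, rfl⟩
    · exact ⟨v, Finset.mem_insert_of_mem hv, by abel⟩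

lemma IsCycle.filter {S : Finset (Cell d)} (hS : IsCycle S) {p : Cell d → Prop} [DecidablePred p]
    (hp : IsColoring S p) : IsCycle (S.filter p) := by
  intro g
  by_cases h : ∃ c ∈ facesAt S g, p c
  · obtain ⟨c, hc, hpc⟩ := h
    have : facesAt (S.filter p) g = facesAt S g := by
      ext a
      simp only [mem_facesAt, Finset.mem_filter] at hc ⊢
      exact ⟨fun h => ⟨h.1.1, h.2⟩,
        fun h => ⟨⟨h.1, (hp a h.1 c hc.1 ⟨g, h.2, hc.2⟩).2 hpc⟩, h.2⟩⟩
    rw [this]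
    exact hS g
  · left
    rw [Finset.card_eq_zero, Finset.eq_empty_iff_forall_notMem]
    intro a ha
    rw [mem_facesAt, Finset.mem_filter] at ha
    exact h ⟨a, mem_facesAt.2 ⟨ha.1.1, ha.2⟩, ha.1.2⟩

lemma le_of_neighbours_of_le {x : Fin d} {c g : Cell d} {X : ℤ} (hX : ¬ Odd X) (hc : X ≤ c x)
    (h : Neighbours c g) : X ≤ g x := by
  obtain ⟨v, hv, rfl⟩ := neighbours_iff.1 h
  rw [Pi.add_apply]
  by_cases hvx : x = v.1
  · subst hvx
    rw [mem_halfInt] at hv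
    have : X ≠ c v.1 := by rintro rfl; exact hX hv
    rcases unit_self v with h | h <;> omega
  · rw [unit_apply_of_ne hvx]; omega

lemma neighbours_le_of_le {x : Fin d} {c g : Cell d} {X : ℤ} (hX : ¬ Odd X) (hc : c x ≤ X)
    (h : Neighbours c g) : g x ≤ X := by
  obtain ⟨v, hv, rfl⟩ := neighbours_iff.1 h
  rw [Pi.add_apply]
  by_cases hvx : x = v.1
  · subst hvx
    rw [mem_halfInt] at hv
    have : X ≠ c v.1 := by rintro rfl; exact hX hv
    rcases unit_self v with h | h <;> omega
  · rw [unit_apply_of_ne hvx]; omega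

/-- The set `T` lies to the right of the cap `s` of `S` and contains the face facing it. -/
structure Facing (x : Fin d) (S T : Finset (Cell d)) (s : Cell d) : Prop where
  cap : Cap x S s
  mem : s + unit (x, true) + unit (x, true) ∈ T
  le : ∀ b ∈ T, s x + 2 ≤ b x

/-- The union of `S` and `T`, with the facing faces replaced by a tube. -/
def bridge (x : Fin d) (S T : Finset (Cell d)) (s : Cell d) : Finset (Cell d) :=
  symmDiff (S ∪ T) (bd (s + unit (x, true)))

namespace Facing

variable {x : Fin d} {S T : Finset (Cell d)} {s : Cell d}

lemma notMem_left (h : Facing x S T s) {b : Cell d} (hb : b ∈ T) : b ∉ S := fun hS => by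
  have := h.le b hb
  have := h.cap.le b hS
  omega

lemma notMem_sides (h : Facing x S T s) {b : Cell d} (hb : b ∈ S ∪ T) : b ∉ sides x s := by
  rcases Finset.mem_union.1 hb with hb | hb
  · exact h.cap.notMem_sides hb
  · intro hs
    have := side_apply h.cap.half hs
    have := h.le b hb
    omega

lemma not_odd (h : Facing x S T s) : ¬ Odd (s x) := by simpa [mem_halfInt] using h.cap.half

lemma facesAt_right (h : Facing x S T s) {g : Cell d} (hg : g x < s x + 2) : facesAt T g = ∅ := by
  rw [Finset.eq_empty_iff_forall_notMem]
  intro b hb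
  obtain ⟨hb, hn⟩ := mem_facesAt.1 hb
  have := h.not_odd
  have := le_of_neighbours_of_le (X := s x + 2) (by grind) (h.le b hb) hn
  omega

lemma isCycle_union (h : Facing x S T s) (hS : IsCycle S) (hT : IsCycle T) : IsCycle (S ∪ T) := by
  intro g
  rw [facesAt_union]
  by_cases hg : s x < g x
  · rw [h.cap.facesAt_eq_empty hg, Finset.empty_union]; exact hT g
  · rw [h.facesAt_right (by omega), Finset.union_empty]; exact hS g

lemma mem_bridge (h : Facing x S T s) {c : Cell d} : c ∈ bridge x S T s ↔
    c ∈ S.erase s ∨ c ∈ sides x s ∨ c ∈ T.erase (s + unit (x, true) + unit (x, true)) := by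
  have h1 : c = s → c ∈ S ∪ T := by rintro rfl; exact Finset.mem_union_left _ h.cap.mem
  have h2 : c = s + unit (x, true) + unit (x, true) → c ∈ S ∪ T := by
    rintro rfl; exact Finset.mem_union_right _ h.mem
  have h3 : c ∈ S ∪ T → c ∉ sides x s := h.notMem_sides
  have h4 : c = s → c ∉ T := by rintro rfl hc; exact h.notMem_left hc h.cap.mem
  have h5 : c = s + unit (x, true) + unit (x, true) → c ∉ S := by
    rintro rfl hc; exact h.notMem_left h.mem hc
  have h6 : c ∈ S ∪ T ↔ c ∈ S ∨ c ∈ T := Finset.mem_union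
  rw [bridge, Finset.mem_symmDiff, mem_bd_add_unit h.cap.half, Finset.mem_erase, Finset.mem_erase,
    ne_eq, ne_eq]
  generalize (c = s + unit (x, true) + unit (x, true)) = P₁ at *
  generalize (c = s) = P₂ at *
  generalize (c ∈ sides x s) = P₃ at *
  generalize (c ∈ S ∪ T) = P₄ at *
  generalize (c ∈ S) = P₅ at *
  generalize (c ∈ T) = P₆ at *
  clear h
  grind

/-- A hyperedge of the cube either belongs to one of its two ends, which lie in `S` and `T`, or is
at mid-height `s x + 1`, where neither set has a face. -/
lemma fits (h : Facing x S T s) : Fits (S ∪ T) (s + unit (x, true)) := by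
  intro g c hc hcg b hb hbg
  obtain ⟨v, w, hv, hw, hvw, rfl, rfl⟩ := exists_of_mem_bd hb hbg
  have hfaces := facesAt_bd hv hw hvw rfl
  have key : ∀ u : Fin d × Bool, u = v ∨ u = w → u.1 = x →
      ∃ a ∈ S ∪ T, a ∈ bd (s + unit (x, true)) ∧
        Neighbours a (s + unit (x, true) + unit v + unit w) := by
    intro u hu hux
    have : s + unit (x, true) + unit u ∈
        facesAt (bd (s + unit (x, true))) (s + unit (x, true) + unit v + unit w) := by
      rw [hfaces]; rcases hu with rfl | rfl <;> simp
    obtain ⟨h1, h2⟩ := mem_facesAt.1 this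
    refine ⟨_, ?_, h1, h2⟩
    obtain ⟨i, b⟩ := u
    obtain rfl : i = x := hux
    cases b
    · have e : s + unit (i, true) + unit (i, false) = s := by rw [unit_true, unit_false]; abel
      rw [e]; exact Finset.mem_union_left _ h.cap.mem
    · exact Finset.mem_union_right _ h.mem
  by_cases hvx : v.1 = x
  · exact key v (.inl rfl) hvx
  by_cases hwx : w.1 = x
  · exact key w (.inr rfl) hwx
  exfalso
  have hgx : (s + unit (x, true) + unit v + unit w) x = s x + 1 := by
    rw [Pi.add_apply, Pi.add_apply, add_unit_true_apply, unit_apply_of_ne (Ne.symm hvx),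
      unit_apply_of_ne (Ne.symm hwx)]
    omega
  have := mem_facesAt.2 ⟨hc, hcg⟩
  rw [facesAt_union, h.cap.facesAt_eq_empty (by omega), h.facesAt_right (by omega)] at this
  simp at this

lemma card_bridge (h : Facing x S T s) (hs : IsCube k s) :
    (bridge x S T s).card + 2 = S.card + T.card + 2 * k := by
  have e : bridge x S T s = tubeFaces x S s ∪ T.erase (s + unit (x, true) + unit (x, true)) := by
    ext c
    rw [h.mem_bridge, tubeFaces, Finset.mem_union, Finset.mem_union, or_assoc]
  have hd : Disjoint (tubeFaces x S s) (T.erase (s + unit (x, true) + unit (x, true))) := by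
    refine Finset.disjoint_right.2 fun b hb hb' => ?_
    have hbT := Finset.mem_of_mem_erase hb
    rcases Finset.mem_union.1 hb' with hb' | hb'
    · exact h.notMem_left hbT (Finset.mem_of_mem_erase hb')
    · exact h.notMem_sides (Finset.mem_union_right _ hbT) hb'
  rw [e, Finset.card_union_of_disjoint hd]
  have h1 := h.cap.card_tube hs
  have h2 := Finset.card_erase_add_one h.mem
  omega

/-- If the sides of the tube fell into two colour classes, then one of the classes would be
a cycle that crosses the hyperplane of the cap an odd number of times. -/
lemma coloring_sides_one (h : Facing x S T s) (hU : IsCycle (bridge x S T s)) {p : Cell d → Prop}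
    (hp : IsColoring (bridge x S T s) p) {i : Fin d} (hi : halfInt s = {i}) :
    p (s + unit (i, false) + unit (x, true)) ↔ p (s + unit (i, true) + unit (x, true)) := by
  classical
  by_contra hne
  set b₀ := s + unit (i, true) + unit (x, true) with hb₀
  have hC := hU.filter (p := fun c => p c ↔ p b₀) fun a ha b hb hab =>
    iff_congr (hp a ha b hb hab) Iff.rfl
  have hside : ∀ b, b₀ = s + unit (i, b) + unit (x, true) →
      b₀ ∈ (bridge x S T s).filter fun c => p c ↔ p b₀ := fun b e =>
    Finset.mem_filter.2 ⟨h.mem_bridge.2 (.inr (.inl (mem_sides.2 ⟨(i, b), by simp [hi], e⟩))),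
      Iff.rfl⟩
  -- Weight one in the half-space up to the cap: faces of `S` contribute an even number, faces of
  -- `T` nothing, and `b₀` exactly its lower vertex. The other side has the other colour, so the sum
  -- is one instead of zero.
  have hsum := hC.sum_bd_eq_zero fun g => if g x ≤ s x then 1 else 0
  have hxi : x ≠ i := by rintro rfl; exact h.cap.half (by simp [hi])
  rw [Finset.sum_eq_single_of_mem b₀ (hside true rfl)] at hsum
  · have hh : halfInt b₀ = {x} := by
      rw [hb₀, halfInt_side (v := (i, true)) h.cap.half (by simp [hi]), hi]; simp
    have hbx : b₀ x = s x + 1 := side_apply h.cap.half (mem_sides.2 ⟨(i, true), by simp [hi], rfl⟩)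
    rw [sum_bd, hh, Finset.sum_singleton, Pi.add_apply, Pi.add_apply, hbx, unit_apply,
      unit_apply] at hsum
    simp at hsum
  · intro c hc hcb
    obtain ⟨hcU, hcp⟩ := Finset.mem_filter.1 hc
    rcases h.mem_bridge.1 hcU with hc | hc | hc
    · rw [Finset.sum_congr rfl fun g hg => if_pos (neighbours_le_of_le h.not_odd
        (h.cap.le c (Finset.mem_of_mem_erase hc)) (mem_bd_iff_neighbours.1 hg)), Finset.sum_const,
        card_bd, mul_nsmul, CharTwo.two_nsmul]
      simp
    · obtain ⟨⟨j, b⟩, hv, rfl⟩ := mem_sides.1 hc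
      rw [hi, Finset.mem_singleton] at hv
      obtain rfl : j = i := hv
      cases b
      · exact absurd hcp hne
      · exact absurd rfl hcb
    · refine Finset.sum_eq_zero fun g hg => if_neg ?_
      have h1 := h.not_odd
      have := le_of_neighbours_of_le (X := s x + 2) (by grind)
        (h.le c (Finset.mem_of_mem_erase hc)) (mem_bd_iff_neighbours.1 hg)
      omega

/-- Each of `S` and `T` is attached to the cube by its own end. The sides are joined to one another
directly if `k ≥ 2`; for `k = 1` the two sides have the same colour by the parity argument of
`coloring_sides_one`. -/
lemma isClosedSAM (h : Facing x S T s) (hk : 1 ≤ k) (hS : IsClosedSAM k S)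
    (hT : IsClosedSAM k T) : IsClosedSAM k (bridge x S T s) := by
  obtain ⟨hS1, hS2, hS3⟩ := isClosedSAM_iff.1 hS
  obtain ⟨hT1, hT2, hT3⟩ := isClosedSAM_iff.1 hT
  have hs := hS1 s h.cap.mem
  have hq : IsCube (k + 1) (s + unit (x, true)) := by
    rw [IsCube, halfInt_add_unit_insert (v := (x, true)) h.cap.half,
      Finset.card_insert_of_notMem h.cap.half, hs]
  have hcyc := h.isCycle_union hS3 hT3
  have hU : IsCycle (bridge x S T s) := hcyc.symmDiff_bd h.fits
  obtain ⟨i, hi⟩ : (halfInt s).Nonempty := h.cap.nonempty_halfInt hS1 hk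
  have hside : ∀ v : Fin d × Bool, v.1 ∈ halfInt s →
      s + unit v + unit (x, true) ∈ sides x s := fun v hv => mem_sides.2 ⟨v, hv, rfl⟩
  refine isClosedSAM_symmDiff_bd (b₀ := s + unit (i, true) + unit (x, true)) ?_ hcyc hq h.fits
    ?_ ((mem_bd_add_unit h.cap.half).2 (.inr (.inr (hside (i, true) hi)))) ?_ ?_
  · intro f hf
    rcases Finset.mem_union.1 hf with hf | hf
    · exact hS1 f hf
    · exact hT1 f hf
  · intro c hc
    rcases Finset.mem_union.1 hc with hc | hc
    · refine ⟨s, Finset.mem_union_left _ h.cap.mem, (mem_bd_add_unit h.cap.half).2 (.inl rfl), ?_⟩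
      exact (hS2.2 c hc s h.cap.mem).lift id fun a b hab =>
        ⟨Finset.mem_union_left _ hab.1, Finset.mem_union_left _ hab.2.1, hab.2.2⟩
    · refine ⟨_, Finset.mem_union_right _ h.mem,
        (mem_bd_add_unit h.cap.half).2 (.inr (.inl rfl)), ?_⟩
      exact (hT2.2 c hc _ h.mem).lift id fun a b hab =>
        ⟨Finset.mem_union_right _ hab.1, Finset.mem_union_right _ hab.2.1, hab.2.2⟩
  · exact fun hc => h.notMem_sides hc (hside (i, true) hi)
  · intro p hp b hb hbW
    have hbs : b ∈ sides x s := by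
      rcases (mem_bd_add_unit h.cap.half).1 hb with rfl | rfl | hb
      · exact absurd (Finset.mem_union_left _ h.cap.mem) hbW
      · exact absurd (Finset.mem_union_right _ h.mem) hbW
      · exact hb
    have hmem : ∀ v : Fin d × Bool, v.1 ∈ halfInt s →
        s + unit v + unit (x, true) ∈ bridge x S T s := fun v hv =>
      h.mem_bridge.2 (.inr (.inl (hside v hv)))
    have hadj : ∀ v w : Fin d × Bool, v.1 ∈ halfInt s → w.1 ∈ halfInt s → v.1 ≠ w.1 →
        (p (s + unit v + unit (x, true)) ↔ p (s + unit w + unit (x, true))) := by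
      intro v w hv hw hvw
      have hq' : halfInt (s + unit (x, true)) = insert x (halfInt s) :=
        halfInt_add_unit_insert (v := (x, true)) h.cap.half
      refine hp _ (hmem v hv) _ (hmem w hw) ?_
      have := adjacent_of_mem_bd (q := s + unit (x, true)) (v := v) (w := w)
        (by rw [hq']; exact Finset.mem_insert_of_mem hv)
        (by rw [hq']; exact Finset.mem_insert_of_mem hw) hvw
      rwa [add_right_comm s (unit (x, true)) (unit v),
        add_right_comm s (unit (x, true)) (unit w)] at this
    obtain ⟨v, hv, rfl⟩ := mem_sides.1 hbs
    by_cases hvi : v.1 = i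
    · by_cases hex : ∃ j ∈ halfInt s, j ≠ i
      · obtain ⟨j, hj, hji⟩ := hex
        exact (hadj v (j, true) hv hj (hvi.trans_ne hji.symm)).trans
          (hadj (j, true) (i, true) hj hi hji)
      · push Not at hex
        have hsing : halfInt s = {i} := Finset.eq_singleton_iff_unique_mem.2 ⟨hi, hex⟩
        obtain ⟨j, b⟩ := v
        obtain rfl : j = i := hvi
        cases b
        · exact h.coloring_sides_one hU hp hsing
        · exact Iff.rfl
    · exact hadj v (i, true) hv hi hvi

lemma isLower_left (h : Facing x S T s) : IsLower x (S.erase s) (bridge x S T s) := by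
  refine ⟨fun c hc => h.mem_bridge.2 (.inl hc), s x, fun c hc => ?_⟩
  rcases h.mem_bridge.1 hc with hc | hc | hc
  · exact iff_of_true hc (h.cap.le c (Finset.mem_of_mem_erase hc))
  · refine iff_of_false (fun h' => h.cap.notMem_sides (Finset.mem_of_mem_erase h') hc) ?_
    rw [side_apply h.cap.half hc]; omega
  · have hcT := Finset.mem_of_mem_erase hc
    refine iff_of_false (fun h' => h.notMem_left hcT (Finset.mem_of_mem_erase h')) ?_
    have := h.le c hcT; omega

lemma isLower_tube (h : Facing x S T s) : IsLower x (tubeFaces x S s) (bridge x S T s) := by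
  refine ⟨fun c hc => h.mem_bridge.2 ?_, s x + 1, fun c hc => ?_⟩
  · rcases Finset.mem_union.1 hc with hc | hc
    · exact .inl hc
    · exact .inr (.inl hc)
  rcases h.mem_bridge.1 hc with hc | hc | hc
  · refine iff_of_true (Finset.mem_union_left _ hc) ?_
    have := h.cap.le c (Finset.mem_of_mem_erase hc); omega
  · exact iff_of_true (Finset.mem_union_right _ hc) (side_apply h.cap.half hc).le
  · have hcT := Finset.mem_of_mem_erase hc
    refine iff_of_false (fun h' => ?_) (by have := h.le c hcT; omega)
    rcases Finset.mem_union.1 h' with h' | h'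
    · exact h.notMem_left hcT (Finset.mem_of_mem_erase h')
    · exact h.notMem_sides (Finset.mem_union_right _ hcT) h'

lemma right_eq (h : Facing x S T s) :
    T.erase (s + unit (x, true) + unit (x, true)) = bridge x S T s \ tubeFaces x S s := by
  ext c
  rw [Finset.mem_sdiff, h.mem_bridge, tubeFaces, Finset.mem_union]
  refine ⟨fun hc => ⟨.inr (.inr hc), ?_⟩, fun hc => ?_⟩
  · have hcT := Finset.mem_of_mem_erase hc
    rintro (h' | h')
    · exact h.notMem_left hcT (Finset.mem_of_mem_erase h')
    · exact h.notMem_sides (Finset.mem_union_right _ hcT) h'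
  · tauto

/-- Cuts below and above the tube are both determined by cardinality. Between them lie the sides,
which give back `s` and so both deleted faces. -/
lemma image_shift_eq {S' T' : Finset (Cell d)} {s' : Cell d} (h : Facing x S T s)
    (h' : Facing x S' T' s') (hs : IsCube k s) (hs' : IsCube k s') (hk : 1 ≤ k)
    (hc : S.card = S'.card) {t : Fin d → ℤ}
    (hU : bridge x S' T' s' = (bridge x S T s).image (shift t)) :
    S' = S.image (shift t) ∧ T' = T.image (shift t) := by
  have h1 := h.isLower_left.image_shift h'.isLower_left hU (by
    rw [Finset.card_erase_of_mem h.cap.mem, Finset.card_erase_of_mem h'.cap.mem, hc])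
  have h2 := h.isLower_tube.image_shift h'.isLower_tube hU (by
    have := h.cap.card_tube hs
    have := h'.cap.card_tube hs'
    omega)
  have hsd : ∀ {S T : Finset (Cell d)} {s}, Facing x S T s →
      sides x s = tubeFaces x S s \ S.erase s := fun h => by
    rw [tubeFaces, Finset.union_sdiff_left, sdiff_eq_left.2 h.cap.disjoint.symm]
  have hsides : sides x s' = sides x (shift t s) := by
    rw [sides_shift, hsd h', hsd h, Finset.image_sdiff _ _ (shift_injective t), ← h1, h2]
  obtain rfl : s' = shift t s :=
    sides_injective (by rw [← Finset.card_pos, hs']; exact hk) hsides.subset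
  refine ⟨?_, ?_⟩
  · rw [← Finset.insert_erase h.cap.mem, ← Finset.insert_erase h'.cap.mem, h1,
      Finset.image_insert]
  · rw [← Finset.insert_erase h.mem, ← Finset.insert_erase h'.mem, h.right_eq, h'.right_eq, hU,
      h2, Finset.image_insert, Finset.image_sdiff _ _ (shift_injective t), shift_add_right,
      shift_add_right]

end Facing

lemma isClosedSAM_image_turn {S : Finset (Cell d)} (hS : IsClosedSAM k S)
    (π : Equiv.Perm (Fin d)) (t : Fin d → ℤ) : IsClosedSAM k (S.image (turn π t)) := by
  obtain ⟨h1, h2, h3⟩ := isClosedSAM_iff.1 hS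
  refine isClosedSAM_iff.2 ⟨fun f hf => ?_, connectedBy_image _ (fun a b ⟨g, ha, hb⟩ =>
    ⟨turn π t g, neighbours_turn.2 ha, neighbours_turn.2 hb⟩) h2, fun g => ?_⟩
  · obtain ⟨a, ha, rfl⟩ := Finset.mem_image.1 hf
    exact isCube_turn.2 (h1 a ha)
  · obtain ⟨g, rfl⟩ := (turn π t).surjective g
    rw [facesAt_image_turn, Finset.card_image_of_injective _ (turn π t).injective]
    exact h3 g

lemma exists_countClosedSAM_le (d k : ℕ) : ∃ C : ℕ, ∀ n,
    (Quotient.mk (faceSetoid d) '' {S | IsClosedSAM k S ∧ S.card = n}).Finite ∧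
      countClosedSAM d k n ≤ C ^ (n + 1) := by
  obtain ⟨C, hC⟩ := finite_classes_and_ncard_le d
  refine ⟨C, fun n => ?_⟩
  have h := hC (fun M => ∃ S, IsClosedSAM k S ∧ M = fullLink S) (by
    rintro _ ⟨S, hS, rfl⟩
    exact ⟨supported_fullLink S, connectedBy_fullLink_iff.2 hS.1.1.2⟩) n
  have e : {M : LinkedFaces d | (∃ S, IsClosedSAM k S ∧ M = fullLink S) ∧ M.faces.card = n} =
      fullLink '' {S | IsClosedSAM k S ∧ S.card = n} := by
    ext M
    constructor
    · rintro ⟨⟨S, hS, rfl⟩, hn⟩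
      exact ⟨S, ⟨hS, hn⟩, rfl⟩
    · rintro ⟨S, ⟨hS, hn⟩, rfl⟩
      exact ⟨⟨S, hS, rfl⟩, hn⟩
  rw [e] at h
  have h' := ncard_faceClasses_eq {S : Finset (Cell d) | IsClosedSAM k S ∧ S.card = n}
  exact ⟨h'.2 h.1, (countClosedSAM.eq_1 d k n).trans_le (h'.1.trans_le h.2)⟩

/-- Turn the second manifold so that a cap of it faces a cap of the first. The bridge removes two
faces and adds `2 * k`, and the permutation is again the only code. -/
lemma countClosedSAM_mul_le (hk : 1 ≤ k) (x : Fin d) (n m : ℕ) :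
    countClosedSAM d k n * countClosedSAM d k m ≤
      Fintype.card (Equiv.Perm (Fin d)) * countClosedSAM d k (n + m + 2 * k - 2) := by
  obtain ⟨C, hC⟩ := exists_countClosedSAM_le d k
  refine ncard_classes_mul_le (sα := faceSetoid d) (sβ := faceSetoid d) (sγ := faceSetoid d)
    (hC (n + m + 2 * k - 2)).1 (fun S T U π => ∃ t s, Facing x S (T.image (turn π t)) s ∧
      U = bridge x S (T.image (turn π t)) s) ?_ ?_
  · rintro S ⟨hS, hn⟩ T ⟨hT, hm⟩
    obtain ⟨hS1, hS2, hS3⟩ := isClosedSAM_iff.1 hS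
    obtain ⟨hT1, hT2, hT3⟩ := isClosedSAM_iff.1 hT
    obtain ⟨s, hs⟩ := hS3.exists_cap hS2.1 x
    obtain ⟨b, hb⟩ := hT3.exists_cap hT2.1 x
    have hs' : halfInt (s + unit (x, true) + unit (x, true)) = halfInt s := by
      rw [halfInt_add_unit (v := (x, true)), halfInt_add_unit_insert (v := (x, true)) hs.half]
      · simp [hs.half]
      · rw [halfInt_add_unit_insert (v := (x, true)) hs.half]; simp
    obtain ⟨π, t, hx, ht⟩ := exists_turn_eq (x := x) (hT1 b hb.mem)
      (f' := s + unit (x, true) + unit (x, true)) (by rw [IsCube, hs']; exact hS1 s hs.mem)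
      (by rw [hs']; exact iff_of_false hb.half hs.half)
    have hF : Facing x S (T.image (turn π t)) s := by
      refine ⟨hs, Finset.mem_image.2 ⟨b, hb.mem, ht⟩, fun c hc => ?_⟩
      obtain ⟨a, ha, rfl⟩ := Finset.mem_image.1 hc
      have h1 := congrFun ht x
      rw [add_unit_true_apply, add_unit_true_apply, turn_apply, hx] at h1
      have h2 := hb.le a ha
      rw [turn_apply, hx]
      omega
    refine ⟨_, ⟨hF.isClosedSAM hk hS (isClosedSAM_image_turn hT π t), ?_⟩, π, t, s, hF, rfl⟩
    have := hF.card_bridge (hS1 s hs.mem)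
    rw [Finset.card_image_of_injective _ (turn π t).injective] at this
    omega
  · rintro S S' T T' _ _ π ⟨hS, hn⟩ ⟨hS', hn'⟩ - - ⟨t, s, h, rfl⟩ ⟨t', s', h', rfl⟩ ⟨u, hu⟩
    obtain ⟨h1, h2⟩ := h.image_shift_eq h' (hS.1.1.1 s h.cap.mem) (hS'.1.1.1 s' h'.cap.mem) hk
      (hn.trans hn'.symm) hu
    obtain ⟨w, hw⟩ := exists_shift_turn_eq π t t' u
    exact ⟨⟨u, h1⟩, w, image_eq_of_image_turn_eq hw h2⟩


/-! ### The growth constant of closed manifolds -/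

/-- Attaching the boundary of a cube to a closed manifold. -/
lemma IsClosedSAM.symmDiff_bd {S : Finset (Cell d)} (hS : IsClosedSAM k S) {q : Cell d}
    (hq : IsCube (k + 1) q) (hfit : Fits S q) {a : Fin d} (ha : a ∈ halfInt q)
    (h₀ : q + unit (a, false) ∈ S) (h₁ : q + unit (a, true) ∉ S) :
    IsClosedSAM k (symmDiff S (bd q)) := by
  obtain ⟨hS1, hS2, hS3⟩ := isClosedSAM_iff.1 hS
  refine isClosedSAM_symmDiff_bd hS1 hS3 hq hfit
    (fun c hc => ⟨_, h₀, mem_bd.2 ⟨(a, false), ha, rfl⟩, hS2.2 c hc _ h₀⟩)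
    (mem_bd.2 ⟨(a, true), ha, rfl⟩) h₁ fun p hp b hb hbS => ?_
  obtain ⟨⟨i, e⟩, hv, rfl⟩ := mem_bd.1 hb
  by_cases hia : i = a
  · subst hia
    cases e
    · exact absurd h₀ hbS
    · rfl
  · exact hp _ (Finset.mem_symmDiff.2 (.inr ⟨hb, hbS⟩)) _
      (Finset.mem_symmDiff.2 (.inr ⟨mem_bd.2 ⟨(a, true), ha, rfl⟩, h₁⟩))
      (adjacent_of_mem_bd (v := (i, e)) (w := (a, true)) hv ha hia)

lemma isClosedSAM_bd (hk : 1 ≤ k) {q : Cell d} (hq : IsCube (k + 1) q) : IsClosedSAM k (bd q) := by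
  have hcard : 1 < (halfInt q).card := by rw [hq]; omega
  obtain ⟨i, hi, j, hj, hij⟩ := Finset.one_lt_card.1 hcard
  have e : symmDiff ∅ (bd q) = bd q := bot_symmDiff (a := bd q)
  rw [← e]
  refine isClosedSAM_symmDiff_bd (b₀ := q + unit (i, true)) (by simp)
    (fun g => .inl (by simp [facesAt])) hq (fun g c hc => by simp at hc) (by simp)
    (mem_bd.2 ⟨(i, true), hi, rfl⟩) (by simp) fun p hp b hb _ => ?_
  rw [e] at hp
  have hadj : ∀ v w : Fin d × Bool, v.1 ∈ halfInt q → w.1 ∈ halfInt q → v.1 ≠ w.1 →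
      (p (q + unit v) ↔ p (q + unit w)) := fun v w hv hw hvw =>
    hp _ (mem_bd.2 ⟨v, hv, rfl⟩) _ (mem_bd.2 ⟨w, hw, rfl⟩) (adjacent_of_mem_bd hv hw hvw)
  obtain ⟨v, hv, rfl⟩ := mem_bd.1 hb
  by_cases hvi : v.1 = i
  · exact (hadj v (j, true) hv hj (hvi.trans_ne hij)).trans (hadj (j, true) (i, true) hj hi hij.symm)
  · exact hadj v (i, true) hv hi hvi

/-- Attaching a cube to a rightmost face. -/
lemma Cap.isClosedSAM {x : Fin d} {S : Finset (Cell d)} {s : Cell d} (h : Cap x S s)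
    (hS : IsClosedSAM k S) : IsClosedSAM k (symmDiff S (bd (s + unit (x, true)))) ∧
      (symmDiff S (bd (s + unit (x, true)))).card = S.card + 2 * k := by
  have e : s + unit (x, true) + unit (x, false) = s := by rw [unit_true, unit_false]; abel
  have hx : x ∈ halfInt (s + unit (x, true)) := by
    rw [halfInt_add_unit_insert (v := (x, true)) h.half]; simp
  have hq : IsCube (k + 1) (s + unit (x, true)) := by
    rw [IsCube, halfInt_add_unit_insert (v := (x, true)) h.half,
      Finset.card_insert_of_notMem h.half, hS.1.1.1 s h.mem]
  have hnot : ∀ c ∈ S, c ≠ s → c ∉ bd (s + unit (x, true)) := fun c hc hcs hb => by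
    rcases (mem_bd_add_unit h.half).1 hb with rfl | rfl | hb
    · exact hcs rfl
    · have := h.le _ hc
      rw [add_unit_true_apply, add_unit_true_apply] at this
      omega
    · exact h.notMem_sides hc hb
  refine ⟨hS.symmDiff_bd hq ?_ hx (by rw [e]; exact h.mem) fun hc => ?_, ?_⟩
  · intro g c hc hcg b hb hbg
    have hgx : g x ≤ s x := neighbours_le_of_le (by simpa [mem_halfInt] using h.half) (h.le c hc) hcg
    refine ⟨s, h.mem, (mem_bd_add_unit h.half).2 (.inl rfl), ?_⟩
    obtain ⟨v, w, hv, hw, hvw, rfl, rfl⟩ := exists_of_mem_bd hb hbg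
    have hfaces := facesAt_bd hv hw hvw rfl
    have key : ∀ u : Fin d × Bool, u = v ∨ u = w → u = (x, false) →
        Neighbours s (s + unit (x, true) + unit v + unit w) := by
      rintro u hu rfl
      have : s + unit (x, true) + unit (x, false) ∈
          facesAt (bd (s + unit (x, true))) (s + unit (x, true) + unit v + unit w) := by
        rw [hfaces]; rcases hu with rfl | rfl <;> simp
      rw [e] at this
      exact (mem_facesAt.1 this).2
    by_cases h1 : v = (x, false)
    · exact key v (.inl rfl) h1
    by_cases h2 : w = (x, false)
    · exact key w (.inr rfl) h2
    exfalso
    have hnn : ∀ u : Fin d × Bool, u ≠ (x, false) → 0 ≤ unit u x := by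
      rintro ⟨i, b⟩ hu
      rw [unit_apply]
      by_cases hi : x = i
      · subst hi
        cases b
        · exact absurd rfl hu
        · simp
      · simp [hi]
    rw [Pi.add_apply, Pi.add_apply, add_unit_true_apply] at hgx
    have := hnn v h1
    have := hnn w h2
    omega
  · have := h.le _ hc
    rw [add_unit_true_apply, add_unit_true_apply] at this
    omega
  · have hint : S ∩ bd (s + unit (x, true)) = {s} := by
      ext c
      rw [Finset.mem_inter, Finset.mem_singleton]
      constructor
      · rintro ⟨hc, hb⟩
        by_contra hcs
        exact hnot c hc hcs hb
      · rintro rfl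
        exact ⟨h.mem, (mem_bd_add_unit h.half).2 (.inl rfl)⟩
    have := card_symmDiff_add S (bd (s + unit (x, true)))
    rw [hint, Finset.card_singleton, card_bd, hq] at this
    omega

lemma bd_apply_le {q c : Cell d} (hc : c ∈ bd q) (i : Fin d) : c i ≤ q i + 1 :=
  by have := (apply_le_of_neighbours (mem_bd_iff_neighbours.1 hc) i).2; omega

/-- The boundary of a two by two block of cubes `q`, `qa`, `qb`, `r`: four times `2 * (k + 1)`
faces, less both copies of the four shared ones. The block serves to reach the residues of the
hyperarea that attaching cubes cannot change. -/
lemma exists_isClosedSAM_block (hk : 1 ≤ k) (hkd : k < d) :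
    ∃ S : Finset (Cell d), IsClosedSAM k S ∧ S.card = 8 * k := by
  obtain ⟨q, hq, -⟩ := exists_isCube_mem_halfInt (k := k + 1) (by omega) hkd ⟨0, by omega⟩
  have hcard : 1 < (halfInt q).card := by rw [hq]; omega
  obtain ⟨a, ha, b, hb, hab⟩ := Finset.one_lt_card.1 hcard
  have hqa : Odd (q a) := mem_halfInt.1 ha
  have hqb : Odd (q b) := mem_halfInt.1 hb
  have uab : (unit (a, true) : Cell d) b = 0 := unit_apply_of_ne hab.symm
  have uba : (unit (b, true) : Cell d) a = 0 := unit_apply_of_ne hab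
  have hha : a ∉ halfInt (q + unit (a, true)) := by
    rw [halfInt_add_unit (v := (a, true)) ha]; simp
  have hhb : b ∉ halfInt (q + unit (b, true)) := by
    rw [halfInt_add_unit (v := (b, true)) hb]; simp
  have h1 : IsClosedSAM k (bd q) := isClosedSAM_bd hk hq
  have c1 : Cap a (bd q) (q + unit (a, true)) := by
    refine ⟨mem_bd.2 ⟨(a, true), ha, rfl⟩, hha, fun c hc => ?_⟩
    rw [add_unit_true_apply]
    exact bd_apply_le hc a
  obtain ⟨h2, n2⟩ := c1.isClosedSAM h1
  set qa := q + unit (a, true) + unit (a, true) with hqa'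
  set S₂ := symmDiff (bd q) (bd qa) with hS₂
  have qab : qa b = q b := by rw [hqa', Pi.add_apply, Pi.add_apply, uab]; omega
  have qaa : qa a = q a + 2 := by rw [hqa', add_unit_true_apply, add_unit_true_apply]; omega
  have le2 : ∀ c ∈ S₂, c b ≤ q b + 1 := by
    intro c hc
    rcases Finset.mem_symmDiff.1 hc with ⟨hc, -⟩ | ⟨hc, -⟩
    · exact bd_apply_le hc b
    · have := bd_apply_le hc b
      omega
  have c2 : Cap b S₂ (q + unit (b, true)) := by
    refine ⟨Finset.mem_symmDiff.2 (.inl ⟨mem_bd.2 ⟨(b, true), hb, rfl⟩, fun hc => ?_⟩), hhb,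
      fun c hc => ?_⟩
    · have := (apply_le_of_neighbours (mem_bd_iff_neighbours.1 hc) a).1
      rw [Pi.add_apply, uba] at this
      omega
    · rw [add_unit_true_apply]
      exact le2 c hc
  obtain ⟨h3, n3⟩ := c2.isClosedSAM h2
  set qb := q + unit (b, true) + unit (b, true) with hqb'
  set S₃ := symmDiff S₂ (bd qb) with hS₃
  have qba : qb a = q a := by rw [hqb', Pi.add_apply, Pi.add_apply, uba]; omega
  -- The three cubes form an L that stays out of the open quadrant of `r`, so `r` meets `S₃` in just
  -- the two faces at the inner corner of the L.
  have le3 : ∀ c ∈ S₃, c a ≤ q a + 1 ∨ c b ≤ q b + 1 := by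
    intro c hc
    rcases Finset.mem_symmDiff.1 hc with ⟨hc, -⟩ | ⟨hc, -⟩
    · exact .inr (le2 c hc)
    · have := bd_apply_le hc a
      exact .inl (by omega)
  set r := qa + unit (b, true) + unit (b, true) with hr
  have ra : r a = q a + 2 := by rw [hr, Pi.add_apply, Pi.add_apply, uba]; omega
  have rb : r b = q b + 2 := by rw [hr, add_unit_true_apply, add_unit_true_apply]; omega
  have eb : r + unit (b, false) = qa + unit (b, true) := by rw [hr, unit_true, unit_false]; abel
  have ea : r + unit (a, false) = qb + unit (a, true) := by
    rw [hr, hqa', hqb', unit_true, unit_true, unit_false]; abel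
  have hhq : ∀ i, halfInt (q + unit (i, true) + unit (i, true)) = halfInt q := by
    intro i
    ext j
    rw [mem_halfInt, mem_halfInt, Pi.add_apply, Pi.add_apply]
    constructor <;> intro h <;> grind
  have hhqa : halfInt qa = halfInt q := hhq a
  have hhr : halfInt r = halfInt q := by
    ext j
    rw [mem_halfInt, ← hhqa, mem_halfInt, hr, Pi.add_apply, Pi.add_apply]
    constructor <;> intro h <;> grind
  have hrcube : IsCube (k + 1) r := by rw [IsCube, hhr]; exact hq
  have hra : a ∈ halfInt r := hhr ▸ ha
  have hrb : b ∈ halfInt r := hhr ▸ hb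
  have ma : r + unit (a, false) ∈ S₃ := by
    rw [ea]
    refine Finset.mem_symmDiff.2 (.inr ⟨mem_bd.2 ⟨(a, true), (hhq b).symm ▸ ha, rfl⟩, fun hc => ?_⟩)
    have := le2 _ hc
    rw [Pi.add_apply, uab, hqb', add_unit_true_apply, add_unit_true_apply] at this
    omega
  have mb : r + unit (b, false) ∈ S₃ := by
    rw [eb]
    refine Finset.mem_symmDiff.2 (.inl ⟨Finset.mem_symmDiff.2 (.inr
      ⟨mem_bd.2 ⟨(b, true), hhqa ▸ hb, rfl⟩, fun hc => ?_⟩), fun hc => ?_⟩)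
    · have := bd_apply_le hc a
      rw [Pi.add_apply, uba] at this
      omega
    · have := bd_apply_le hc a
      rw [Pi.add_apply, uba] at this
      omega
  have hnn : ∀ (u : Fin d × Bool) i, u ≠ (i, false) → 0 ≤ unit u i := by
    rintro ⟨i, e⟩ j hu
    rw [unit_apply]
    by_cases hi : j = i
    · subst hi
      cases e
      · exact absurd rfl hu
      · simp
    · simp [hi]
  have hsmall : ∀ v : Fin d × Bool, v ≠ (a, false) → v ≠ (b, false) → r + unit v ∉ S₃ := by
    intro v hva hvb hc
    have h1 := hnn v a hva
    have h2 := hnn v b hvb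
    have := le3 _ hc
    rw [Pi.add_apply, Pi.add_apply] at this
    omega
  have hfit : Fits S₃ r := by
    intro g c hc hcg e he heg
    obtain ⟨v, w, hv, hw, hvw, rfl, rfl⟩ := exists_of_mem_bd he heg
    have hfaces := facesAt_bd hv hw hvw rfl
    have key : ∀ u : Fin d × Bool, u = v ∨ u = w → u = (a, false) ∨ u = (b, false) →
        ∃ f ∈ S₃, f ∈ bd r ∧ Neighbours f (r + unit v + unit w) := by
      intro u hu hu'
      have : r + unit u ∈ facesAt (bd r) (r + unit v + unit w) := by
        rw [hfaces]; rcases hu with rfl | rfl <;> simp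
      refine ⟨_, ?_, mem_facesAt.1 this⟩
      rcases hu' with rfl | rfl
      · exact ma
      · exact mb
    by_cases hva : v = (a, false) ∨ v = (b, false)
    · exact key v (.inl rfl) hva
    by_cases hwa : w = (a, false) ∨ w = (b, false)
    · exact key w (.inr rfl) hwa
    exfalso
    rw [not_or] at hva hwa
    have h1 := hnn v a hva.1
    have h2 := hnn v b hva.2
    have h3 := hnn w a hwa.1
    have h4 := hnn w b hwa.2
    rcases le3 c hc with hl | hl
    · have := neighbours_le_of_le (by grind) hl hcg
      rw [Pi.add_apply, Pi.add_apply] at this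
      omega
    · have := neighbours_le_of_le (by grind) hl hcg
      rw [Pi.add_apply, Pi.add_apply] at this
      omega
  refine ⟨_, h3.symmDiff_bd hrcube hfit hra ma (hsmall _ (by simp) (by simp)), ?_⟩
  have hne : r + unit (a, false) ≠ r + unit (b, false) := fun h =>
    hab (congrArg Prod.fst (unit_injective (add_left_cancel h)))
  have hint : S₃ ∩ bd r = {r + unit (a, false), r + unit (b, false)} := by
    ext c
    rw [Finset.mem_inter, Finset.mem_insert, Finset.mem_singleton]
    constructor
    · rintro ⟨hc, hcr⟩
      obtain ⟨v, hv, rfl⟩ := mem_bd.1 hcr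
      by_contra hcon
      rw [not_or] at hcon
      exact hsmall v (fun h => hcon.1 (by rw [h])) (fun h => hcon.2 (by rw [h])) hc
    · rintro (rfl | rfl)
      · exact ⟨ma, mem_bd.2 ⟨(a, false), hra, rfl⟩⟩
      · exact ⟨mb, mem_bd.2 ⟨(b, false), hrb, rfl⟩⟩
  have := card_symmDiff_add S₃ (bd r)
  rw [hint, Finset.card_pair hne, card_bd, hrcube, n3, n2, card_bd, hq] at this
  omega

/-! ### Large even hyperareas, and the limit through them -/

lemma countClosedSAM_pos_iff {n : ℕ} :
    0 < countClosedSAM d k n ↔ ∃ S : Finset (Cell d), IsClosedSAM k S ∧ S.card = n := by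
  obtain ⟨C, hC⟩ := exists_countClosedSAM_le d k
  rw [countClosedSAM, Set.ncard_pos (hC n).1, Set.image_nonempty]
  rfl

/-- In terms of half the hyperarea, one cube has `k + 1`, attaching a cube adds `k`, and joining a
block adds `5 * k - 1`, which is `-1` modulo `k`. At most `k` blocks thus reach any residue, and
cubes do the rest. -/
lemma countClosedSAM_two_mul_pos (hk : 1 ≤ k) (hkd : k < d) {m : ℕ}
    (hm : k + 1 + k * (5 * k - 1) ≤ m) : 0 < countClosedSAM d k (2 * m) := by
  set x : Fin d := ⟨0, by omega⟩
  have base : 0 < countClosedSAM d k (2 * (k + 1)) := by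
    obtain ⟨q, hq, -⟩ := exists_isCube_mem_halfInt (k := k + 1) (by omega) hkd x
    exact countClosedSAM_pos_iff.2 ⟨bd q, isClosedSAM_bd hk hq, by rw [card_bd, hq]⟩
  have step : ∀ m j, 0 < countClosedSAM d k (2 * m) →
      0 < countClosedSAM d k (2 * (m + j * k)) := by
    intro m j h
    induction j with
    | zero => simpa using h
    | succ j ih =>
      obtain ⟨S, hS, hn⟩ := countClosedSAM_pos_iff.1 ih
      obtain ⟨-, h2, h3⟩ := isClosedSAM_iff.1 hS
      obtain ⟨s, hs⟩ := h3.exists_cap h2.1 x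
      obtain ⟨h4, h5⟩ := hs.isClosedSAM hS
      exact countClosedSAM_pos_iff.2 ⟨_, h4, by rw [h5, hn]; ring⟩
  have block : ∀ m j, 0 < countClosedSAM d k (2 * m) →
      0 < countClosedSAM d k (2 * (m + j * (5 * k - 1))) := by
    intro m j h
    induction j with
    | zero => simpa using h
    | succ j ih =>
      have h8 : 0 < countClosedSAM d k (8 * k) :=
        countClosedSAM_pos_iff.2 (exists_isClosedSAM_block hk hkd)
      have := (Nat.mul_pos ih h8).trans_le (countClosedSAM_mul_le hk x _ _)
      have := Nat.pos_of_mul_pos_left this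
      rwa [show 2 * (m + j * (5 * k - 1)) + 8 * k + 2 * k - 2 =
        2 * (m + (j + 1) * (5 * k - 1)) by rw [add_mul, one_mul]; omega] at this
  obtain ⟨t, rfl⟩ := Nat.exists_eq_add_of_le (show k + 1 ≤ m by omega)
  have ht : k * (5 * k - 1) ≤ t := by omega
  have hr : t % k < k := Nat.mod_lt _ hk
  have hle : (k - t % k) * (5 * k - 1) ≤ k * (5 * k - 1) := Nat.mul_le_mul_right _ (Nat.sub_le _ _)
  -- Modulo `k` the first product is `-(k - t % k)`, that is, `t`.
  have hj : ∃ j, t = (k - t % k) * (5 * k - 1) + j * k := by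
    have hdvd : k ∣ t - (k - t % k) * (5 * k - 1) := by
      rw [← Int.natCast_dvd_natCast, Nat.cast_sub (hle.trans ht), Nat.cast_mul,
        Nat.cast_sub hr.le, Nat.cast_sub (by omega : 1 ≤ 5 * k)]
      have e : (t : ℤ) = k * (t / k : ℕ) + (t % k : ℕ) := by
        exact_mod_cast (Nat.div_add_mod t k).symm
      push_cast at e ⊢
      refine ⟨(t : ℤ) / k + 1 - 5 * (k - (t : ℤ) % k), ?_⟩
      linear_combination e
    obtain ⟨j, hj⟩ := hdvd
    exact ⟨j, by rw [mul_comm j, ← hj]; omega⟩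
  obtain ⟨j, hj⟩ := hj
  rw [hj, ← add_assoc]
  exact step _ _ (block _ _ base)

/-- A closed manifold has a cap perpendicular to `x`, but a `d`-cube extends in all directions. -/
lemma countClosedSAM_self (hd : 1 ≤ d) (n : ℕ) : countClosedSAM d d n = 0 := by
  by_contra h
  obtain ⟨S, hS, -⟩ := countClosedSAM_pos_iff.1 (Nat.pos_of_ne_zero h)
  obtain ⟨h1, h2, h3⟩ := isClosedSAM_iff.1 hS
  obtain ⟨s, hs⟩ := h3.exists_cap h2.1 ⟨0, hd⟩
  have : halfInt s = Finset.univ := by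
    rw [← Finset.card_eq_iff_eq_univ, Fintype.card_fin]
    exact h1 s hs.mem
  exact hs.half (by rw [this]; simp)

lemma tendsto_even_of_tendsto_two_mul {c : ℕ → ℕ} {μ : ℝ}
    (h : Tendsto (fun m : ℕ => (c (2 * m) : ℝ) ^ ((1 : ℝ) / m)) atTop (𝓝 μ)) :
    Tendsto (fun n : ℕ => (c n : ℝ) ^ ((1 : ℝ) / n)) (atTop ⊓ 𝓟 {n : ℕ | Even n})
      (𝓝 (μ ^ ((1 : ℝ) / 2))) := by
  have h1 : Tendsto (fun n : ℕ => n / 2) (atTop ⊓ 𝓟 {n : ℕ | Even n}) atTop :=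
    (Nat.tendsto_div_const_atTop two_ne_zero).mono_left inf_le_left
  refine ((h.comp h1).rpow_const (.inr (by norm_num))).congr' ?_
  rw [EventuallyEq, eventually_inf_principal]
  refine Eventually.of_forall fun n hn => ?_
  obtain ⟨m, rfl⟩ := even_iff_two_dvd.1 hn
  simp only [Function.comp, Nat.mul_div_cancel_left m two_pos]
  rw [← Real.rpow_mul (Nat.cast_nonneg _)]
  congr 1
  push_cast
  rw [div_mul_div_comm, one_mul, mul_comm]

theorem exists_growth_countClosedSAM (hk : 1 ≤ k) (hkd : k ≤ d) :
    ∃ μ : ℝ, Tendsto (fun n : ℕ => (countClosedSAM d k n : ℝ) ^ ((1 : ℝ) / n))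
      (atTop ⊓ 𝓟 {n : ℕ | Even n}) (𝓝 μ) := by
  obtain ⟨μ, hμ⟩ : ∃ μ : ℝ, Tendsto (fun m : ℕ => (countClosedSAM d k (2 * m) : ℝ) ^ ((1 : ℝ) / m))
      atTop (𝓝 μ) := by
    rcases hkd.eq_or_lt with rfl | hlt
    · refine ⟨0, tendsto_const_nhds.congr' ?_⟩
      filter_upwards [eventually_gt_atTop 0] with m hm
      rw [countClosedSAM_self hk, Nat.cast_zero, Real.zero_rpow (by positivity)]
    · obtain ⟨C, hC⟩ := exists_countClosedSAM_le d k
      refine exists_tendsto_rpow_of_supermul (a := fun m => countClosedSAM d k (2 * m))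
        (K := Fintype.card (Equiv.Perm (Fin d))) (p := k - 1) (N := k + 1 + k * (5 * k - 1))
        (C := C ^ 2) (fun i j => ?_) (fun n hn => countClosedSAM_two_mul_pos hk hlt hn) fun n => ?_
      · have := countClosedSAM_mul_le (k := k) hk (⟨0, by omega⟩ : Fin d) (2 * i) (2 * j)
        rwa [show 2 * i + 2 * j + 2 * k - 2 = 2 * (i + j + (k - 1)) by omega] at this
      · refine (hC (2 * n)).2.trans ?_
        rw [← pow_mul]
        rcases C.eq_zero_or_pos with rfl | hpos
        · rw [zero_pow (by omega), zero_pow (by omega)]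
        · exact Nat.pow_le_pow_right hpos (by omega)
  exact ⟨_, tendsto_even_of_tendsto_two_mul hμ⟩


/-! ### Manifolds of dimension one and walks -/

/-- The edges `e i`, for `o ≤ i < m`, are distinct, and `e i` joins the vertices `v i` and
`v (i + 1)`. -/
structure Walk (v e : ℤ → Cell d) (o m : ℤ) : Prop where
  cube : ∀ i, o ≤ i → i < m → IsCube 1 (e i)
  left : ∀ i, o ≤ i → i < m → Neighbours (e i) (v i)
  right : ∀ i, o ≤ i → i < m → Neighbours (e i) (v (i + 1))
  ne : ∀ i, o ≤ i → i < m → v i ≠ v (i + 1)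
  inj : ∀ i j, o ≤ i → i < m → o ≤ j → j < m → e i = e j → i = j

/-- Consecutive edges of a walk are connected at their common vertex. -/
def walkConn (v e : ℤ → Cell d) (o m : ℤ) (g a b : Cell d) : Prop :=
  ∃ i, o ≤ i ∧ i + 1 < m ∧ g = v (i + 1) ∧ pairRel (e i) (e (i + 1)) a b

/-- The linked faces given by a walk. -/
noncomputable def walkLink (v e : ℤ → Cell d) (o m : ℤ) : LinkedFaces d :=
  ⟨(Finset.Ico o m).image e, walkConn v e o m⟩

section Walk

variable {v e : ℤ → Cell d} {o m : ℤ}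

lemma mem_walkLink {a : Cell d} : a ∈ (walkLink v e o m).faces ↔ ∃ i, o ≤ i ∧ i < m ∧ e i = a := by
  simp [walkLink, and_assoc]

lemma walkConn_symm {g a b : Cell d} (h : walkConn v e o m g a b) : walkConn v e o m g b a :=
  let ⟨i, h1, h2, h3, h4⟩ := h; ⟨i, h1, h2, h3, h4.symm.imp (fun h => ⟨h.2, h.1⟩)
    fun h => ⟨h.2, h.1⟩⟩

lemma walkConn_mono {o' m' : ℤ} (ho : o ≤ o') (hm : m' ≤ m) {g a b : Cell d}
    (h : walkConn v e o' m' g a b) : walkConn v e o m g a b :=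
  let ⟨i, h1, h2, h3⟩ := h; ⟨i, by omega, by omega, h3⟩

namespace Walk

lemma mono (h : Walk v e o m) {o' m' : ℤ} (ho : o ≤ o') (hm : m' ≤ m) : Walk v e o' m' where
  cube i h1 h2 := h.cube i (by omega) (by omega)
  left i h1 h2 := h.left i (by omega) (by omega)
  right i h1 h2 := h.right i (by omega) (by omega)
  ne i h1 h2 := h.ne i (by omega) (by omega)
  inj i j h1 h2 h3 h4 := h.inj i j (by omega) (by omega) (by omega) (by omega)

lemma neighbours_iff (h : Walk v e o m) {i : ℤ} (h1 : o ≤ i) (h2 : i < m) {g : Cell d} :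
    Neighbours (e i) g ↔ g = v i ∨ g = v (i + 1) := by
  constructor
  · intro hg
    have hcard : (bd (e i)).card = 2 := by rw [card_bd, h.cube i h1 h2]
    have hsub : ({v i, v (i + 1)} : Finset (Cell d)) ⊆ bd (e i) := by
      intro c hc
      rw [Finset.mem_insert, Finset.mem_singleton] at hc
      rw [mem_bd_iff_neighbours]
      rcases hc with rfl | rfl
      · exact h.left i h1 h2
      · exact h.right i h1 h2
    have heq := Finset.eq_of_subset_of_card_le hsub (by
      rw [hcard, Finset.card_pair (h.ne i h1 h2)])
    have := mem_bd_iff_neighbours.2 hg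
    rw [← heq, Finset.mem_insert, Finset.mem_singleton] at this
    exact this
  · rintro (rfl | rfl)
    · exact h.left i h1 h2
    · exact h.right i h1 h2

lemma conn_iff (h : Walk v e o m) {i : ℤ} (h1 : o ≤ i) (h2 : i < m) {g b : Cell d} :
    walkConn v e o m g (e i) b ↔ (i + 1 < m ∧ g = v (i + 1) ∧ b = e (i + 1)) ∨
      (o < i ∧ g = v i ∧ b = e (i - 1)) := by
  constructor
  · rintro ⟨j, h3, h4, h5, ⟨h6, h7⟩ | ⟨h6, h7⟩⟩
    · obtain rfl := h.inj i j h1 h2 h3 (by omega) h6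
      exact .inl ⟨h4, h5, h7⟩
    · obtain rfl := h.inj i (j + 1) h1 h2 (by omega) h4 h6
      exact .inr ⟨by omega, h5, by rw [h7, add_sub_cancel_right]⟩
  · rintro (⟨h3, h4, h5⟩ | ⟨h3, h4, h5⟩)
    · exact ⟨i, h1, h3, h4, .inl ⟨rfl, h5⟩⟩
    · exact ⟨i - 1, by omega, by omega, by rw [h4, sub_add_cancel],
        .inr ⟨by rw [sub_add_cancel], h5⟩⟩

lemma conn_unique (h : Walk v e o m) {g a b c : Cell d} (hb : walkConn v e o m g a b)
    (hc : walkConn v e o m g a c) : b = c := by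
  have : ∃ i, o ≤ i ∧ i < m ∧ a = e i := by
    obtain ⟨i, h1, h2, -, ⟨h3, -⟩ | ⟨h3, -⟩⟩ := hb
    · exact ⟨i, h1, by omega, h3⟩
    · exact ⟨i + 1, by omega, h2, h3⟩
  obtain ⟨i, h1, h2, rfl⟩ := this
  have hne := h.ne i h1 h2
  rw [h.conn_iff h1 h2] at hb hc
  rcases hb with ⟨-, hb, rfl⟩ | ⟨-, hb, rfl⟩ <;> rcases hc with ⟨-, hc, rfl⟩ | ⟨-, hc, rfl⟩
  · rfl
  · exact absurd (hc.symm.trans hb) hne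
  · exact absurd (hb.symm.trans hc) hne
  · rfl

lemma supported (h : Walk v e o m) : (walkLink v e o m).Supported := by
  have key : ∀ i, o ≤ i → i + 1 < m → e i ∈ facesAt (walkLink v e o m).faces (v (i + 1)) ∧
      e (i + 1) ∈ facesAt (walkLink v e o m).faces (v (i + 1)) ∧ e i ≠ e (i + 1) := by
    intro i h1 h2
    refine ⟨mem_facesAt.2 ⟨mem_walkLink.2 ⟨i, h1, by omega, rfl⟩, h.right i h1 (by omega)⟩,
      mem_facesAt.2 ⟨mem_walkLink.2 ⟨i + 1, by omega, h2, rfl⟩, h.left _ (by omega) h2⟩,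
      fun he => ?_⟩
    have := h.inj _ _ h1 (by omega) (by omega) h2 he
    omega
  rintro g a b ⟨i, h1, h2, rfl, ⟨rfl, rfl⟩ | ⟨rfl, rfl⟩⟩
  · exact key i h1 h2
  · obtain ⟨h3, h4, h5⟩ := key i h1 h2
    exact ⟨h4, h3, h5.symm⟩

lemma connectedBy (v e : ℤ → Cell d) {o m : ℤ} (hom : o < m) :
    ConnectedBy (walkLink v e o m).faces fun a b => ∃ g, (walkLink v e o m).conn g a b := by
  rw [connectedBy_iff_coloring fun a b ⟨g, hg⟩ => ⟨g, walkConn_symm hg⟩]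
  refine ⟨⟨e o, mem_walkLink.2 ⟨o, le_rfl, hom, rfl⟩⟩, fun p hp => ?_⟩
  have key : ∀ i, o ≤ i → (i < m → (p (e i) ↔ p (e o))) := by
    intro i hi
    induction i, hi using Int.leInduction with
    | base => exact fun _ => Iff.rfl
    | succ i hi ih =>
      intro hm
      rw [← ih (by omega)]
      exact hp _ (mem_walkLink.2 ⟨_, by omega, hm, rfl⟩) _
        (mem_walkLink.2 ⟨i, hi, by omega, rfl⟩)
        ⟨v (i + 1), i, hi, hm, rfl, .inr ⟨rfl, rfl⟩⟩
  intro a ha b hb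
  obtain ⟨i, h1, h2, rfl⟩ := mem_walkLink.1 ha
  obtain ⟨j, h3, h4, rfl⟩ := mem_walkLink.1 hb
  exact (key i h1 h2).trans (key j h3 h4).symm

lemma card_walkLink (h : Walk v e o m) : ((walkLink v e o m).faces.card : ℤ) = max (m - o) 0 := by
  rw [walkLink, Finset.card_image_of_injOn, Int.card_Ico, Int.toNat_eq_max]
  intro i hi j hj hij
  simp only [Finset.coe_Ico, Set.mem_Ico] at hi hj
  exact h.inj i j hi.1 hi.2 hj.1 hj.2 hij

/-- A face of the walk that is not connected at one of its vertices is the first or the last. -/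
lemma eq_of_lone (h : Walk v e o m) {i : ℤ} (h1 : o ≤ i) (h2 : i < m) {g : Cell d}
    (hg : Neighbours (e i) g) (hl : ∀ b, ¬ walkConn v e o m g (e i) b) :
    (i = o ∧ g = v o) ∨ (i = m - 1 ∧ g = v m) := by
  rcases (h.neighbours_iff h1 h2).1 hg with rfl | rfl
  · left
    by_contra hi
    refine hl _ ((h.conn_iff h1 h2).2 (.inr ⟨?_, rfl, rfl⟩))
    by_contra hoi
    obtain rfl : i = o := by omega
    exact hi ⟨rfl, rfl⟩
  · right
    by_contra hi
    refine hl _ ((h.conn_iff h1 h2).2 (.inl ⟨?_, rfl, rfl⟩))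
    by_contra hoi
    obtain rfl : i = m - 1 := by omega
    exact hi ⟨rfl, by rw [sub_add_cancel]⟩

lemma lone_first (h : Walk v e o m) (hom : o < m) (b : Cell d) :
    ¬ walkConn v e o m (v o) (e o) b := by
  rw [h.conn_iff le_rfl hom]
  rintro (⟨-, h1, -⟩ | ⟨h1, -⟩)
  · exact h.ne o le_rfl hom h1
  · omega

lemma lone_last (h : Walk v e o m) (hom : o < m) (b : Cell d) :
    ¬ walkConn v e o m (v m) (e (m - 1)) b := by
  have h2 := h.ne (m - 1) (by omega) (by omega)
  rw [sub_add_cancel] at h2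
  rw [h.conn_iff (by omega) (by omega)]
  rintro (⟨h1, -⟩ | ⟨-, h1, -⟩)
  · omega
  · exact h2 h1.symm

/-- The second vertex of an edge is determined by the first and the edge. -/
lemma next (h : Walk v e o m) {i : ℤ} (h1 : o ≤ i) (h2 : i < m) {w : Fin d × Bool}
    (hw : e i = v i + unit w) : v (i + 1) = v i + unit w + unit w := by
  obtain ⟨w', hw', e'⟩ := RestrictedManifold.neighbours_iff.1 (h.right i h1 h2)
  obtain ⟨u, hu, hu'⟩ := RestrictedManifold.neighbours_iff.1 (h.left i h1 h2)
  have huw : unit w + unit u = (0 : Cell d) := by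
    rw [hw, add_assoc] at hu'
    exact left_eq_add.1 hu'
  have hu2 : u = (w.1, !w.2) := by
    apply unit_injective
    rw [← neg_unit]
    exact eq_neg_of_add_eq_zero_right huw
  obtain ⟨j, hj⟩ := Finset.card_eq_one.1 (h.cube i h1 h2)
  rw [hj, Finset.mem_singleton] at hw' hu
  have hww : w'.1 = w.1 := by rw [hw', ← hu, hu2]
  have : w' = w := by
    by_contra hne
    have hwu : w' = u := by
      rw [hu2]
      refine Prod.ext hww ?_
      obtain ⟨a, b⟩ := w
      obtain ⟨a', b'⟩ := w'
      obtain rfl : a' = a := hww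
      cases b <;> cases b' <;> first | rfl | exact absurd rfl hne
    rw [hwu, ← hu'] at e'
    exact h.ne i h1 h2 e'.symm
  rw [e', this, hw]

lemma halfInt_vertex (h : Walk v e o m) {i : ℤ} (h1 : o ≤ i) (h2 : i < m) :
    halfInt (v i) = ∅ := by
  obtain ⟨w, hw, e'⟩ := RestrictedManifold.neighbours_iff.1 (h.left i h1 h2)
  rw [e', halfInt_add_unit hw, ← Finset.card_eq_zero, Finset.card_erase_of_mem hw,
    h.cube i h1 h2]

lemma exists_step (h : Walk v e o m) {i : ℤ} (h1 : o ≤ i) (h2 : i < m) :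
    ∃ w, e i = v i + unit w :=
  let ⟨w, _, hw⟩ := neighbours_iff'.1 (h.left i h1 h2); ⟨w, hw⟩

end Walk

end Walk

/-! ### Walks subject to the local conditions -/

lemma PairsOsculate.mono {g : Cell d} {r r' : Cell d → Cell d → Prop} (h : PairsOsculate g r')
    (hr : ∀ a b, r a b → r' a b) : PairsOsculate g r :=
  fun f₁ f₂ f₃ f₄ h12 h34 => h f₁ f₂ f₃ f₄ (hr _ _ h12) (hr _ _ h34)

/-- Exchanging partners is an involution without fixed points, so the paired faces are even in
number. With at most one lone face, parity decides whether there is one. -/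
lemma isPairing_of_lone {F : Finset (Cell d)} {r : Cell d → Cell d → Prop}
    (hsupp : ∀ a b, r a b → a ∈ F ∧ b ∈ F ∧ a ≠ b) (hsymm : ∀ a b, r a b → r b a)
    (huniq : ∀ a b c, r a b → r a c → b = c)
    (hlone : ∀ a ∈ F, ∀ b ∈ F, (∀ c, ¬ r a c) → (∀ c, ¬ r b c) → a = b) : IsPairing F r := by
  classical
  have heven : Even (F.filter fun a => ∃ b, r a b).card := by
    set σ : Cell d → Cell d := fun a => if h : ∃ b, r a b then h.choose else a
    have hσ : ∀ a, (∃ b, r a b) → r a (σ a) := fun a h => by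
      simp only [σ, dif_pos h]; exact h.choose_spec
    refine even_card_of_involution σ (fun a ha => ?_) (fun a ha => ?_) fun a ha => ?_
    all_goals have h1 := hσ a (Finset.mem_filter.1 ha).2
    · exact Finset.mem_filter.2 ⟨(hsupp _ _ h1).2.1, a, hsymm _ _ h1⟩
    · exact (hsupp _ _ h1).2.2.symm
    · exact huniq _ _ _ (hσ _ ⟨a, hsymm _ _ h1⟩) (hsymm _ _ h1)
  refine ⟨hsupp, hsymm, huniq, fun hE a ha => ?_, fun hO => ?_⟩
  · by_contra hn
    have hn' : ∀ b, ¬ r a b := fun b hb => hn ⟨b, hb⟩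
    have e : F.filter (fun a => ∃ b, r a b) = F.erase a := by
      ext c
      rw [Finset.mem_filter, Finset.mem_erase]
      constructor
      · rintro ⟨hc, b, hb⟩
        exact ⟨by rintro rfl; exact hn' b hb, hc⟩
      · rintro ⟨hca, hc⟩
        refine ⟨hc, ?_⟩
        by_contra hcn
        exact hca (hlone c hc a ha (fun b hb => hcn ⟨b, hb⟩) hn')
    rw [e] at heven
    have h2 := Finset.card_erase_add_one ha
    rw [← h2] at hE
    exact Nat.not_even_iff_odd.2 heven.add_one hE
  · have : ∃ a ∈ F, ∀ b, ¬ r a b := by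
      by_contra hcon
      push Not at hcon
      rw [Finset.filter_true_of_mem hcon] at heven
      exact Nat.not_even_iff_odd.2 hO heven
    obtain ⟨a, ha, hn⟩ := this
    exact ⟨a, ⟨ha, hn⟩, fun b hb => hlone b hb.1 a ha hb.2 hn⟩

/-- A walk that satisfies the local conditions. -/
structure OscWalk (sam : Prop) (v e : ℤ → Cell d) (o m : ℤ) : Prop extends Walk v e o m where
  osc : ∀ g, PairsOsculate g (walkConn v e o m g)
  card_le : sam → ∀ g, (facesAt (walkLink v e o m).faces g).card ≤ 2

lemma OscWalk.mono {sam : Prop} {v e : ℤ → Cell d} {o m o' m' : ℤ} (h : OscWalk sam v e o m)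
    (ho : o ≤ o') (hm : m' ≤ m) : OscWalk sam v e o' m' where
  toWalk := h.toWalk.mono ho hm
  osc g := (h.osc g).mono fun _ _ => walkConn_mono ho hm
  card_le hs g := (Finset.card_le_card fun a ha => by
    obtain ⟨ha, hg⟩ := mem_facesAt.1 ha
    obtain ⟨i, h1, h2, rfl⟩ := mem_walkLink.1 ha
    exact mem_facesAt.2 ⟨mem_walkLink.2 ⟨i, by omega, by omega, rfl⟩, hg⟩).trans (h.card_le hs g)

/-- The middle part of a walk, if it is not closed, is a manifold. -/
lemma OscWalk.inClass {sam : Prop} {v e : ℤ → Cell d} {o m o' m' : ℤ} (h : OscWalk sam v e o m)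
    (ho : o < o') (hom : o' < m') (hm : m' < m) (hne : v o' ≠ v m') :
    InClass 1 (locSOM sam) (walkLink v e o' m') := by
  have h' := h.mono ho.le hm.le
  have hpair : ∀ g, IsPairing (facesAt (walkLink v e o' m').faces g)
      (walkConn v e o' m' g) := by
    intro g
    refine isPairing_of_lone (fun a b hab => h'.supported g a b hab) (fun a b => walkConn_symm)
      (fun a b c => h'.conn_unique) fun a ha b hb hna hnb => ?_
    obtain ⟨ha, hag⟩ := mem_facesAt.1 ha
    obtain ⟨hb, hbg⟩ := mem_facesAt.1 hb
    obtain ⟨i, h1, h2, rfl⟩ := mem_walkLink.1 ha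
    obtain ⟨j, h3, h4, rfl⟩ := mem_walkLink.1 hb
    rcases h'.eq_of_lone h1 h2 hag hna with ⟨rfl, hg⟩ | ⟨rfl, hg⟩ <;>
      rcases h'.eq_of_lone h3 h4 hbg hnb with ⟨rfl, hg'⟩ | ⟨rfl, hg'⟩
    · rfl
    · exact absurd (hg.symm.trans hg') hne
    · exact absurd (hg'.symm.trans hg) hne
    · rfl
  refine ⟨fun f hf => ?_, h'.supported, fun g => ⟨hpair g, fun _ => ⟨fun _ => h'.osc g,
    fun hO => ?_⟩, fun hs => h'.card_le hs g⟩, Walk.connectedBy v e hom⟩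
  · obtain ⟨i, h1, h2, rfl⟩ := mem_walkLink.1 hf
    exact h'.cube i h1 h2
  -- The lone face is an end of the middle part, and the next edge of the longer walk beyond that
  -- end is the required free position: the longer walk osculates with this pair included.
  · obtain ⟨a, ⟨ha, hn⟩, -⟩ := (hpair g).2.2.2.2 hO
    refine ⟨a, ha, hn, ?_⟩
    obtain ⟨haF, hag⟩ := mem_facesAt.1 ha
    obtain ⟨i, h1, h2, rfl⟩ := mem_walkLink.1 haF
    have hnew : ∀ j, o ≤ j → j < m → (j < o' ∨ m' ≤ j) →
        e j ∉ facesAt (walkLink v e o' m').faces g := by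
      intro j h3 h4 h5 hj
      obtain ⟨l, h6, h7, h8⟩ := mem_walkLink.1 (mem_facesAt.1 hj).1
      have := h.inj _ _ (by omega) (by omega) h3 h4 h8
      omega
    rcases h'.eq_of_lone h1 h2 hag hn with ⟨rfl, rfl⟩ | ⟨rfl, rfl⟩
    · refine ⟨e (i - 1), hnew _ (by omega) (by omega) (.inl (by omega)), ?_,
        (h.osc _).mono fun a b hab => ?_⟩
      · have := h.right (i - 1) (by omega) (by omega)
        rwa [sub_add_cancel] at this
      · rcases hab with hab | hab | hab
        · exact walkConn_mono ho.le hm.le hab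
        · exact ⟨i - 1, by omega, by omega, by rw [sub_add_cancel],
            .inr ⟨by rw [sub_add_cancel]; exact hab.1, hab.2⟩⟩
        · exact ⟨i - 1, by omega, by omega, by rw [sub_add_cancel],
            .inl ⟨hab.1, by rw [sub_add_cancel]; exact hab.2⟩⟩
    · refine ⟨e m', hnew _ (by omega) (by omega) (.inr le_rfl), h.left _ (by omega) (by omega),
        (h.osc _).mono fun a b hab => ?_⟩
      rcases hab with hab | hab | hab
      · exact walkConn_mono ho.le hm.le hab
      · exact ⟨m' - 1, by omega, by omega, by rw [sub_add_cancel],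
          .inl ⟨hab.1, by rw [sub_add_cancel]; exact hab.2⟩⟩
      · exact ⟨m' - 1, by omega, by omega, by rw [sub_add_cancel],
          .inr ⟨by rw [sub_add_cancel]; exact hab.1, hab.2⟩⟩

/-- Not both of two successive parts of the same length are closed. -/
lemma Walk.ne_or_ne {v e : ℤ → Cell d} {o m : ℤ} (h : Walk v e o m) {i j : ℤ} (h1 : o ≤ i)
    (hij : i < j) (h2 : j < m) : v i ≠ v j ∨ v (i + 1) ≠ v (j + 1) := by
  by_contra hcon
  push Not at hcon
  obtain ⟨w, hw⟩ := h.exists_step h1 (by omega)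
  obtain ⟨u, hu⟩ := h.exists_step (by omega) h2
  have h3 := h.next h1 (by omega) hw
  have h4 := h.next (by omega) h2 hu
  -- If both parts closed up, then `e i` and `e j` would join the same two vertices and coincide.
  rw [hcon.1, hcon.2, h4, add_assoc, add_assoc, add_right_inj] at h3
  have h5 : (unit w : Cell d) = unit u := by
    ext l
    have := congrFun h3 l
    simp only [Pi.add_apply] at this
    omega
  have := h.inj i j h1 (by omega) (by omega) h2 (by rw [hw, hu, hcon.1, h5])
  omega


/-! ### Every manifold of dimension one is a walk, possibly closed up -/

/-- The linked faces given by a walk whose ends are connected if `b` holds. -/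
noncomputable def closedLink (v e : ℤ → Cell d) (o m : ℤ) (b : Bool) : LinkedFaces d :=
  ⟨(walkLink v e o m).faces, fun g x y => walkConn v e o m g x y ∨
    (b = true ∧ g = v o ∧ pairRel (e o) (e (m - 1)) x y)⟩

lemma pairRel_shift {t : Fin d → ℤ} {a b x y : Cell d} :
    pairRel (shift t a) (shift t b) (shift t x) (shift t y) ↔ pairRel a b x y := by
  simp only [pairRel, (shift_injective t).eq_iff]

section Shift

variable {v e v' e' : ℤ → Cell d} {o m c : ℤ} {t : Fin d → ℤ}

lemma faces_walkLink_shift (he : ∀ i, o ≤ i → i < m → e' (i + c) = shift t (e i)) :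
    (walkLink v' e' (o + c) (m + c)).faces = (walkLink v e o m).faces.image (shift t) := by
  ext a
  rw [mem_walkLink, Finset.mem_image]
  constructor
  · rintro ⟨i, h1, h2, rfl⟩
    refine ⟨e (i - c), mem_walkLink.2 ⟨i - c, by omega, by omega, rfl⟩, ?_⟩
    rw [← he _ (by omega) (by omega), sub_add_cancel]
  · rintro ⟨_, ha, rfl⟩
    obtain ⟨i, h1, h2, rfl⟩ := mem_walkLink.1 ha
    exact ⟨i + c, by omega, by omega, he i h1 h2⟩

lemma walkConn_shift (hv : ∀ i, o ≤ i → i ≤ m → v' (i + c) = shift t (v i))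
    (he : ∀ i, o ≤ i → i < m → e' (i + c) = shift t (e i)) (g a b : Cell d) :
    walkConn v' e' (o + c) (m + c) (shift t g) (shift t a) (shift t b) ↔
      walkConn v e o m g a b := by
  constructor
  · rintro ⟨i, h1, h2, h3, h4⟩
    refine ⟨i - c, by omega, by omega, shift_injective t ?_, ?_⟩
    · rw [h3, ← hv _ (by omega) (by omega)]; congr 1; ring
    · rwa [← pairRel_shift (t := t), ← he _ (by omega) (by omega), ← he _ (by omega) (by omega),
        sub_add_cancel, show i - c + 1 + c = i + 1 by ring]
  · rintro ⟨i, h1, h2, rfl, h4⟩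
    refine ⟨i + c, by omega, by omega, ?_, ?_⟩
    · rw [← hv _ (by omega) (by omega)]; congr 1; ring
    · rwa [show i + c + 1 = i + 1 + c by ring, he _ (by omega) (by omega),
        he _ (by omega) (by omega), pairRel_shift]

lemma closedLink_shift (hv : ∀ i, o ≤ i → i ≤ m → v' (i + c) = shift t (v i))
    (he : ∀ i, o ≤ i → i < m → e' (i + c) = shift t (e i)) (hom : o < m) (b : Bool) :
    linkedSetoid d (closedLink v e o m b) (closedLink v' e' (o + c) (m + c) b) := by
  refine ⟨t, faces_walkLink_shift (v := v) (v' := v') he, fun g x y => ?_⟩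
  simp only [closedLink]
  rw [walkConn_shift hv he, hv o le_rfl hom.le, he o le_rfl hom,
    show m + c - 1 = m - 1 + c by ring, he (m - 1) (by omega) (by omega), pairRel_shift,
    (shift_injective t).eq_iff]

end Shift

/-- Walks with the same steps are translates. -/
lemma Walk.shift_eq {v e v' e' : ℤ → Cell d} {o o' : ℤ} {n : ℕ} (h : Walk v e o (o + n))
    (h' : Walk v' e' o' (o' + n)) {w : Fin n → Fin d × Bool}
    (hw : ∀ i : Fin n, e (o + i) = v (o + i) + unit (w i))
    (hw' : ∀ i : Fin n, e' (o' + i) = v' (o' + i) + unit (w i)) {t : Fin d → ℤ}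
    (ht : shift t (v o) = v' o') :
    (∀ i, o ≤ i → i ≤ o + n → v' (i + (o' - o)) = shift t (v i)) ∧
      ∀ i, o ≤ i → i < o + n → e' (i + (o' - o)) = shift t (e i) := by
  have hstep : ∀ i, o ≤ i → i < o + n → ∃ u, e i = v i + unit u ∧
      e' (i + (o' - o)) = v' (i + (o' - o)) + unit u := by
    intro i h1 h2
    obtain ⟨j, rfl⟩ : ∃ j : ℕ, i = o + j := ⟨(i - o).toNat, by omega⟩
    refine ⟨w ⟨j, by omega⟩, hw ⟨j, by omega⟩, ?_⟩
    have := hw' ⟨j, by omega⟩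
    rwa [show o + (j : ℤ) + (o' - o) = o' + j by ring]
  have key : ∀ i, o ≤ i → (i ≤ o + n → v' (i + (o' - o)) = shift t (v i)) := by
    intro i hi
    induction i, hi using Int.leInduction with
    | base => intro _; rw [ht]; congr 1; ring
    | succ i hi ih =>
      intro hin
      obtain ⟨u, hu, hu'⟩ := hstep i hi (by omega)
      rw [show i + 1 + (o' - o) = i + (o' - o) + 1 by ring, h.next hi (by omega) hu,
        h'.next (by omega) (by omega) hu', ih (by omega), shift_add_right, shift_add_right]
  refine ⟨key, fun i h1 h2 => ?_⟩
  obtain ⟨u, hu, hu'⟩ := hstep i h1 h2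
  rw [hu', hu, key i h1 h2.le, shift_add_right]

/-- A walk along the connections of `M`. -/
structure Trace (M : LinkedFaces d) (v e : ℤ → Cell d) (o m : ℤ) : Prop extends Walk v e o m where
  mem : ∀ i, o ≤ i → i < m → e i ∈ M.faces
  conn : ∀ i, o ≤ i → i + 1 < m → M.conn (v (i + 1)) (e i) (e (i + 1))

namespace Trace

variable {M : LinkedFaces d} {v e : ℤ → Cell d} {o m : ℤ}

lemma reverse (h : Trace M v e o m) (hs : ∀ g a b, M.conn g a b → M.conn g b a) :
    Trace M (fun i => v (-i)) (fun i => e (-i - 1)) (-m) (-o) where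
  cube i h1 h2 := h.cube _ (by omega) (by omega)
  left i h1 h2 := by
    have := h.right (-i - 1) (by omega) (by omega)
    rwa [sub_add_cancel] at this
  right i h1 h2 := by
    have := h.left (-i - 1) (by omega) (by omega)
    rwa [show -(i + 1) = -i - 1 by ring]
  ne i h1 h2 := by
    have := h.ne (-i - 1) (by omega) (by omega)
    rw [sub_add_cancel] at this
    rw [show -(i + 1) = -i - 1 by ring]
    exact this.symm
  inj i j h1 h2 h3 h4 h5 := by
    have := h.inj _ _ (by omega) (by omega) (by omega) (by omega) h5
    omega
  mem i h1 h2 := h.mem _ (by omega) (by omega)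
  conn i h1 h2 := by
    have := h.conn (-(i + 1) - 1) (by omega) (by omega)
    rw [sub_add_cancel, show -(i + 1) = -i - 1 by ring] at this
    rw [show -(i + 1) = -i - 1 by ring]
    exact hs _ _ _ this

lemma extend (h : Trace M v e o m) (hM : M.Supported) (hcube : ∀ f ∈ M.faces, IsCube 1 f)
    {f : Cell d} (hom : o < m) (hf : M.conn (v m) (e (m - 1)) f)
    (hnew : ∀ i, o ≤ i → i < m → e i ≠ f) : ∃ v' e', Trace M v' e' o (m + 1) := by
  obtain ⟨-, hfF, -⟩ := hM _ _ _ hf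
  obtain ⟨hfM, hfv⟩ := mem_facesAt.1 hfF
  obtain ⟨w, hw, hfw⟩ := neighbours_iff'.1 hfv
  have hwf : w.1 ∈ halfInt f := by rw [hfw, halfInt_add_unit_insert hw]; simp
  have hv : ∀ i, i ≤ m → Function.update v (m + 1) (f + unit w) i = v i := fun i hi =>
    Function.update_of_ne (by omega) _ _
  have he : ∀ i, i < m → Function.update e m f i = e i := fun i hi =>
    Function.update_of_ne (by omega) _ _
  have hem : Function.update e m f m = f := Function.update_self ..
  have hvm : Function.update v (m + 1) (f + unit w) (m + 1) = f + unit w := Function.update_self ..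
  refine ⟨Function.update v (m + 1) (f + unit w), Function.update e m f, ⟨⟨fun i h1 h2 => ?_,
    fun i h1 h2 => ?_, fun i h1 h2 => ?_, fun i h1 h2 => ?_, fun i j h1 h2 h3 h4 h5 => ?_⟩,
    fun i h1 h2 => ?_, fun i h1 h2 => ?_⟩⟩
  · rcases (show i < m ∨ i = m by omega) with hi | rfl
    · rw [he i hi]; exact h.cube i h1 hi
    · rw [hem]; exact hcube f hfM
  · rcases (show i < m ∨ i = m by omega) with hi | rfl
    · rw [he i hi, hv i hi.le]; exact h.left i h1 hi
    · rw [hem, hv i le_rfl]; exact hfv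
  · rcases (show i < m ∨ i = m by omega) with hi | rfl
    · rw [he i hi, hv (i + 1) (by omega)]; exact h.right i h1 hi
    · rw [hem, hvm]; exact neighbours_add_unit hwf
  · rcases (show i < m ∨ i = m by omega) with hi | rfl
    · rw [hv i hi.le, hv (i + 1) (by omega)]; exact h.ne i h1 hi
    · rw [hv i le_rfl, hvm, hfw]
      intro e'
      have := congrFun e' w.1
      simp only [Pi.add_apply] at this
      rcases unit_self w with h | h <;> omega
  · rcases (show i < m ∨ i = m by omega) with hi | hi <;>
      rcases (show j < m ∨ j = m by omega) with hj | hj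
    · rw [he i hi, he j hj] at h5; exact h.inj i j h1 hi h3 hj h5
    · rw [he i hi, hj, hem] at h5; exact absurd h5 (hnew i h1 hi)
    · rw [he j hj, hi, hem] at h5; exact absurd h5.symm (hnew j h3 hj)
    · rw [hi, hj]
  · rcases (show i < m ∨ i = m by omega) with hi | rfl
    · rw [he i hi]; exact h.mem i h1 hi
    · rw [hem]; exact hfM
  · rcases (show i + 1 < m ∨ i = m - 1 by omega) with hi | rfl
    · rw [he i (by omega), he _ hi, hv _ hi.le]; exact h.conn i h1 hi
    · rw [he (m - 1) (by omega), sub_add_cancel, hem, hv m le_rfl]; exact hf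

lemma card_le (h : Trace M v e o m) : m - o ≤ M.faces.card := by
  have h1 := h.card_walkLink
  have h2 : (walkLink v e o m).faces.card ≤ M.faces.card := Finset.card_le_card fun a ha => by
    obtain ⟨i, h1, h2, rfl⟩ := mem_walkLink.1 ha
    exact h.mem i h1 h2
  omega

/-- A connection of `M` at a face of the trace either belongs to the trace, or it is at an end. -/
lemma conn_or (h : Trace M v e o m) (hM : ∀ g, IsPairing (facesAt M.faces g) (M.conn g)) {i : ℤ}
    (h1 : o ≤ i) (h2 : i < m) {g b : Cell d} (hb : M.conn g (e i) b) :
    walkConn v e o m g (e i) b ∨ (i = o ∧ g = v o) ∨ (i = m - 1 ∧ g = v m) := by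
  have hg := (mem_facesAt.1 ((hM g).1 _ _ hb).1).2
  by_cases hl : ∀ b, ¬ walkConn v e o m g (e i) b
  · exact .inr (h.eq_of_lone h1 h2 hg hl)
  · push Not at hl
    obtain ⟨c, hc⟩ := hl
    have : M.conn g (e i) c := by
      rcases (h.conn_iff h1 h2).1 hc with ⟨h3, rfl, rfl⟩ | ⟨h3, rfl, rfl⟩
      · exact h.conn i h1 h3
      · have := h.conn (i - 1) (by omega) (by omega)
        rw [sub_add_cancel] at this
        exact (hM _).2.1 _ _ this
    rw [(hM g).2.2.1 _ _ _ hb this]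
    exact .inl hc

end Trace

/-- While a face is missing, some connection leaves the trace. Since an edge has two vertices and at
most one partner at each, this happens at an end of the trace, which can be extended there; reversal
reduces the first end to the last. -/
lemma exists_trace_card {M : LinkedFaces d} (hcube : ∀ f ∈ M.faces, IsCube 1 f)
    (hM : ∀ g, IsPairing (facesAt M.faces g) (M.conn g))
    (hconn : ConnectedBy M.faces fun a b => ∃ g, M.conn g a b) :
    ∃ v e o, Trace M v e o (o + M.faces.card) := by
  have hsupp : M.Supported := fun g a b h => (hM g).1 a b h
  suffices H : ∀ (N : ℕ) (v e : ℤ → Cell d) (o m : ℤ), Trace M v e o m → o < m →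
      M.faces.card ≤ m - o + N → ∃ v e o, Trace M v e o (o + M.faces.card) by
    obtain ⟨f, hf⟩ := hconn.1
    obtain ⟨j, hj⟩ := Finset.card_eq_one.1 (hcube f hf)
    have hjf : j ∈ halfInt f := by rw [hj]; simp
    have e0 : ∀ i : ℤ, 0 ≤ i → i < 1 → i = 0 := fun i h1 h2 => by omega
    refine H M.faces.card (fun i => f + unit (j, decide (1 ≤ i))) (fun _ => f) 0 1
      ⟨⟨fun i _ _ => hcube f hf, fun i _ _ => neighbours_add_unit (v := (j, _)) hjf,
        fun i _ _ => neighbours_add_unit (v := (j, _)) hjf, fun i h1 h2 => ?_,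
        fun i j h1 h2 h3 h4 _ => by omega⟩, fun i _ _ => hf, fun i h1 h2 => by omega⟩ one_pos
      (by omega)
    rw [e0 i h1 h2]
    intro h
    have := unit_injective (add_left_cancel h)
    simp at this
  intro N
  induction N with
  | zero =>
    intro v e o m h hom hle
    have := h.card_le
    exact ⟨v, e, o, by rwa [show o + (M.faces.card : ℤ) = m by omega]⟩
  | succ N ih =>
    intro v e o m h hom hle
    by_cases hfull : ∀ f ∈ M.faces, ∃ i, o ≤ i ∧ i < m ∧ e i = f
    · have h1 : M.faces.card ≤ (walkLink v e o m).faces.card :=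
        Finset.card_le_card fun f hf => mem_walkLink.2 (hfull f hf)
      have h2 := h.card_walkLink
      exact ih v e o m h hom (by omega)
    push Not at hfull
    obtain ⟨f, hf, hnf⟩ := hfull
    obtain ⟨a, b, ⟨i, h1, h2, rfl⟩, hb, -, hbM, g, hg⟩ := exists_crossing
      (p := fun a => ∃ i, o ≤ i ∧ i < m ∧ e i = a)
      (hconn.2 (e o) (h.mem o le_rfl hom) f hf) ⟨o, le_rfl, hom, rfl⟩
      (fun ⟨i, h1, h2, h3⟩ => hnf i h1 h2 h3)
    have hnew : ∀ i, o ≤ i → i < m → e i ≠ b := fun i h1 h2 h3 => hb ⟨i, h1, h2, h3⟩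
    rcases h.conn_or hM h1 h2 hg with hc | ⟨rfl, rfl⟩ | ⟨rfl, rfl⟩
    · rcases (h.conn_iff h1 h2).1 hc with ⟨h3, -, rfl⟩ | ⟨h3, -, rfl⟩
      · exact absurd rfl (hnew _ (by omega) h3)
      · exact absurd rfl (hnew _ (by omega) (by omega))
    · obtain ⟨v', e', h'⟩ := (h.reverse fun g => (hM g).2.1).extend hsupp hcube (f := b)
        (by omega) (by simpa using hg) fun j h3 h4 => hnew _ (by omega) (by omega)
      exact ih v' e' _ _ h' (by omega) (by push_cast at hle; omega)
    · obtain ⟨v', e', h'⟩ := h.extend hsupp hcube hom hg hnew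
      exact ih v' e' _ _ h' (by omega) (by push_cast at hle; omega)

/-- Once the trace covers all faces, any connection outside it must be at an end for both of its
faces, so it can only join the two ends. -/
lemma Trace.eq_closedLink {M : LinkedFaces d} {v e : ℤ → Cell d} {o m : ℤ} (h : Trace M v e o m)
    (hM : ∀ g, IsPairing (facesAt M.faces g) (M.conn g)) (hcard : M.faces.card ≤ m - o) :
    ∃ b, M = closedLink v e o m b := by
  classical
  have hfaces : (walkLink v e o m).faces = M.faces := by
    refine Finset.eq_of_subset_of_card_le (fun a ha => ?_) ?_
    · obtain ⟨i, h1, h2, rfl⟩ := mem_walkLink.1 ha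
      exact h.mem i h1 h2
    · have := h.card_walkLink
      omega
  have hsymm : ∀ g a b, M.conn g a b → M.conn g b a := fun g => (hM g).2.1
  refine ⟨decide (M.conn (v o) (e o) (e (m - 1))), ?_⟩
  ext1
  · exact hfaces.symm
  ext g x y
  simp only [closedLink, decide_eq_true_eq]
  constructor
  · intro hxy
    obtain ⟨hx, hy, hne⟩ := (hM g).1 _ _ hxy
    have hx' := (mem_facesAt.1 hx).1
    have hy' := (mem_facesAt.1 hy).1
    rw [← hfaces] at hx' hy'
    obtain ⟨i, h1, h2, rfl⟩ := mem_walkLink.1 hx'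
    obtain ⟨j, h3, h4, rfl⟩ := mem_walkLink.1 hy'
    rcases h.conn_or hM h1 h2 hxy with hc | hi
    · exact .inl hc
    rcases h.conn_or hM h3 h4 (hsymm _ _ _ hxy) with hc | hj
    · exact .inl (walkConn_symm hc)
    right
    rcases hi with ⟨rfl, hg⟩ | ⟨rfl, hg⟩ <;> rcases hj with ⟨rfl, hg'⟩ | ⟨rfl, hg'⟩
    · exact absurd rfl hne
    · exact ⟨hg ▸ hxy, hg, .inl ⟨rfl, rfl⟩⟩
    · exact ⟨hg' ▸ hsymm _ _ _ hxy, hg', .inr ⟨rfl, rfl⟩⟩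
    · exact absurd rfl hne
  · rintro (⟨i, h1, h2, rfl, ⟨rfl, rfl⟩ | ⟨rfl, rfl⟩⟩ | ⟨hc, rfl, ⟨rfl, rfl⟩ | ⟨rfl, rfl⟩⟩)
    · exact h.conn i h1 h2
    · exact hsymm _ _ _ (h.conn i h1 h2)
    · exact hc
    · exact hsymm _ _ _ hc

lemma pairsOsculate_of_locSOM {sam : Prop} {g : Cell d} {F : Finset (Cell d)}
    {r : Cell d → Cell d → Prop} (h : locSOM sam g F r) : PairsOsculate g r := by
  obtain ⟨h1, h2, -⟩ := h
  by_cases hc : 2 < F.card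
  · rcases Nat.even_or_odd F.card with hE | hO
    · exact (h2 hc).1 hE
    · obtain ⟨a, -, -, x, -, -, hp⟩ := (h2 hc).2 hO
      exact hp.mono fun _ _ => .inl
  · intro f₁ f₂ f₃ f₄ h12 h34 hne
    refine absurd ?_ hne
    obtain ⟨m1, m2, n12⟩ := h1.1 _ _ h12
    obtain ⟨m3, m4, n34⟩ := h1.1 _ _ h34
    have e12 : ({f₁, f₂} : Finset (Cell d)) = F :=
      Finset.eq_of_subset_of_card_le (by simp [Finset.insert_subset_iff, m1, m2])
        (by rw [Finset.card_pair n12]; omega)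
    rw [← e12, Finset.mem_insert, Finset.mem_singleton] at m3 m4
    rw [Sym2.eq_iff]
    grind

/-! ### Counting walks by their step sequences -/

/-- The step sequences of the walks with `n` edges. -/
def walkWords (d : ℕ) (sam : Prop) (n : ℕ) : Set (Fin n → Fin d × Bool) :=
  {w | ∃ v e o, OscWalk sam v e o (o + n) ∧ ∀ i : Fin n, e (o + i) = v (o + i) + unit (w i)}

/-- An initial and a final piece of an osculating walk are again osculating walks. `OscWalk` has no
condition requiring a free position for a lone edge; this is what makes it hereditary. -/
lemma ncard_walkWords_add_le (sam : Prop) (i j : ℕ) :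
    (walkWords d sam (i + j)).ncard ≤ (walkWords d sam i).ncard * (walkWords d sam j).ncard := by
  rw [← Set.ncard_prod]
  refine Set.ncard_le_ncard_of_injOn
    (fun w => (fun l => w (Fin.castAdd j l), fun l => w (Fin.natAdd i l))) ?_ ?_ (Set.toFinite _)
  · rintro w ⟨v, e, o, h, hw⟩
    push_cast at h
    refine ⟨⟨v, e, o, h.mono le_rfl (by omega), fun l => ?_⟩,
      ⟨v, e, o + i, h.mono (by omega) (by omega), fun l => ?_⟩⟩
    · simpa using hw (Fin.castAdd j l)
    · simpa [add_assoc] using hw (Fin.natAdd i l)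
  · intro w _ w' _ h
    obtain ⟨h1, h2⟩ := Prod.mk.inj h
    funext l
    refine Fin.addCases (fun l => congrFun h1 l) (fun l => congrFun h2 l) l

lemma walkWords_zero_nonempty (sam : Prop) : (walkWords d sam 0).Nonempty := by
  refine ⟨Fin.elim0, fun _ => 0, fun _ => 0, 0, ⟨⟨?_, ?_, ?_, ?_, ?_⟩, fun g => ?_, fun _ g => ?_⟩,
    fun i => i.elim0⟩
  iterate 5 · intros; omega
  · rintro _ _ _ _ ⟨i, h1, h2, -⟩
    push_cast at h2
    omega
  · simp [facesAt, walkLink]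

/-- The step sequence fixes the walk up to translation; the factor 2 records whether its ends are
connected. -/
lemma classCount_le_walkWords (sam : Prop) (n : ℕ) :
    classCount (InClass (d := d) 1 (locSOM sam)) n ≤ 2 * (walkWords d sam n).ncard := by
  rw [← Fintype.card_bool]
  refine ncard_le_card_mul_ncard (Set.toFinite _) (fun q w b => 0 < n ∧ ∃ v e o,
    Walk v e o (o + n) ∧ (∀ i : Fin n, e (o + i) = v (o + i) + unit (w i)) ∧
    Quotient.mk (linkedSetoid d) (closedLink v e o (o + n) b) = q) ?_ ?_
  · rintro _ ⟨M, ⟨hM, rfl⟩, rfl⟩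
    have hp : ∀ g, IsPairing (facesAt M.faces g) (M.conn g) := fun g => (hM.loc g).1
    obtain ⟨v, e, o, h⟩ := exists_trace_card hM.cube hp hM.conn
    obtain ⟨b, hb⟩ := h.eq_closedLink hp (by omega)
    have hstep : ∀ i : Fin M.faces.card, ∃ w, e (o + i) = v (o + i) + unit w := fun i =>
      h.exists_step (by omega) (by omega)
    choose w hw using hstep
    refine ⟨w, ⟨v, e, o, ⟨h.toWalk, fun g => ?_, fun hs g => ?_⟩, hw⟩, b,
      Finset.card_pos.2 hM.conn.1, v, e, o, h.toWalk, hw, by rw [← hb]⟩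
    · refine (pairsOsculate_of_locSOM (hM.loc g)).mono fun x y hxy => ?_
      rw [hb]
      exact .inl hxy
    · have := (hM.loc g).2.2 hs
      rwa [hb] at this
  · rintro _ - _ - w - b ⟨hn, v, e, o, h, hw, rfl⟩ ⟨-, v', e', o', h', hw', rfl⟩
    obtain ⟨t, ht⟩ := exists_shift_eq_of_parity (r := v o) (r' := v' o') fun i => by
      rw [← mem_halfInt, ← mem_halfInt, h.halfInt_vertex le_rfl (by omega),
        h'.halfInt_vertex le_rfl (by omega)]
    obtain ⟨h1, h2⟩ := h.shift_eq h' hw hw' ht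
    have := closedLink_shift h1 h2 (by omega) b
    rw [show o + (o' - o) = o' by ring, show o + (n : ℤ) + (o' - o) = o' + n by ring] at this
    exact Quotient.sound this

/-- A walk can be recovered from its linked faces, its first step and the relative position of its
ends. -/
lemma Walk.eq_shift {v e v' e' : ℤ → Cell d} {o o' : ℤ} {n : ℕ} (h : Walk v e o (o + n))
    (h' : Walk v' e' o' (o' + n)) {t : Fin d → ℤ}
    (hf : (walkLink v' e' o' (o' + n)).faces = (walkLink v e o (o + n)).faces.image (shift t))
    (hc : ∀ g a b, walkConn v' e' o' (o' + n) (shift t g) (shift t a) (shift t b) ↔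
      walkConn v e o (o + n) g a b)
    (hend : ∀ l, e o l < e (o + n - 1) l ↔ e' o' l < e' (o' + n - 1) l)
    {w : Fin d × Bool} (hw : e o = v o + unit w) (hw' : e' o' = v' o' + unit w) :
    ∀ i : ℕ, i < n → v' (o' + i) = shift t (v (o + i)) ∧ e' (o' + i) = shift t (e (o + i)) := by
  intro i hi
  have hn : 0 < n := by omega
  have hlone : ∀ i', o' ≤ i' → i' < o' + n → ∀ g', Neighbours (e' i') g' →
      (∀ b, ¬ walkConn v' e' o' (o' + n) g' (e' i') b) →
      e' i' = shift t (e o) ∨ e' i' = shift t (e (o + n - 1)) := by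
    intro i' h1 h2 g' hg' hl
    have hm : e' i' ∈ (walkLink v' e' o' (o' + n)).faces := mem_walkLink.2 ⟨i', h1, h2, rfl⟩
    rw [hf, Finset.mem_image] at hm
    obtain ⟨a, ha, hae⟩ := hm
    obtain ⟨j, h3, h4, rfl⟩ := mem_walkLink.1 ha
    have hg : g' = shift t (shift (-t) g') := by
      have := shift_neg (-t) g'
      rw [neg_neg] at this
      exact this.symm
    rw [← hae, hg, neighbours_shift] at hg'
    rcases h.eq_of_lone h3 h4 hg' (fun b hb => hl (shift t b) (by
      rw [hg, ← hae]; exact (hc _ _ _).2 hb)) with ⟨rfl, -⟩ | ⟨rfl, -⟩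
    · exact .inl hae.symm
    · exact .inr hae.symm
  have hlast : Neighbours (e' (o' + n - 1)) (v' (o' + n)) := by
    have := h'.right (o' + n - 1) (by omega) (by omega)
    rwa [sub_add_cancel] at this
  have base : e' o' = shift t (e o) := by
    rcases hlone o' le_rfl (by omega) _ (h'.left o' le_rfl (by omega))
      (h'.lone_first (by omega)) with h1 | h1
    · exact h1
    -- If the translation exchanged the ends, `hend` would reverse every strict inequality between
    -- their coordinates, so the end edges would coincide.
    rcases hlone (o' + n - 1) (by omega) (by omega) _ hlast (h'.lone_last (by omega)) with h2 | h2
    · rw [h1]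
      congr 1
      ext l
      have h3 := hend l
      rw [h1, h2] at h3
      simp only [shift] at h3
      omega
    · have h3 := h'.inj _ _ le_rfl (by omega) (by omega) (by omega) (h1.trans h2.symm)
      rw [h1, show o + (n : ℤ) - 1 = o by omega]
  have hv0 : v' o' = shift t (v o) := by
    rw [hw', hw, shift_add_right, add_left_inj] at base
    exact base
  induction i with
  | zero => simpa using ⟨hv0, base⟩
  | succ i ih =>
    obtain ⟨ih1, ih2⟩ := ih (by omega)
    obtain ⟨u, hu⟩ := h.exists_step (i := o + i) (by omega) (by omega)
    have hu' : e' (o' + i) = v' (o' + i) + unit u := by rw [ih1, ih2, hu, shift_add_right]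
    have hv1 : v' (o' + i + 1) = shift t (v (o + i + 1)) := by
      rw [h.next (by omega) (by omega) hu, h'.next (by omega) (by omega) hu', ih1,
        shift_add_right, shift_add_right]
    have h1 : walkConn v e o (o + n) (v (o + i + 1)) (e (o + i)) (e (o + i + 1)) :=
      ⟨o + i, by omega, by omega, rfl, .inl ⟨rfl, rfl⟩⟩
    have h2 : walkConn v' e' o' (o' + n) (v' (o' + i + 1)) (e' (o' + i)) (e' (o' + i + 1)) :=
      ⟨o' + i, by omega, by omega, rfl, .inl ⟨rfl, rfl⟩⟩
    rw [← hc, ← hv1, ← ih2] at h1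
    push_cast
    rw [← add_assoc, ← add_assoc]
    exact ⟨hv1, h'.conn_unique h2 h1⟩

/-- From `n + 3` edges keep `n` consecutive ones starting at position 1 or 2, whichever piece has
distinct end vertices; at least one edge remains beyond each end. The code stores the starting
position, the steps that may be cut off or come first in the piece, and the coordinatewise
comparison of its end edges, which fixes the orientation. -/
lemma walkWords_le_classCount (sam : Prop) : ∃ K, ∀ n, 1 ≤ n →
    (walkWords d sam (n + 3)).ncard ≤ K * classCount (InClass (d := d) 1 (locSOM sam)) n := by
  refine ⟨Fintype.card (Bool × (Fin 5 → Fin d × Bool) × (Fin d → Bool)), fun n hn => ?_⟩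
  refine ncard_le_card_mul_ncard (finite_classes_inClass (fun M h => h) n) (fun w q c =>
    ∃ v e o, ∃ s : ℕ, s = (if c.1 then 2 else 1) ∧ Walk v e o (o + (n + 3 : ℕ)) ∧
      (∀ i : Fin (n + 3), e (o + i) = v (o + i) + unit (w i)) ∧
      (w ⟨0, by omega⟩ = c.2.1 0 ∧ w ⟨1, by omega⟩ = c.2.1 1 ∧ w ⟨2, by omega⟩ = c.2.1 2 ∧
        w ⟨n + 1, by omega⟩ = c.2.1 3 ∧ w ⟨n + 2, by omega⟩ = c.2.1 4) ∧
      (∀ l, c.2.2 l = true ↔ e (o + s) l < e (o + s + n - 1) l) ∧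
      Quotient.mk (linkedSetoid d) (walkLink v e (o + s) (o + s + n)) = q) ?_ ?_
  · rintro w ⟨v, e, o, h, hw⟩
    have hs : ∃ b : Bool, v (o + (if b then 2 else 1 : ℕ)) ≠
        v (o + (if b then 2 else 1 : ℕ) + n) := by
      rcases h.toWalk.ne_or_ne (i := o + 1) (j := o + 1 + n) (by omega) (by omega)
        (by push_cast; omega) with h1 | h1
      · exact ⟨false, h1⟩
      · refine ⟨true, ?_⟩
        rw [show o + 1 + 1 = o + 2 by ring, show o + 1 + (n : ℤ) + 1 = o + 2 + n by ring] at h1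
        exact h1
    obtain ⟨b, hb⟩ := hs
    obtain ⟨s, hs, hs1, hs2⟩ : ∃ s : ℕ, s = (if b then 2 else 1) ∧ 1 ≤ s ∧ s ≤ 2 :=
      ⟨_, rfl, by cases b <;> simp, by cases b <;> simp⟩
    rw [← hs] at hb
    have hM := h.inClass (o' := o + s) (m' := o + s + n) (by omega) (by omega)
      (by push_cast; omega) hb
    refine ⟨_, ⟨walkLink v e (o + s) (o + s + n), ⟨hM, ?_⟩, rfl⟩,
      (b, ![w ⟨0, by omega⟩, w ⟨1, by omega⟩, w ⟨2, by omega⟩, w ⟨n + 1, by omega⟩,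
        w ⟨n + 2, by omega⟩], fun l => decide (e (o + s) l < e (o + s + n - 1) l)),
      v, e, o, s, hs, h.toWalk, hw, ⟨rfl, rfl, rfl, rfl, rfl⟩, fun l => by simp, rfl⟩
    have := (h.toWalk.mono (o' := o + s) (m' := o + s + n) (by omega)
      (by push_cast; omega)).card_walkLink
    omega
  · rintro w - w' - _ - c ⟨v, e, o, s, hs, h, hw, ⟨h0, h1, h2, h3, h4⟩, hc, rfl⟩
      ⟨v', e', o', s', hs', h', hw', ⟨h0', h1', h2', h3', h4'⟩, hc', hq⟩
    obtain rfl : s = s' := hs.trans hs'.symm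
    have hs12 : s = 1 ∨ s = 2 := by rw [hs]; cases c.1 <;> simp
    clear hs hs'
    obtain ⟨t, hf, hconn⟩ := Quotient.exact hq.symm
    have hm := h.mono (o' := o + s) (m' := o + s + n) (by omega) (by push_cast; omega)
    have hm' := h'.mono (o' := o' + s) (m' := o' + s + n) (by omega) (by push_cast; omega)
    have hws : w ⟨s, by omega⟩ = w' ⟨s, by omega⟩ := by
      rcases hs12 with rfl | rfl
      · exact h1.trans h1'.symm
      · exact h2.trans h2'.symm
    have key := hm.eq_shift hm' hf hconn (fun l => (hc l).symm.trans (hc' l))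
      (hw ⟨s, by omega⟩) (by rw [hws]; exact hw' ⟨s, by omega⟩)
    funext ⟨j, hj⟩
    by_cases hj0 : j < s
    · obtain rfl | rfl : j = 0 ∨ j = 1 := by omega
      · exact h0.trans h0'.symm
      · exact h1.trans h1'.symm
    by_cases hjn : s + n ≤ j
    · obtain rfl | rfl : j = n + 1 ∨ j = n + 2 := by omega
      · exact h3.trans h3'.symm
      · exact h4.trans h4'.symm
    obtain ⟨i, rfl⟩ := Nat.exists_eq_add_of_le (not_lt.1 hj0)
    obtain ⟨k1, k2⟩ := key i (by omega)
    have e1 := hw ⟨s + i, hj⟩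
    have e2 := hw' ⟨s + i, hj⟩
    push_cast at e1 e2
    rw [← add_assoc] at e1 e2
    rw [k1, k2, e1, shift_add_right, add_right_inj] at e2
    exact unit_injective e2

theorem exists_growth_locSOM_one (sam : Prop) (hd : 1 ≤ d) :
    ∃ μ : ℝ, Tendsto (fun n : ℕ => (classCount (InClass (d := d) 1 (locSOM sam)) n : ℝ) ^
      ((1 : ℝ) / n)) atTop (𝓝 μ) := by
  obtain ⟨K, hK⟩ := walkWords_le_classCount (d := d) sam
  have h2 := classCount_le_walkWords (d := d) sam
  refine exists_tendsto_rpow_of_submul (w := fun n => (walkWords d sam n).ncard) (K := K + 2)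
    (p := 3) (fun n => ?_) (fun i j => ?_) (fun n => ?_) fun n hn => ?_
  · rcases n.eq_zero_or_pos with rfl | hn
    · exact (Set.ncard_pos).2 (walkWords_zero_nonempty sam)
    · have := classCount_inClass_pos (k := 1) le_rfl hd (basic_locSOM sam) hn
      have := h2 n
      omega
  · exact (ncard_walkWords_add_le sam i j).trans (Nat.le_mul_of_pos_left _ (by omega))
  · exact (h2 n).trans (Nat.mul_le_mul_right _ (by omega))
  · exact (hK n hn).trans (Nat.mul_le_mul_right _ (by omega))

end RestrictedManifold

/-! ### The four growth constants -/

theorem mainTheorem1 (d k : ℕ) (hk : 1 ≤ k) (hkd : k ≤ d) :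
    ((∀ n : ℕ, Odd n → RestrictedManifold.countClosedSAM d k n = 0) ∧
      ∃ μ : ℝ, Tendsto (fun n : ℕ => (RestrictedManifold.countClosedSAM d k n : ℝ) ^ ((1 : ℝ) / n))
        (atTop ⊓ 𝓟 {n : ℕ | Even n}) (𝓝 μ)) ∧
    (∃ μ : ℝ, Tendsto (fun n : ℕ => (RestrictedManifold.countSAM d k n : ℝ) ^ ((1 : ℝ) / n))
      atTop (𝓝 μ)) ∧
    (∃ μ : ℝ, Tendsto (fun n : ℕ => (RestrictedManifold.countSOM d k n : ℝ) ^ ((1 : ℝ) / n))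
      atTop (𝓝 μ)) ∧
    (∃ μ : ℝ, Tendsto (fun n : ℕ => (RestrictedManifold.countXD d k n : ℝ) ^ ((1 : ℝ) / n))
      atTop (𝓝 μ)) := by
  have h2 : ∀ sam : Prop, ∃ μ : ℝ, Tendsto (fun n : ℕ =>
      (RestrictedManifold.classCount (RestrictedManifold.InClass (d := d) k
        (RestrictedManifold.locSOM sam)) n : ℝ) ^ ((1 : ℝ) / n)) atTop (𝓝 μ) := fun sam => by
    rcases hk.eq_or_lt with rfl | hlt
    · exact RestrictedManifold.exists_growth_locSOM_one sam hkd
    · exact RestrictedManifold.exists_growth_locSOM sam hlt hkd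
  refine ⟨⟨fun n hn => RestrictedManifold.countClosedSAM_odd hk hn,
    RestrictedManifold.exists_growth_countClosedSAM hk hkd⟩, ?_, ?_,
    RestrictedManifold.exists_growth_countXD hk hkd⟩
  · simpa only [RestrictedManifold.countSAM_eq] using h2 True
  · simpa only [RestrictedManifold.countSOM_eq] using h2 False
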